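/- Let $n\in\{2,3\}$ and write $x=(\tilde x,x_n)\in\mathbb R^{n-1}\times\mathbb R$. For $H\in\mathbb R$ let $U_H=\{x: x_n>H\}$, $\Gamma_H=\{x:x_n=H\}\cong\mathbb R^{n-1}$. Let $D\subset\mathbb R^n$ be a connected open set with $U_{f_+}\subset D\subset U_{f_-}$ for some constants $f_-<f_+$; for $H\ge f_+$ let $S_H=D\setminus\overline{U_H}$ and $V_H=\{\phi|_{S_H}:\phi\in H^1_0(D)\}$, and let $\gamma_-:V_H\to H^{1/2}(\Gamma_H)$ be the trace operator, i.e. the continuous extension of $\phi|_{S_H}\mapsto\phi|_{\Gamma_H}$, $\phi\in C_0^\infty(D)$ (extended by zero outside $D$). Fix $H\ge f_+$ and $k_+>0$. Let $\mathcal F\phi(\xi)=\hat\phi(\xi)=(2\pi)^{-(n-1)/2}\int_{\mathbb R^{n-1}}e^{-i\tilde x\cdot\xi}\phi(\tilde x)\,d\tilde x$ be the unitary Fourier transform on $L^2(\mathbb R^{n-1})$, and let $\sqrt{k_+^2-\xi^2}=i\sqrt{\xi^2-k_+^2}$ when $|\xi|>k_+$. Boundary value problem. Given complex-valued $g\in L^2(D)$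 and $k\in L^\infty(D)$ with $\operatorname{supp} g\subset\overline{S_H}$ and $k=k_+$ on $\overline{U_H}\cap D$, find $u:D\to\mathbb C$ such that $u|_{S_a}\in V_a$ for every $a>f_+$, $\Delta u+k^2u=g$ in $D$ in the sense of distributions, and, with $F_H=u|_{\Gamma_H}$ (in the sense of traces), $$u(x)=\frac1{(2\pi)^{(n-1)/2}}\int_{\mathbb R^{n-1}}\exp\bigl(i[(x_n-H)\sqrt{k_+^2-\xi^2}+\tilde x\cdot\xi]\bigr)\hat F_H(\xi)\,d\xi\quad\text{for (almost every) }x\in U_H.\qquad(*)$$ Variational problem. Given complex-valued $g\in L^2(S_H)$ and $k\in L^\infty(S_H)$, find $u\in V_H$ such that $b(u,v)=-(g,v)$ for all $v\in V_H$, where $(u,v)=\int_{S_H}u\bar v\,dx$, $$b(u,v)=(\nabla u,\nabla v)-(k^2u,v)+\int_{\Gamma_H}\overline{\gamma_-v}\;T\gamma_-u\,ds,$$ $T=\mathcal F^{-1}M_z\mathcal F:H^{1/2}(\Gamma_H)\to H^{-1/2}(\Gamma_H)$, $M_z$ is multiplication by $z(\xi)=-i\sqrt{k_+^2-\xi^2}$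 for $|\xi|\le k_+$, $z(\xi)=\sqrt{\xi^2-k_+^2}$ for $|\xi|>k_+$, and the integral over $\Gamma_H$ is the duality pairing of $H^{-1/2}(\Gamma_H)$ and $H^{1/2}(\Gamma_H)$ extending the $L^2(\Gamma_H)$ scalar product. Theorem. (i) If $u$ is a solution of the boundary value problem, with data $g$ and $k$, then $u|_{S_H}$ is a solution of the variational problem, with data $g|_{S_H}$ and $k|_{S_H}$. (ii) Conversely, let $g\in L^2(S_H)$, $k\in L^\infty(S_H)$, and let $u\in V_H$ be a solution of the variational problem. Put $F_H:=\gamma_-u$ and extend $u$ to $D$ by setting $u(x)$ equal to the right hand side of $(*)$ for $x\in U_H$. Then the extended function is a solution of the boundary value problem, with $g$ extended by zero from $S_H$ to $D$ and $k$ extended from $S_H$ to $D$ by the value $k_+$. -/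

import Mathlib

open MeasureTheory Filter Topology
open scoped ENNReal ContDiff FourierTransform ComplexConjugate

noncomputable section

namespace RoughLayer

/-- The horizontal variables, `ℝ^{n-1}` with its Euclidean norm, where `d = n - 1`. -/
abbrev Horiz (d : ℕ) : Type := EuclideanSpace ℝ (Fin d)

/-- The space `ℝ^n`, `n = d + 1`, whose points are written `x = (x̃, x_n)` with `x̃ = x.1` and
`x_n = x.2`. Its `volume` is the `n`-dimensional Lebesgue measure; only the topology and the
smooth structure of the product are used, not its (supremum) norm. -/
abbrev Space (d : ℕ) : Type := Horiz d × ℝ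

/-- The `n` coordinate directions of `ℝ^n`: `Sum.inl i` is the `i`-th horizontal direction and
`Sum.inr ()` is the vertical direction. -/
def dir {d : ℕ} : Fin d ⊕ Unit → Space d
  | Sum.inl i => (EuclideanSpace.single i 1, 0)
  | Sum.inr _ => (0, 1)

/-- The half-space `U_H = {x : x_n > H}`. -/
def U (d : ℕ) (H : ℝ) : Set (Space d) := {x | H < x.2}

/-- The layer `S_H = D \ closure U_H`. -/
def S {d : ℕ} (D : Set (Space d)) (H : ℝ) : Set (Space d) := D \ closure (U d H)

/-! ### Function spaces

Functions are represented by total functions on `ℝ^n`; a function on an open set `Ω` is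
represented by any total function agreeing with it almost everywhere on `Ω`, and every notion
below depends on the values in `Ω` up to null sets only. -/

/-- `φ ∈ C_0^∞(Ω)`, complex valued (extended by zero to the whole space). -/
structure IsTest {d : ℕ} (Ω : Set (Space d)) (φ : Space d → ℂ) : Prop where
  smooth : ContDiff ℝ ∞ φ
  compact : HasCompactSupport φ
  subset : tsupport φ ⊆ Ω

/-- The classical partial derivative in the direction `i`. -/
def pd {d : ℕ} (i : Fin d ⊕ Unit) (φ : Space d → ℂ) (x : Space d) : ℂ := fderiv ℝ φ x (dir i)

/-- The classical Laplacian. -/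
def lap {d : ℕ} (φ : Space d → ℂ) (x : Space d) : ℂ := ∑ i, pd i (pd i φ) x

/-- `u'` is the weak (distributional) partial derivative of `u` in the direction `i` on `Ω`. -/
structure HasWeakDeriv {d : ℕ} (Ω : Set (Space d)) (i : Fin d ⊕ Unit) (u u' : Space d → ℂ) :
    Prop where
  locInt : LocallyIntegrableOn u Ω
  locInt' : LocallyIntegrableOn u' Ω
  integral_eq : ∀ φ, IsTest Ω φ → ∫ x in Ω, u x * pd i φ x = -∫ x in Ω, u' x * φ x

open Classical in
/-- The weak partial derivative of `u` in the direction `i` on `Ω`, unique up to null sets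
(and the zero function if there is none). -/
def weakDeriv {d : ℕ} (Ω : Set (Space d)) (i : Fin d ⊕ Unit) (u : Space d → ℂ) : Space d → ℂ :=
  if h : ∃ u', HasWeakDeriv Ω i u u' then h.choose else 0

/-- `u ∈ H^1(Ω)`: `u` and all its first weak partial derivatives are in `L^2(Ω)`. -/
structure MemH1 {d : ℕ} (Ω : Set (Space d)) (u : Space d → ℂ) : Prop where
  memLp : MemLp u 2 (volume.restrict Ω)
  hasWeakDeriv : ∀ i, HasWeakDeriv Ω i u (weakDeriv Ω i u)
  memLp_weakDeriv : ∀ i, MemLp (weakDeriv Ω i u) 2 (volume.restrict Ω)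

/-- The smooth functions `φ_m` converge to `u` in the norm of `H^1(Ω)`. -/
structure TendstoH1 {d : ℕ} (Ω : Set (Space d)) (φ : ℕ → Space d → ℂ) (u : Space d → ℂ) :
    Prop where
  tendsto : Tendsto (fun m => eLpNorm (fun x => φ m x - u x) 2 (volume.restrict Ω)) atTop (𝓝 0)
  tendsto_deriv : ∀ i, Tendsto
    (fun m => eLpNorm (fun x => pd i (φ m) x - weakDeriv Ω i u x) 2 (volume.restrict Ω))
    atTop (𝓝 0)

/-- `u ∈ H_0^1(D)`, the closure of `C_0^∞(D)` in `H^1(D)`. -/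
def MemH10 {d : ℕ} (D : Set (Space d)) (u : Space d → ℂ) : Prop :=
  MemH1 D u ∧ ∃ φ : ℕ → Space d → ℂ, (∀ m, IsTest D (φ m)) ∧ TendstoH1 D φ u

/-- `w ∈ V_H = {φ|_{S_H} : φ ∈ H_0^1(D)}`; more precisely, `w|_{S_H} ∈ V_H`. -/
def MemV {d : ℕ} (D : Set (Space d)) (H : ℝ) (w : Space d → ℂ) : Prop :=
  ∃ φ, MemH10 D φ ∧ w =ᵐ[volume.restrict (S D H)] φ

/-! ### Traces, the Fourier transform and the Dirichlet to Neumann map on `Γ_H`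

The plane `Γ_H = {x : x_n = H}` is identified with `ℝ^{n-1}`. -/

/-- `F` is the trace `γ_- w` on `Γ_H` of `w ∈ V_H`. The trace operator is the continuous extension
of `φ|_{S_H} ↦ φ|_{Γ_H}`, `φ ∈ C_0^∞(D)`, where `φ` is extended by zero outside `D`: there are
`φ_m ∈ C_0^∞(D)` converging to `w` in `H^1(S_H)` whose restrictions to `Γ_H` converge to `F`. -/
def IsTrace {d : ℕ} (D : Set (Space d)) (H : ℝ) (w : Space d → ℂ)
    (F : Lp ℂ 2 (volume : Measure (Horiz d))) : Prop :=
  ∃ φ : ℕ → Space d → ℂ, (∀ m, IsTest D (φ m)) ∧ TendstoH1 (S D H) φ w ∧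
    Tendsto (fun m => eLpNorm (fun y => φ m (y, H) - F y) 2 volume) atTop (𝓝 0)

open Classical in
/-- The trace `γ_- w` on `Γ_H` of `w ∈ V_H` (zero if `w` has no trace, which does not happen for
`w ∈ V_H`). The trace lies in `H^{1/2}(Γ_H)`, a subspace of `L^2(Γ_H)`. -/
def trace {d : ℕ} (D : Set (Space d)) (H : ℝ) (w : Space d → ℂ) :
    Lp ℂ 2 (volume : Measure (Horiz d)) :=
  if h : ∃ F, IsTrace D H w F then h.choose else 0

/-- The unitary Fourier transform on `L^2(ℝ^{n-1})`,
`F̂(ξ) = (2π)^{-(n-1)/2} ∫ exp(-i x̃·ξ) F(x̃) dx̃`, obtained from Mathlib's Fourier transform on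
`L^2`, whose kernel is `exp(-2πi x̃·ξ)`, by rescaling. -/
def fourierHat {d : ℕ} (F : Lp ℂ 2 (volume : Measure (Horiz d))) (ξ : Horiz d) : ℂ :=
  (((2 * Real.pi) ^ (-(d : ℝ) / 2) : ℝ) : ℂ) *
    (𝓕 F : Lp ℂ 2 (volume : Measure (Horiz d))) ((2 * Real.pi)⁻¹ • ξ)

/-- `√(k₊² - ξ²)`, equal to `i √(ξ² - k₊²)` when `|ξ| > k₊`. -/
def root {d : ℕ} (kp : ℝ) (ξ : Horiz d) : ℂ :=
  if ‖ξ‖ ≤ kp then (Real.sqrt (kp ^ 2 - ‖ξ‖ ^ 2) : ℂ)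
  else Complex.I * (Real.sqrt (‖ξ‖ ^ 2 - kp ^ 2) : ℂ)

/-- The upward propagating plane wave representation
`(2π)^{-(n-1)/2} ∫ exp(i[(x_n - H) √(k₊² - ξ²) + x̃·ξ]) F̂(ξ) dξ`. -/
def planeWaves {d : ℕ} (kp H : ℝ) (F : Lp ℂ 2 (volume : Measure (Horiz d))) (x : Space d) : ℂ :=
  (((2 * Real.pi) ^ (-(d : ℝ) / 2) : ℝ) : ℂ) *
    ∫ ξ : Horiz d,
      Complex.exp (Complex.I * (((x.2 - H : ℝ) : ℂ) * root kp ξ + ((inner ℝ x.1 ξ : ℝ) : ℂ))) *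
        fourierHat F ξ

/-- The symbol `z` of the Dirichlet to Neumann map. -/
def z {d : ℕ} (kp : ℝ) (ξ : Horiz d) : ℂ :=
  if ‖ξ‖ ≤ kp then -Complex.I * (Real.sqrt (kp ^ 2 - ‖ξ‖ ^ 2) : ℂ)
  else (Real.sqrt (‖ξ‖ ^ 2 - kp ^ 2) : ℂ)

/-- The Fourier transform of `T F ∈ H^{-1/2}(Γ_H)`, where `T = 𝓕⁻¹ M_z 𝓕` and
`F ∈ H^{1/2}(Γ_H)`. Elements of `H^s(Γ_H)` are identified with their Fourier transforms,
the measurable functions that are square integrable with the weight `(k₊² + ξ²)^s`. -/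
def dtnHat {d : ℕ} (kp : ℝ) (F : Lp ℂ 2 (volume : Measure (Horiz d))) (ξ : Horiz d) : ℂ :=
  z kp ξ * fourierHat F ξ

/-- The integral `∫_{Γ_H} Ḡ T F ds` for `F, G ∈ H^{1/2}(Γ_H)`, that is, the duality pairing of
`H^{-1/2}(Γ_H)` and `H^{1/2}(Γ_H)` extending the scalar product of `L^2(Γ_H)`; by Plancherel's
identity it is the integral of the product of the Fourier transforms. -/
def dtnPairing {d : ℕ} (kp : ℝ) (F G : Lp ℂ 2 (volume : Measure (Horiz d))) : ℂ :=
  ∫ ξ : Horiz d, dtnHat kp F ξ * conj (fourierHat G ξ)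

/-! ### The two problems -/

/-- The scalar product `(u, v)` of `L^2(S_H)`. -/
def innerS {d : ℕ} (D : Set (Space d)) (H : ℝ) (u v : Space d → ℂ) : ℂ :=
  ∫ x in S D H, u x * conj (v x)

/-- The sesquilinear form
`b(u, v) = (∇u, ∇v) - (k² u, v) + ∫_{Γ_H} γ_-v̄ T γ_-u ds` on `V_H`. -/
def b {d : ℕ} (D : Set (Space d)) (H kp : ℝ) (k u v : Space d → ℂ) : ℂ :=
  (∑ i, innerS D H (weakDeriv (S D H) i u) (weakDeriv (S D H) i v))
    - innerS D H (fun x => k x ^ 2 * u x) v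
    + dtnPairing kp (trace D H u) (trace D H v)

/-- The variational problem for data `g, k` on `S_H`:
`u ∈ V_H` and `b(u, v) = -(g, v)` for all `v ∈ V_H`. -/
def IsVariationalSolution {d : ℕ} (D : Set (Space d)) (H kp : ℝ) (g k u : Space d → ℂ) : Prop :=
  MemV D H u ∧ ∀ v, MemV D H v → b D H kp k u v = -innerS D H g v

/-- Admissible data on `D`: `g ∈ L^2(D)` with support in the closure of `S_H`, and
`k ∈ L^∞(D)` with `k = k₊` on the closure of `U_H`. -/
structure AdmissibleData {d : ℕ} (D : Set (Space d)) (H kp : ℝ) (g k : Space d → ℂ) : Prop where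
  memLp_g : MemLp g 2 (volume.restrict D)
  supp_g : ∀ᵐ x ∂(volume.restrict D), x ∉ closure (S D H) → g x = 0
  memLp_k : MemLp k ∞ (volume.restrict D)
  k_eq : ∀ᵐ x ∂(volume.restrict D), x ∈ closure (U d H) → k x = kp

/-- `u` solves the boundary value problem with data `g, k` (and parameters `H ≥ f₊`, `k₊`). -/
structure IsBVPSolution {d : ℕ} (D : Set (Space d)) (fp H kp : ℝ) (g k u : Space d → ℂ) :
    Prop where
  /-- `u|_{S_a} ∈ V_a` for every `a > f₊`. -/
  memV : ∀ a, fp < a → MemV D a u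
  /-- `Δu + k²u = g` in `D` in the sense of distributions. -/
  helmholtz : ∀ φ, IsTest D φ →
    ∫ x in D, (u x * lap φ x + k x ^ 2 * u x * φ x) = ∫ x in D, g x * φ x
  /-- The upward propagating radiation condition, with `F_H = u|_{Γ_H}`. -/
  radiation : ∀ᵐ x ∂(volume.restrict (U d H)), u x = planeWaves kp H (trace D H u) x

open Classical in
/-- The extension of a function `w` on `S_H` to `D` that, in `U_H`, is the plane wave
representation with density `F_H = γ_- w`. -/
def extendSol {d : ℕ} (D : Set (Space d)) (H kp : ℝ) (w : Space d → ℂ) (x : Space d) : ℂ :=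
  if x ∈ U d H then planeWaves kp H (trace D H w) x else w x

open Classical in
/-- The extension of `g` by zero from `S_H`. -/
def extendG {d : ℕ} (D : Set (Space d)) (H : ℝ) (g : Space d → ℂ) (x : Space d) : ℂ :=
  if x ∈ S D H then g x else 0

open Classical in
/-- The extension of `k` from `S_H` by the constant `k₊`. -/
def extendK {d : ℕ} (D : Set (Space d)) (H kp : ℝ) (k : Space d → ℂ) (x : Space d) : ℂ :=
  if x ∈ S D H then k x else (kp : ℂ)

end RoughLayer

end

noncomputable section

namespace RoughLayer

variable {d : ℕ}

/-! Everything rests on one identity, `helmholtz_eq_form`: if `u` lies in `V_a` for all `a > f₊` and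
is given above `Γ_H` by the plane waves of its own trace, then `∫_D (u Δv̄ + k² u v̄) = -b(u, v)`
for every test function `v` of `D`. The integral is split at `Γ_H`. Below, Green's formula holds for
test functions in place of `u` and passes to the `H¹` limit (`green_lower`), leaving `-(∇u, ∇v)` and
the boundary term `∫ γ₋u ∂_n v̄`. Above, the Fourier transform in `x̃` turns `u` into `exp(-(x_n -
H) Z) F̂` and `Δ + k₊²` into `∂_n² - Z²`. As `Z²` is real, the vertical integral has an explicit
antiderivative (`integral_vertical`), and `green_upper` yields the opposite normal derivative term
and minus the Dirichlet to Neumann pairing. By Parseval the normal derivative terms cancel.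

Direction (i) is then immediate for test functions `v`, and follows for `v ∈ V_H` by density. The
only delicate term is the pairing, whose symbol grows like `|ξ|`. It is continuous because `H¹(S_H)`
convergence gives `H^{1/2}` convergence of traces (`IsTest.trace_bound`), a consequence of the
fundamental theorem of calculus for `ĝ(η, ·)²`.

Direction (ii) reads the identity backwards, but first needs the extended function to be in `V_a`
for every `a`. For a test function `φ`, the plane wave extension of its trace, cut off at a finite
height, differs from `φ` in `U_H` by a `C¹` function vanishing linearly at `Γ_H`. Cutoffs and
mollification put this difference in `H_0^1(U_H)`, and it extends by zero to `D`
(`IsTest.approxH1_glue`). A bound of the cut off extension in `H¹` by the `H^{1/2}` norm of the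
trace (`exists_cutWave_bound`) carries this over to limits (`MemH10.memH10_glue`). The bound is
Plancherel at each height together with `∫ exp(-2(t - H) Re Z) dt ≤ C / (1 + 2π|η|)` over a strip of
finite thickness.

The frequency used throughout is `η = ξ / 2π`, that of Mathlib's kernel `exp(-2πi x̃·η)`. -/

instance : (volume : Measure (Space d)).IsAddHaarMeasure :=
  inferInstanceAs (Measure.IsAddHaarMeasure
    ((volume : Measure (Horiz d)).prod (volume : Measure ℝ)))

/-! ### Convergence in `L²` -/

/-- Hölder turns `L²` convergence of one factor into `L¹` convergence of the product. With this,
identities known for test functions pass to limits in `H¹`. -/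
lemma tendsto_integral_mul {α : Type*} [MeasurableSpace α] {μ : Measure α}
    {f : ℕ → α → ℂ} {f₀ h : α → ℂ} (hf : ∀ m, MemLp (f m) 2 μ) (hf₀ : MemLp f₀ 2 μ)
    (hh : MemLp h 2 μ) (hlim : Tendsto (fun m => eLpNorm (fun x => f m x - f₀ x) 2 μ) atTop (𝓝 0)) :
    Tendsto (fun m => ∫ x, f m x * h x ∂μ) atTop (𝓝 (∫ x, f₀ x * h x ∂μ)) := by
  have hi : ∀ {g : α → ℂ}, MemLp g 2 μ → Integrable (fun x => g x * h x) μ :=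
    fun hg => hg.integrable_mul hh
  have h2 : Tendsto (fun m => eLpNorm (fun x => f m x - f₀ x) 2 μ * eLpNorm h 2 μ) atTop (𝓝 0) := by
    simpa using ENNReal.Tendsto.mul_const hlim (Or.inr hh.2.ne)
  refine tendsto_integral_of_L1' (fun x => f₀ x * h x) (hi hf₀).1 (F := fun m x => f m x * h x)
    (.of_forall fun m => hi (hf m)) ?_
  refine tendsto_of_tendsto_of_tendsto_of_le_of_le tendsto_const_nhds h2 (fun _ => zero_le) ?_
  intro m
  have h3 := eLpNorm_smul_le_mul_eLpNorm (p := 2) (q := 2) (r := 1) hh.1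
    ((hf m).1.sub hf₀.1)
  have h4 : (f m - f₀) • h = (fun x => f m x * h x) - fun x => f₀ x * h x := by
    funext x
    simp [sub_mul]
  rw [h4] at h3
  exact h3

lemma eLpNorm_sub_le_add {α : Type*} [MeasurableSpace α] {μ : Measure α} {u v w : α → ℂ}
    (hu : AEStronglyMeasurable u μ) (hv : AEStronglyMeasurable v μ)
    (hw : AEStronglyMeasurable w μ) :
    eLpNorm (fun x => u x - w x) 2 μ ≤
      eLpNorm (fun x => u x - v x) 2 μ + eLpNorm (fun x => v x - w x) 2 μ := by
  refine le_trans (le_of_eq ?_) (eLpNorm_add_le (hu.sub hv) (hv.sub hw) (by norm_num))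
  congr 1
  funext x
  simp

lemma eLpNorm_sub_comm' {α : Type*} [MeasurableSpace α] {μ : Measure α} (u v : α → ℂ) :
    eLpNorm (fun x => u x - v x) 2 μ = eLpNorm (fun x => v x - u x) 2 μ :=
  eLpNorm_sub_comm u v 2 μ

lemma eLpNorm_two_sq {α : Type*} [MeasurableSpace α] (μ : Measure α) (f : α → ℂ) :
    eLpNorm f 2 μ ^ 2 = ∫⁻ x, ‖f x‖ₑ ^ 2 ∂μ := by
  rw [eLpNorm_eq_lintegral_rpow_enorm_toReal (by norm_num) (by norm_num)]
  simp only [ENNReal.toReal_ofNat, ENNReal.rpow_ofNat, one_div]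
  rw [← ENNReal.rpow_natCast, ← ENNReal.rpow_mul]
  norm_num

lemma ae_eq_of_tendsto_eLpNorm {α : Type*} [MeasurableSpace α] {μ : Measure α}
    {f : ℕ → α → ℂ} {u v : α → ℂ} (hf : ∀ m, AEStronglyMeasurable (f m) μ)
    (hu : AEStronglyMeasurable u μ) (hv : AEStronglyMeasurable v μ)
    (h1 : Tendsto (fun m => eLpNorm (fun x => f m x - u x) 2 μ) atTop (𝓝 0))
    (h2 : Tendsto (fun m => eLpNorm (fun x => f m x - v x) 2 μ) atTop (𝓝 0)) : u =ᵐ[μ] v := by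
  have h3 : eLpNorm (u - v) 2 μ = 0 := by
    refine le_antisymm (ge_of_tendsto' (by simpa using h1.add h2) fun m => ?_) zero_le
    rw [eLpNorm_sub_comm' (f m) u]
    exact eLpNorm_sub_le_add hu (hf m) hv
  rw [eLpNorm_eq_zero_iff (hu.sub hv) (by norm_num)] at h3
  filter_upwards [h3] with x hx
  simpa [sub_eq_zero] using hx

/-! ### The domains -/

lemma closure_U (H : ℝ) : closure (U d H) = {x | H ≤ x.2} := by
  have h1 : U d H = Set.univ ×ˢ Set.Ioi H := by ext x; simp [U]
  rw [h1, closure_prod_eq, closure_univ, closure_Ioi]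
  ext x; simp

lemma isOpen_U (H : ℝ) : IsOpen (U d H) := isOpen_lt continuous_const continuous_snd

lemma S_eq (D : Set (Space d)) (H : ℝ) : S D H = D ∩ {x | x.2 < H} := by
  ext x; simp [S, closure_U]

lemma isOpen_S {D : Set (Space d)} (hD : IsOpen D) (H : ℝ) : IsOpen (S D H) :=
  hD.sdiff isClosed_closure

lemma S_subset (D : Set (Space d)) (H : ℝ) : S D H ⊆ D := Set.sdiff_subset

lemma S_mono (D : Set (Space d)) {H a : ℝ} (h : H ≤ a) : S D H ⊆ S D a := by
  simp only [S_eq]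
  exact fun x hx => ⟨hx.1, lt_of_lt_of_le hx.2 h⟩

/-! ### Test functions -/

namespace IsTest

variable {Ω Ω' : Set (Space d)} {φ ψ : Space d → ℂ}

lemma mono (h : IsTest Ω φ) (hΩ : Ω ⊆ Ω') : IsTest Ω' φ := ⟨h.1, h.2, h.3.trans hΩ⟩

lemma continuous (h : IsTest Ω φ) : Continuous φ := h.smooth.continuous

lemma differentiable (h : IsTest Ω φ) : Differentiable ℝ φ :=
  h.smooth.differentiable (by simp)

lemma pderiv (h : IsTest Ω φ) (i : Fin d ⊕ Unit) : IsTest Ω (pd i φ) where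
  smooth := (h.smooth.fderiv_right (m := ∞) (by simp)).clm_apply contDiff_const
  compact := h.compact.fderiv_apply ℝ _
  subset := (tsupport_fderiv_apply_subset ℝ _).trans h.subset

lemma star (h : IsTest Ω φ) : IsTest Ω (fun x => conj (φ x)) where
  smooth := Complex.conjCLE.contDiff.comp h.smooth
  compact := h.compact.comp_left (g := fun z : ℂ => (starRingEnd ℂ) z) (by simp)
  subset := (closure_mono (Function.support_comp_subset (g := fun z : ℂ => (starRingEnd ℂ) z)
    (by simp) φ)).trans h.subset

lemma memLp (h : IsTest Ω φ) (μ : Measure (Space d)) [IsFiniteMeasureOnCompacts μ] :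
    MemLp φ 2 μ := h.continuous.memLp_of_hasCompactSupport h.compact

lemma integrable (h : IsTest Ω φ) (μ : Measure (Space d)) [IsFiniteMeasureOnCompacts μ] :
    Integrable φ μ := h.continuous.integrable_of_hasCompactSupport h.compact

lemma sub (h : IsTest Ω φ) (h' : IsTest Ω ψ) : IsTest Ω (fun x => φ x - ψ x) where
  smooth := h.smooth.sub h'.smooth
  compact := by
    simpa [sub_eq_add_neg, Function.comp_def, Pi.add_def] using
      h.compact.add (h'.compact.comp_left (g := fun z : ℂ => -z) (by simp))
  subset := (tsupport_sub φ ψ).trans (Set.union_subset h.subset h'.subset)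

lemma add (h : IsTest Ω φ) (h' : IsTest Ω ψ) : IsTest Ω (fun x => φ x + ψ x) where
  smooth := h.smooth.add h'.smooth
  compact := h.compact.add h'.compact
  subset := (tsupport_add φ ψ).trans (Set.union_subset h.subset h'.subset)

lemma mul (h : IsTest Ω φ) (h' : IsTest Ω' ψ) : IsTest Ω (fun x => φ x * ψ x) where
  smooth := h.smooth.mul h'.smooth
  compact := h.compact.mul_right
  subset := (tsupport_mul_subset_left).trans h.subset

lemma eq_zero (h : IsTest Ω φ) {x : Space d} (hx : x ∉ Ω) : φ x = 0 :=
  image_eq_zero_of_notMem_tsupport fun h' => hx (h.subset h')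

end IsTest

lemma pd_sub {φ ψ : Space d → ℂ} (i : Fin d ⊕ Unit) {x : Space d} (h : DifferentiableAt ℝ φ x)
    (h' : DifferentiableAt ℝ ψ x) :
    pd i (fun x => φ x - ψ x) x = pd i φ x - pd i ψ x := by
  simp [pd, fderiv_fun_sub h h']

lemma pd_add {φ ψ : Space d → ℂ} (i : Fin d ⊕ Unit) {x : Space d} (h : DifferentiableAt ℝ φ x)
    (h' : DifferentiableAt ℝ ψ x) :
    pd i (fun x => φ x + ψ x) x = pd i φ x + pd i ψ x := by
  simp [pd, fderiv_fun_add h h']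

lemma pd_mul {φ ψ : Space d → ℂ} (i : Fin d ⊕ Unit) {x : Space d} (h : DifferentiableAt ℝ φ x)
    (h' : DifferentiableAt ℝ ψ x) :
    pd i (fun x => φ x * ψ x) x = φ x * pd i ψ x + pd i φ x * ψ x := by
  simp [pd, fderiv_fun_mul h h', mul_comm]

lemma pd_conj {φ : Space d → ℂ} (i : Fin d ⊕ Unit) (x : Space d) (h : DifferentiableAt ℝ φ x) :
    pd i (fun x => conj (φ x)) x = conj (pd i φ x) := by
  have := (Complex.conjCLE.toContinuousLinearMap.hasFDerivAt.comp x h.hasFDerivAt).fderiv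
  simp only [pd]
  change fderiv ℝ ((Complex.conjCLE.toContinuousLinearMap : ℂ → ℂ) ∘ φ) x (dir i) = _
  rw [this]
  simp

lemma setIntegral_eq_of_test {Ω : Set (Space d)} {φ : Space d → ℂ} (h : IsTest Ω φ)
    (f : Space d → ℂ) : ∫ x in Ω, f x * φ x = ∫ x, f x * φ x :=
  setIntegral_eq_integral_of_forall_compl_eq_zero fun x hx => by rw [h.eq_zero hx, mul_zero]

/-! ### Weak derivatives -/

lemma integrable_mul_test {Ω : Set (Space d)} {u φ : Space d → ℂ}
    (hu : LocallyIntegrableOn u Ω) (h : IsTest Ω φ) : Integrable (fun x => u x * φ x) := by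
  rw [← integrableOn_iff_integrable_of_support_subset (s := tsupport φ)]
  · exact (hu.integrableOn_compact_subset h.subset h.compact).mul_continuousOn
      h.continuous.continuousOn h.compact
  · exact (Function.support_mul_subset_right u φ).trans (subset_tsupport φ)

/-- Fundamental lemma of the calculus of variations: real test functions already separate the two
candidates. This makes the arbitrary choice inside `weakDeriv` harmless. -/
lemma HasWeakDeriv.ae_unique {Ω : Set (Space d)} (hΩ : IsOpen Ω) {i : Fin d ⊕ Unit}
    {u u₁ u₂ : Space d → ℂ} (h₁ : HasWeakDeriv Ω i u u₁) (h₂ : HasWeakDeriv Ω i u u₂) :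
    u₁ =ᵐ[volume.restrict Ω] u₂ := by
  have key := hΩ.ae_eq_zero_of_integral_contDiff_smul_eq_zero (μ := volume)
    (f := fun x => u₁ x - u₂ x) (h₁.locInt'.sub h₂.locInt') ?_
  · rw [EventuallyEq, ae_restrict_iff' hΩ.measurableSet]
    filter_upwards [key] with x hx hxΩ
    exact sub_eq_zero.1 (hx hxΩ)
  · intro g hg hgc hgs
    have hφ : IsTest Ω (fun x => (g x : ℂ)) :=
      ⟨Complex.ofRealCLM.contDiff.comp hg, hgc.comp_left (g := fun r : ℝ => (r : ℂ)) (by simp),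
        (closure_mono (Function.support_comp_subset (g := fun r : ℝ => (r : ℂ)) (by simp) g)).trans
          hgs⟩
    have e1 := h₁.integral_eq _ hφ
    rw [h₂.integral_eq _ hφ, neg_inj, setIntegral_eq_of_test hφ, setIntegral_eq_of_test hφ] at e1
    have e2 : ∀ x, g x • (u₁ x - u₂ x) = u₁ x * (g x : ℂ) - u₂ x * (g x : ℂ) := fun x => by
      rw [Complex.real_smul]; ring
    simp_rw [e2]
    rw [integral_sub (integrable_mul_test h₁.locInt' hφ) (integrable_mul_test h₂.locInt' hφ), e1,
      sub_self]

lemma weakDeriv_spec {Ω : Set (Space d)} {i : Fin d ⊕ Unit} {u u' : Space d → ℂ}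
    (h : HasWeakDeriv Ω i u u') : HasWeakDeriv Ω i u (weakDeriv Ω i u) := by
  have h' : ∃ u', HasWeakDeriv Ω i u u' := ⟨u', h⟩
  rw [weakDeriv, dif_pos h']
  exact h'.choose_spec

lemma HasWeakDeriv.congr {Ω : Set (Space d)} (hΩ : IsOpen Ω) {i : Fin d ⊕ Unit}
    {u v u' : Space d → ℂ} (h : HasWeakDeriv Ω i u u') (huv : u =ᵐ[volume.restrict Ω] v) :
    HasWeakDeriv Ω i v u' where
  locInt := by
    refine (locallyIntegrableOn_iff hΩ.isLocallyClosed).2 fun K hK hKc => ?_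
    exact (h.locInt.integrableOn_compact_subset hK hKc).congr
      (ae_restrict_of_ae_restrict_of_subset hK huv)
  locInt' := h.locInt'
  integral_eq φ hφ := by
    rw [← h.integral_eq φ hφ]
    refine integral_congr_ae ?_
    filter_upwards [huv] with x hx
    rw [hx]

lemma weakDeriv_congr {Ω : Set (Space d)} (hΩ : IsOpen Ω) {i : Fin d ⊕ Unit} {u v u' : Space d → ℂ}
    (h : HasWeakDeriv Ω i u u') (huv : u =ᵐ[volume.restrict Ω] v) :
    weakDeriv Ω i u =ᵐ[volume.restrict Ω] weakDeriv Ω i v :=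
  (weakDeriv_spec h).ae_unique hΩ
    ((weakDeriv_spec (h.congr hΩ huv)).congr hΩ huv.symm)

lemma locallyIntegrableOn_of_memLp {Ω : Set (Space d)} {u : Space d → ℂ}
    (h : MemLp u 2 (volume.restrict Ω)) : LocallyIntegrableOn u Ω :=
  locallyIntegrableOn_of_locallyIntegrable_restrict (h.locallyIntegrable (by norm_num))

lemma integral_test_mul_pd {φ ψ : Space d → ℂ} {Ω Ω' : Set (Space d)} (hφ : IsTest Ω φ)
    (hψ : IsTest Ω' ψ) (i : Fin d ⊕ Unit) :
    ∫ x, φ x * pd i ψ x = -∫ x, pd i φ x * ψ x :=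
  integral_mul_fderiv_eq_neg_fderiv_mul_of_integrable
    (((hφ.pderiv i).mul hψ).integrable volume) ((hφ.mul (hψ.pderiv i)).integrable volume)
    ((hφ.mul hψ).integrable volume) (fun x _ => hφ.differentiable x)
    (fun x _ => hψ.differentiable x)

/-! ### Limits of test functions in `H¹` -/

/-- `u` and `u' i` are the limits in `L²(Ω)` of test functions of `D` and of their partial
derivatives. -/
structure ApproxH1 (D Ω : Set (Space d)) (u : Space d → ℂ) (u' : Fin d ⊕ Unit → Space d → ℂ) :
    Prop where
  memLp : MemLp u 2 (volume.restrict Ω)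
  memLp' : ∀ i, MemLp (u' i) 2 (volume.restrict Ω)
  approx : ∀ ε : ℝ≥0∞, 0 < ε → ∃ φ, IsTest D φ ∧
    eLpNorm (fun x => φ x - u x) 2 (volume.restrict Ω) ≤ ε ∧
    ∀ i, eLpNorm (fun x => pd i φ x - u' i x) 2 (volume.restrict Ω) ≤ ε

namespace ApproxH1

variable {D Ω : Set (Space d)} {u v : Space d → ℂ} {u' v' : Fin d ⊕ Unit → Space d → ℂ}

lemma exists_seq (h : ApproxH1 D Ω u u') : ∃ φ : ℕ → Space d → ℂ, (∀ m, IsTest D (φ m)) ∧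
    Tendsto (fun m => eLpNorm (fun x => φ m x - u x) 2 (volume.restrict Ω)) atTop (𝓝 0) ∧
    ∀ i, Tendsto (fun m => eLpNorm (fun x => pd i (φ m) x - u' i x) 2 (volume.restrict Ω))
      atTop (𝓝 0) := by
  choose φ h1 h2 h3 using fun m : ℕ => h.approx ((m : ℝ≥0∞)⁻¹) (by simp)
  have h0 := ENNReal.tendsto_inv_nat_nhds_zero
  exact ⟨φ, h1, tendsto_of_tendsto_of_tendsto_of_le_of_le tendsto_const_nhds h0
      (fun _ => zero_le) h2, fun i => tendsto_of_tendsto_of_tendsto_of_le_of_le tendsto_const_nhds h0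
      (fun _ => zero_le) fun m => h3 m i⟩

lemma of_seq (hu : MemLp u 2 (volume.restrict Ω)) (hu' : ∀ i, MemLp (u' i) 2 (volume.restrict Ω))
    {φ : ℕ → Space d → ℂ} (h1 : ∀ m, IsTest D (φ m))
    (h2 : Tendsto (fun m => eLpNorm (fun x => φ m x - u x) 2 (volume.restrict Ω)) atTop (𝓝 0))
    (h3 : ∀ i, Tendsto (fun m => eLpNorm (fun x => pd i (φ m) x - u' i x) 2 (volume.restrict Ω))
      atTop (𝓝 0)) : ApproxH1 D Ω u u' := by
  refine ⟨hu, hu', fun ε hε => ?_⟩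
  have e2 := h2.eventually (Iic_mem_nhds hε)
  have e3 := eventually_all.2 fun i => (h3 i).eventually (Iic_mem_nhds hε)
  obtain ⟨m, hm2, hm3⟩ := (e2.and e3).exists
  exact ⟨φ m, h1 m, hm2, hm3⟩

lemma mono (h : ApproxH1 D Ω u u') {Ω' : Set (Space d)} (hΩ : Ω' ⊆ Ω) : ApproxH1 D Ω' u u' where
  memLp := h.memLp.mono_measure (Measure.restrict_mono_set _ hΩ)
  memLp' i := (h.memLp' i).mono_measure (Measure.restrict_mono_set _ hΩ)
  approx ε hε := by
    obtain ⟨φ, h1, h2, h3⟩ := h.approx ε hε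
    exact ⟨φ, h1, (eLpNorm_mono_measure _ (Measure.restrict_mono_set _ hΩ)).trans h2,
      fun i => (eLpNorm_mono_measure _ (Measure.restrict_mono_set _ hΩ)).trans (h3 i)⟩

lemma congr (h : ApproxH1 D Ω u u') (hu : u =ᵐ[volume.restrict Ω] v)
    (hu' : ∀ i, u' i =ᵐ[volume.restrict Ω] v' i) : ApproxH1 D Ω v v' where
  memLp := h.memLp.ae_eq hu
  memLp' i := (h.memLp' i).ae_eq (hu' i)
  approx ε hε := by
    obtain ⟨φ, h1, h2, h3⟩ := h.approx ε hε
    refine ⟨φ, h1, (eLpNorm_congr_ae ?_).trans_le h2,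
      fun i => (eLpNorm_congr_ae ?_).trans_le (h3 i)⟩
    · filter_upwards [hu] with x hx
      rw [hx]
    · filter_upwards [hu' i] with x hx
      rw [hx]

lemma of_test {φ : Space d → ℂ} (h : IsTest D φ) (Ω : Set (Space d)) :
    ApproxH1 D Ω φ (fun i => pd i φ) :=
  ⟨h.memLp _, fun i => (h.pderiv i).memLp _, fun ε _ => ⟨φ, h, by simp, by simp⟩⟩

/-- Limits of limits of test functions are limits of test functions. -/
lemma of_approx (hu : MemLp u 2 (volume.restrict Ω))
    (hu' : ∀ i, MemLp (u' i) 2 (volume.restrict Ω))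
    (h : ∀ ε : ℝ≥0∞, 0 < ε → ∃ v v', ApproxH1 D Ω v v' ∧
      eLpNorm (fun x => v x - u x) 2 (volume.restrict Ω) ≤ ε ∧
      ∀ i, eLpNorm (fun x => v' i x - u' i x) 2 (volume.restrict Ω) ≤ ε) : ApproxH1 D Ω u u' := by
  refine ⟨hu, hu', fun ε hε => ?_⟩
  obtain ⟨v, v', hv, h1, h2⟩ := h (ε / 2) (ENNReal.half_pos hε.ne')
  obtain ⟨φ, hφ, h3, h4⟩ := hv.approx (ε / 2) (ENNReal.half_pos hε.ne')
  refine ⟨φ, hφ, ?_, fun i => ?_⟩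
  · refine (eLpNorm_sub_le_add (hφ.memLp _).1 hv.memLp.1 hu.1).trans ?_
    exact (add_le_add h3 h1).trans (ENNReal.add_halves ε).le
  · refine (eLpNorm_sub_le_add ((hφ.pderiv i).memLp _).1 (hv.memLp' i).1 (hu' i).1).trans ?_
    exact (add_le_add (h4 i) (h2 i)).trans (ENNReal.add_halves ε).le

lemma add (h : ApproxH1 D Ω u u') (h' : ApproxH1 D Ω v v') :
    ApproxH1 D Ω (fun x => u x + v x) (fun i x => u' i x + v' i x) where
  memLp := h.memLp.add h'.memLp
  memLp' i := (h.memLp' i).add (h'.memLp' i)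
  approx ε hε := by
    obtain ⟨φ, hφ, h1, h2⟩ := h.approx (ε / 2) (ENNReal.half_pos hε.ne')
    obtain ⟨ψ, hψ, h3, h4⟩ := h'.approx (ε / 2) (ENNReal.half_pos hε.ne')
    refine ⟨_, hφ.add hψ, ?_, fun i => ?_⟩
    · refine le_trans (le_of_eq ?_) ((eLpNorm_add_le ((hφ.memLp _).1.sub h.memLp.1)
        ((hψ.memLp _).1.sub h'.memLp.1) (by norm_num)).trans
        ((add_le_add h1 h3).trans (ENNReal.add_halves ε).le))
      congr 1
      funext x
      simp only [Pi.add_apply, Pi.sub_apply]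
      ring
    · refine le_trans (le_of_eq ?_) ((eLpNorm_add_le (((hφ.pderiv i).memLp _).1.sub (h.memLp' i).1)
        (((hψ.pderiv i).memLp _).1.sub (h'.memLp' i).1) (by norm_num)).trans
        ((add_le_add (h2 i) (h4 i)).trans (ENNReal.add_halves ε).le))
      congr 1
      funext x
      rw [pd_add i (hφ.differentiable x) (hψ.differentiable x)]
      simp only [Pi.add_apply, Pi.sub_apply]
      ring

/-- For the approximants this is integration by parts on the whole space, `ψ` confining the
integrals to `Ω`; both sides then converge. -/
lemma hasWeakDeriv (h : ApproxH1 D Ω u u') (i : Fin d ⊕ Unit) : HasWeakDeriv Ω i u (u' i) where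
  locInt := locallyIntegrableOn_of_memLp h.memLp
  locInt' := locallyIntegrableOn_of_memLp (h.memLp' i)
  integral_eq ψ hψ := by
    obtain ⟨φ, h1, h2, h3⟩ := h.exists_seq
    have l1 := tendsto_integral_mul (fun m => (h1 m).memLp (volume.restrict Ω)) h.memLp
      ((hψ.pderiv i).memLp _) h2
    have l2 := tendsto_integral_mul (fun m => ((h1 m).pderiv i).memLp (volume.restrict Ω)) (h.memLp' i)
      (hψ.memLp _) (h3 i)
    refine tendsto_nhds_unique l1 (l2.neg.congr fun m => ?_)
    rw [setIntegral_eq_of_test hψ, setIntegral_eq_of_test (hψ.pderiv i),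
      integral_test_mul_pd (h1 m) hψ]

lemma weakDeriv_ae_eq (hΩ : IsOpen Ω) (h : ApproxH1 D Ω u u') (i : Fin d ⊕ Unit) :
    u' i =ᵐ[volume.restrict Ω] weakDeriv Ω i u :=
  (h.hasWeakDeriv i).ae_unique hΩ (weakDeriv_spec (h.hasWeakDeriv i))

lemma memH10 (hD : IsOpen D) (h : ApproxH1 D D u u') : MemH10 D u := by
  have h' := h.congr (ae_eq_refl u) (h.weakDeriv_ae_eq hD)
  obtain ⟨φ, h1, h2, h3⟩ := h'.exists_seq
  exact ⟨⟨h'.memLp, h'.hasWeakDeriv, h'.memLp'⟩, φ, h1, h2, h3⟩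

end ApproxH1

lemma MemH10.approxH1 {D : Set (Space d)} {u : Space d → ℂ} (h : MemH10 D u) :
    ApproxH1 D D u (fun i => weakDeriv D i u) := by
  obtain ⟨h0, φ, h1, h2, h3⟩ := h
  exact .of_seq h0.memLp h0.memLp_weakDeriv h1 h2 h3

/-- The test functions that approximate on `D` also approximate on `S_H`; the weak derivatives taken
on `D` and on `S_H` agree there by uniqueness. -/
lemma MemV.approxH1 {D : Set (Space d)} (hD : IsOpen D) {H : ℝ} {w : Space d → ℂ}
    (h : MemV D H w) : ApproxH1 D (S D H) w (fun i => weakDeriv (S D H) i w) := by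
  obtain ⟨φ, h1, h2⟩ := h
  have h3 := (h1.approxH1.mono (S_subset D H)).congr h2.symm fun i => ae_eq_refl _
  exact h3.congr (ae_eq_refl _) (h3.weakDeriv_ae_eq (isOpen_S hD H))

lemma IsTest.memV {D : Set (Space d)} (hD : IsOpen D) (H : ℝ) {φ : Space d → ℂ} (h : IsTest D φ) :
    MemV D H φ :=
  ⟨φ, (ApproxH1.of_test h D).memH10 hD, ae_eq_refl _⟩

lemma IsTest.weakDeriv_ae_eq {D : Set (Space d)} (hD : IsOpen D) (H : ℝ) {φ : Space d → ℂ}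
    (h : IsTest D φ) (i : Fin d ⊕ Unit) :
    pd i φ =ᵐ[volume.restrict (S D H)] weakDeriv (S D H) i φ :=
  (ApproxH1.of_test h _).weakDeriv_ae_eq (isOpen_S hD H) i

lemma MemV.mono {D : Set (Space d)} {H a : ℝ} (ha : H ≤ a) {w : Space d → ℂ} (h : MemV D a w) :
    MemV D H w := by
  obtain ⟨φ, h1, h2⟩ := h
  exact ⟨φ, h1, ae_restrict_of_ae_restrict_of_subset (S_mono D ha) h2⟩

lemma MemV.congr {D : Set (Space d)} {H : ℝ} {w v : Space d → ℂ} (h : MemV D H w)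
    (hv : v =ᵐ[volume.restrict (S D H)] w) : MemV D H v := by
  obtain ⟨φ, h1, h2⟩ := h
  exact ⟨φ, h1, hv.trans h2⟩

end RoughLayer

end

noncomputable section

namespace RoughLayer

variable {d : ℕ}

/-! ### The Fourier transform in the horizontal variables -/

/-- The Fourier transform of `g(·, t)`. -/
def hat (g : Space d → ℂ) (η : Horiz d) (t : ℝ) : ℂ := 𝓕 (fun y => g (y, t)) η

lemma hat_eq (g : Space d → ℂ) (η : Horiz d) (t : ℝ) :
    hat g η t = ∫ y, Real.fourierChar (-(inner ℝ y η)) • g (y, t) := by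
  rw [hat, Real.fourier_eq]

variable {Ω : Set (Space d)} {g : Space d → ℂ}

lemma IsTest.slice_smooth (h : IsTest Ω g) (t : ℝ) : ContDiff ℝ ∞ (fun y : Horiz d => g (y, t)) :=
  h.smooth.comp (contDiff_id.prodMk contDiff_const)

lemma IsTest.bound (h : IsTest Ω g) : ∃ C R : ℝ, 0 ≤ C ∧ 0 ≤ R ∧ (∀ x, ‖g x‖ ≤ C) ∧
    ∀ y t, (R < ‖y‖ ∨ R < |t|) → g (y, t) = 0 := by
  obtain ⟨C, hC⟩ := h.continuous.bounded_above_of_compact_support h.compact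
  obtain ⟨R, hR⟩ := h.compact.isCompact.isBounded.subset_closedBall 0
  refine ⟨C, max R 0, (norm_nonneg _).trans (hC 0), le_max_right _ _, hC, fun y t hyt => ?_⟩
  refine image_eq_zero_of_notMem_tsupport fun hx => ?_
  have := hR hx
  rw [mem_closedBall_zero_iff, Prod.norm_def, max_le_iff, Real.norm_eq_abs] at this
  rcases hyt with h1 | h1
  · exact absurd (this.1.trans (le_max_left _ _)) (not_le.2 h1)
  · exact absurd (this.2.trans (le_max_left _ _)) (not_le.2 h1)

lemma IsTest.slice_compact (h : IsTest Ω g) (t : ℝ) :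
    HasCompactSupport (fun y : Horiz d => g (y, t)) := by
  obtain ⟨C, R, -, -, -, hR⟩ := h.bound
  refine HasCompactSupport.intro (isCompact_closedBall 0 R) fun y hy => hR y t (Or.inl ?_)
  simpa using hy

/-- The restriction of a test function to a horizontal plane as a Schwartz function. -/
def IsTest.slice (h : IsTest Ω g) (t : ℝ) : SchwartzMap (Horiz d) ℂ :=
  (h.slice_compact t).toSchwartzMap (h.slice_smooth t)

lemma IsTest.slice_apply (h : IsTest Ω g) (t : ℝ) (y : Horiz d) : h.slice t y = g (y, t) := rfl

lemma IsTest.fourier_slice (h : IsTest Ω g) (t : ℝ) (η : Horiz d) :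
    (𝓕 (h.slice t) : SchwartzMap (Horiz d) ℂ) η = hat g η t := rfl

lemma IsTest.memLp_slice (h : IsTest Ω g) (t : ℝ) : MemLp (fun y : Horiz d => g (y, t)) 2 volume :=
  (h.slice_smooth t).continuous.memLp_of_hasCompactSupport (h.slice_compact t)

lemma IsTest.integrable_slice (h : IsTest Ω g) (t : ℝ) :
    Integrable (fun y : Horiz d => g (y, t)) :=
  (h.slice_smooth t).continuous.integrable_of_hasCompactSupport (h.slice_compact t)

lemma IsTest.memLp_hat (h : IsTest Ω g) (t : ℝ) : MemLp (fun η => hat g η t) 2 volume :=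
  (𝓕 (h.slice t) : SchwartzMap (Horiz d) ℂ).memLp 2 volume

lemma integrable_fourierChar_smul (h : IsTest Ω g) (η : Horiz d) (t : ℝ) :
    Integrable (fun y : Horiz d => Real.fourierChar (-(inner ℝ y η)) • g (y, t)) := by
  refine Continuous.integrable_of_hasCompactSupport ?_ (h.slice_compact t).smul_left
  exact (Real.continuous_fourierChar.comp (by fun_prop)).smul (h.slice_smooth t).continuous

lemma hat_sub {Ω' : Set (Space d)} {g' : Space d → ℂ} (h : IsTest Ω g) (h' : IsTest Ω' g')
    (η : Horiz d) (t : ℝ) : hat (fun x => g x - g' x) η t = hat g η t - hat g' η t := by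
  simp_rw [hat_eq, smul_sub]
  exact integral_sub (integrable_fourierChar_smul h η t) (integrable_fourierChar_smul h' η t)

lemma IsTest.hasDerivAt_slice (h : IsTest Ω g) (y : Horiz d) (t : ℝ) :
    HasDerivAt (fun t => g (y, t)) (pd (Sum.inr ()) g (y, t)) t := by
  have h1 := (h.differentiable (y, t)).hasFDerivAt
  have h2 : HasDerivAt (fun t : ℝ => (y, t)) ((0 : Horiz d), (1 : ℝ)) t :=
    (hasDerivAt_const t y).prodMk (hasDerivAt_id t)
  exact h1.comp_hasDerivAt t h2

lemma IsTest.fderiv_slice (h : IsTest Ω g) (y : Horiz d) (t : ℝ) (i : Fin d) :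
    fderiv ℝ (fun y => g (y, t)) y (EuclideanSpace.single i 1) = pd (Sum.inl i) g (y, t) := by
  have h1 := (h.differentiable (y, t)).hasFDerivAt
  have h2 : HasFDerivAt (fun y : Horiz d => (y, t))
      ((ContinuousLinearMap.id ℝ (Horiz d)).prod 0) y :=
    (hasFDerivAt_id y).prodMk (hasFDerivAt_const t y)
  rw [show (fun y => g (y, t)) = g ∘ (fun y => (y, t)) from rfl, (h1.comp y h2).fderiv]
  rfl

/-- Differentiation under the integral: a constant on a fixed ball dominates the vertical derivative
at all heights at once. -/
lemma IsTest.hasDerivAt_hat (h : IsTest Ω g) (η : Horiz d) (t : ℝ) :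
    HasDerivAt (hat g η) (hat (pd (Sum.inr ()) g) η t) t := by
  obtain ⟨C, R, hC0, -, hC, hR⟩ := (h.pderiv (Sum.inr ())).bound
  have e : hat g η = fun t => ∫ y, Real.fourierChar (-(inner ℝ y η)) • g (y, t) :=
    funext fun t => hat_eq g η t
  rw [e, hat_eq]
  refine (hasDerivAt_integral_of_dominated_loc_of_deriv_le (s := Set.univ) univ_mem
    (.of_forall fun t => (integrable_fourierChar_smul h η t).1)
    (integrable_fourierChar_smul h η t)
    (F' := fun t y => Real.fourierChar (-(inner ℝ y η)) • pd (Sum.inr ()) g (y, t))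
    (integrable_fourierChar_smul (h.pderiv (Sum.inr ())) η t).1
    (bound := (Metric.closedBall (0 : Horiz d) R).indicator fun _ => C) ?_ ?_ ?_).2
  · refine .of_forall fun y s _ => ?_
    rw [Circle.norm_smul]
    by_cases hy : y ∈ Metric.closedBall (0 : Horiz d) R
    · rw [Set.indicator_of_mem hy]
      exact hC _
    · rw [Set.indicator_of_notMem hy, hR y s (Or.inl (by simpa using hy)), norm_zero]
  · rw [integrable_indicator_iff Metric.isClosed_closedBall.measurableSet]
    exact integrableOn_const (measure_closedBall_lt_top).ne
  · exact .of_forall fun y s _ => (h.hasDerivAt_slice y s).const_smul _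

lemma IsTest.continuous_hat (h : IsTest Ω g) :
    Continuous (fun p : Horiz d × ℝ => hat g p.1 p.2) := by
  obtain ⟨C, R, hC0, -, hC, hR⟩ := h.bound
  simp_rw [hat_eq]
  have hc := h.continuous
  refine continuous_of_dominated (bound := (Metric.closedBall (0 : Horiz d) R).indicator fun _ => C)
    (fun p => ?_) (fun p => .of_forall fun y => ?_) ?_ (.of_forall fun y => ?_)
  · exact ((Real.continuous_fourierChar.comp (by fun_prop)).smul
      (by fun_prop : Continuous fun y : Horiz d => g (y, p.2))).aestronglyMeasurable
  · rw [Circle.norm_smul]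
    by_cases hy : y ∈ Metric.closedBall (0 : Horiz d) R
    · rw [Set.indicator_of_mem hy]
      exact hC _
    · rw [Set.indicator_of_notMem hy, hR y _ (Or.inl (by simpa using hy)), norm_zero]
  · rw [integrable_indicator_iff Metric.isClosed_closedBall.measurableSet]
    exact integrableOn_const (measure_closedBall_lt_top).ne
  · exact (Real.continuous_fourierChar.comp (by fun_prop)).smul
      (by fun_prop : Continuous fun p : Horiz d × ℝ => g (y, p.2))

lemma IsTest.exists_hat_eq_zero (h : IsTest Ω g) :
    ∃ R : ℝ, 0 ≤ R ∧ ∀ η t, R < |t| → hat g η t = 0 := by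
  obtain ⟨C, R, -, hR0, -, hR⟩ := h.bound
  refine ⟨R, hR0, fun η t ht => ?_⟩
  simp [hat_eq, hR _ t (Or.inr ht)]

lemma IsTest.hat_pd_inl (h : IsTest Ω g) (i : Fin d) (η : Horiz d) (t : ℝ) :
    hat (pd (Sum.inl i) g) η t = 2 * Real.pi * Complex.I * (η i : ℂ) * hat g η t := by
  have h1 := DFunLike.congr_fun
    (SchwartzMap.fourier_lineDerivOp_eq (h.slice t) (EuclideanSpace.single i 1)) η
  have h2 : (LineDeriv.lineDerivOp (EuclideanSpace.single i (1 : ℝ)) (h.slice t) :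
      SchwartzMap (Horiz d) ℂ) = (h.pderiv (Sum.inl i)).slice t := by
    ext y
    rw [SchwartzMap.lineDerivOp_apply_eq_fderiv]
    exact h.fderiv_slice y t i
  rw [h2, IsTest.fourier_slice] at h1
  rw [h1, smul_apply, SchwartzMap.smulLeftCLM_apply_apply (by fun_prop)]
  simp [IsTest.fourier_slice, EuclideanSpace.inner_single_right]
  ring

/-! ### Plancherel and Parseval on horizontal planes. -/

lemma coeFn_fourier_slice (h : IsTest Ω g) (t : ℝ) :
    (𝓕 ((h.slice t).toLp 2 volume : Lp ℂ 2 (volume : Measure (Horiz d))) :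
      Lp ℂ 2 (volume : Measure (Horiz d))) =ᵐ[volume] fun η => hat g η t := by
  rw [SchwartzMap.toLp_fourier_eq]
  exact SchwartzMap.coeFn_toLp _ 2 volume

/-- Plancherel for the slice minus `F`. It links the `L²` convergence of slices by which traces are
defined with convergence of their transforms. -/
lemma eLpNorm_hat_sub (h : IsTest Ω g) (t : ℝ) (F : Lp ℂ 2 (volume : Measure (Horiz d))) :
    eLpNorm (fun η => hat g η t - (𝓕 F : Lp ℂ 2 (volume : Measure (Horiz d))) η) 2 volume
      = eLpNorm (fun y => g (y, t) - F y) 2 volume := by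
  set s : Lp ℂ 2 (volume : Measure (Horiz d)) := (h.slice t).toLp 2 volume with hs
  have h1 : ‖(𝓕 (s - F) : Lp ℂ 2 (volume : Measure (Horiz d)))‖ₑ = ‖s - F‖ₑ := by
    rw [← ofReal_norm, ← ofReal_norm, Lp.norm_fourier_eq]
  have h0 : (𝓕 (s - F) : Lp ℂ 2 (volume : Measure (Horiz d))) = 𝓕 s - 𝓕 F :=
    (Lp.fourierTransformₗᵢ (Horiz d) ℂ).map_sub s F
  rw [Lp.enorm_def, Lp.enorm_def, h0] at h1
  refine (eLpNorm_congr_ae ?_).trans (h1.trans (eLpNorm_congr_ae ?_))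
  · filter_upwards [coeFn_fourier_slice h t, Lp.coeFn_sub (𝓕 s) (𝓕 F)] with η h2 h3
    rw [h3, Pi.sub_apply, h2]
  · filter_upwards [SchwartzMap.coeFn_toLp (h.slice t) 2 volume, Lp.coeFn_sub s F] with y h2 h3
    rw [h3, Pi.sub_apply, h2]
    rfl

lemma eLpNorm_hat (h : IsTest Ω g) (t : ℝ) :
    eLpNorm (fun η => hat g η t) 2 volume = eLpNorm (fun y => g (y, t)) 2 volume := by
  have h1 := eLpNorm_hat_sub h t 0
  have h0 : (𝓕 (0 : Lp ℂ 2 (volume : Measure (Horiz d))) : Lp ℂ 2 (volume : Measure (Horiz d)))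
      = 0 := (Lp.fourierTransformₗᵢ (Horiz d) ℂ).map_zero
  rw [h0] at h1
  have h2 := Lp.coeFn_zero ℂ 2 (volume : Measure (Horiz d))
  convert h1 using 1
  · refine eLpNorm_congr_ae ?_
    filter_upwards [h2] with η h3
    simp
  · refine eLpNorm_congr_ae ?_
    filter_upwards [h2] with η h3
    simp

lemma lintegral_hat (h : IsTest Ω g) (t : ℝ) :
    ∫⁻ η, ‖hat g η t‖ₑ ^ 2 = ∫⁻ y, ‖g (y, t)‖ₑ ^ 2 := by
  rw [← eLpNorm_two_sq, ← eLpNorm_two_sq, eLpNorm_hat h]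

/-- Parseval's identity. -/
lemma integral_mul_conj_slice (h : IsTest Ω g) (t : ℝ) (F : Lp ℂ 2 (volume : Measure (Horiz d))) :
    ∫ y, F y * conj (g (y, t)) =
      ∫ η, (𝓕 F : Lp ℂ 2 (volume : Measure (Horiz d))) η * conj (hat g η t) := by
  have h1 := Lp.inner_fourier_eq ((h.slice t).toLp 2 volume) F
  rw [L2.inner_def, L2.inner_def] at h1
  have e1 : ∫ y, F y * conj (g (y, t)) =
      ∫ a, inner ℂ ((h.slice t).toLp 2 (volume : Measure (Horiz d)) a) (F a) := by
    refine integral_congr_ae ?_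
    filter_upwards [SchwartzMap.coeFn_toLp (h.slice t) 2 volume] with y hy
    rw [hy, RCLike.inner_apply]
    rfl
  rw [e1, ← h1]
  refine integral_congr_ae ?_
  filter_upwards [coeFn_fourier_slice h t] with η hη
  rw [hη, RCLike.inner_apply]

attribute [irreducible] hat

end RoughLayer

end

noncomputable section

namespace RoughLayer

variable {d : ℕ} {D Ω : Set (Space d)} {g : Space d → ℂ}

/-! ### The trace in `H^{1/2}` -/

lemma restrict_slab (T : Set ℝ) : (volume : Measure (Space d)).restrict {x | x.2 ∈ T} =
    (volume : Measure (Horiz d)).prod (volume.restrict T) := by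
  have h1 : {x : Space d | x.2 ∈ T} = Set.univ ×ˢ T := by ext x; simp
  rw [h1, Measure.volume_eq_prod, ← Measure.prod_restrict, Measure.restrict_univ]

lemma lintegral_slab (T : Set ℝ) {f : Space d → ℝ≥0∞} (hf : Measurable f) :
    ∫⁻ x in {x : Space d | x.2 ∈ T}, f x = ∫⁻ t in T, ∫⁻ y : Horiz d, f (y, t) := by
  rw [restrict_slab, lintegral_prod_symm' _ hf]

/-- The measure with density `1 + 2π|η|`, whose `L²` space is the Fourier image of `H^{1/2}`. -/
def halfMeasure (d : ℕ) : Measure (Horiz d) :=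
  volume.withDensity fun η => ENNReal.ofReal (1 + 2 * Real.pi * ‖η‖)

lemma volume_le_halfMeasure : (volume : Measure (Horiz d)) ≤ halfMeasure d := by
  have h1 : (volume : Measure (Horiz d)) = volume.withDensity 1 := withDensity_one.symm
  conv_lhs => rw [h1]
  refine withDensity_mono (.of_forall fun η => ?_)
  rw [Pi.one_apply, ENNReal.one_le_ofReal]
  have := Real.pi_pos
  nlinarith [norm_nonneg η, mul_nonneg Real.pi_pos.le (norm_nonneg η)]

lemma halfMeasure_absolutelyContinuous : halfMeasure d ≪ (volume : Measure (Horiz d)) :=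
  withDensity_absolutelyContinuous _ _

lemma lintegral_halfMeasure (f : Horiz d → ℝ≥0∞) :
    ∫⁻ η, f η ∂(halfMeasure d) = ∫⁻ η, ENNReal.ofReal (1 + 2 * Real.pi * ‖η‖) * f η := by
  rw [halfMeasure, lintegral_withDensity_eq_lintegral_mul_non_measurable]
  · rfl
  · fun_prop
  · exact .of_forall fun _ => ENNReal.ofReal_lt_top

lemma enorm_sq_eq_ofReal (w : ℂ) : ‖w‖ₑ ^ 2 = ENNReal.ofReal (‖w‖ ^ 2) := by
  rw [← ofReal_norm, ENNReal.ofReal_pow (norm_nonneg _)]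

/-- The derivative `∂_i` becomes multiplication by `2πi η_i`. In this way the horizontal derivatives
pay for the weight of `H^{1/2}`. -/
lemma IsTest.sum_norm_hat_sq (h : IsTest Ω g) (η : Horiz d) (t : ℝ) :
    (2 * Real.pi * ‖η‖) ^ 2 * ‖hat g η t‖ ^ 2 = ∑ i : Fin d, ‖hat (pd (Sum.inl i) g) η t‖ ^ 2 := by
  have h1 : ∀ i : Fin d, ‖hat (pd (Sum.inl i) g) η t‖ ^ 2 =
      (2 * Real.pi) ^ 2 * ‖hat g η t‖ ^ 2 * ‖η i‖ ^ 2 := by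
    intro i
    rw [h.hat_pd_inl]
    simp only [norm_mul, Complex.norm_I, Complex.norm_real, Complex.norm_ofNat]
    rw [Real.norm_of_nonneg Real.pi_pos.le]
    ring
  simp_rw [h1]
  rw [← Finset.mul_sum, ← EuclideanSpace.norm_sq_eq]
  ring

/-- `A²` is the integral of its derivative `2 A A'` from `-∞`, where `A` vanishes. -/
lemma enorm_sq_le_of_hasDerivAt {A A' : ℝ → ℂ} (hA'c : Continuous A')
    (hsupp : HasCompactSupport A) (hd : ∀ t, HasDerivAt A (A' t) t) (H : ℝ) :
    ‖A H‖ₑ ^ 2 ≤ ∫⁻ t in Set.Iio H, ‖2 * A t * A' t‖ₑ := by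
  have hAc : Continuous A := continuous_iff_continuousAt.2 fun t => (hd t).continuousAt
  have hd2 : ∀ t, HasDerivAt (fun t => A t ^ 2) (2 * A t * A' t) t := fun t => by
    have h1 := (hd t).mul (hd t)
    rw [show A * A = fun t => A t ^ 2 from funext fun t => (sq (A t)).symm] at h1
    exact h1.congr_deriv (by ring)
  have hint : Integrable (fun t => 2 * A t * A' t) := by
    refine Continuous.integrable_of_hasCompactSupport (by fun_prop) ?_
    exact (hsupp.mul_left (f := fun _ => (2 : ℂ))).mul_right
  have hftc : ∫ t in Set.Iic H, 2 * A t * A' t = A H ^ 2 := by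
    rw [integral_Iic_of_hasDerivAt_of_tendsto (m := 0) (hd2 H).continuousAt.continuousWithinAt
      (fun t _ => hd2 t) hint.integrableOn, sub_zero]
    have h0 : Tendsto A atBot (𝓝 0) :=
      (hsupp.is_zero_at_infty).mono_left (by rw [cocompact_eq_atBot_atTop]; exact le_sup_left)
    simpa using h0.pow 2
  rw [← enorm_pow, ← hftc, setLIntegral_congr Iio_ae_eq_Iic]
  exact enorm_integral_le_lintegral_enorm _

/-- With `w = 2π|η|`, Young's inequality gives `2(1 + w)ab ≤ (1 + w)²a² + b²`, and `(1 + w)² ≤ 2 +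
2w²`; the term `w²a²` is the sum over the horizontal derivatives. -/
lemma IsTest.trace_integrand (h : IsTest Ω g) (η : Horiz d) (t : ℝ) :
    ENNReal.ofReal (1 + 2 * Real.pi * ‖η‖) *
      ‖2 * hat g η t * hat (pd (Sum.inr ()) g) η t‖ₑ ≤
    2 * ‖hat g η t‖ₑ ^ 2 + 2 * ∑ i : Fin d ⊕ Unit, ‖hat (pd i g) η t‖ₑ ^ 2 := by
  have h2 : (1 + 2 * Real.pi * ‖η‖) * ‖2 * hat g η t * hat (pd (Sum.inr ()) g) η t‖ ≤
      2 * ‖hat g η t‖ ^ 2 + 2 * ∑ i : Fin d ⊕ Unit, ‖hat (pd i g) η t‖ ^ 2 := by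
    have hW : 0 ≤ 2 * Real.pi * ‖η‖ := by positivity
    rw [Fintype.sum_sum_type, ← h.sum_norm_hat_sq]
    simp only [norm_mul, Complex.norm_ofNat, Finset.univ_unique, Finset.sum_singleton,
      PUnit.default_eq_unit]
    generalize 2 * Real.pi * ‖η‖ = w at hW
    generalize ‖hat g η t‖ = a
    generalize ‖hat (pd (Sum.inr ()) g) η t‖ = b
    nlinarith [sq_nonneg ((1 + w) * a - b), sq_nonneg ((1 - w) * a), sq_nonneg b]
  have h3 : 2 * ‖hat g η t‖ₑ ^ 2 + 2 * ∑ i : Fin d ⊕ Unit, ‖hat (pd i g) η t‖ₑ ^ 2 =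
      ENNReal.ofReal (2 * ‖hat g η t‖ ^ 2 + 2 * ∑ i : Fin d ⊕ Unit, ‖hat (pd i g) η t‖ ^ 2) := by
    rw [ENNReal.ofReal_add (by positivity) (by positivity), ENNReal.ofReal_mul (by norm_num),
      ENNReal.ofReal_mul (by norm_num), ENNReal.ofReal_sum_of_nonneg (fun _ _ => by positivity)]
    simp only [enorm_sq_eq_ofReal, ENNReal.ofReal_ofNat]
  rw [h3, ← ofReal_norm, ← ENNReal.ofReal_mul (by positivity)]
  exact ENNReal.ofReal_le_ofReal h2

lemma IsTest.continuous_hat_left (h : IsTest Ω g) (η : Horiz d) : Continuous (hat g η) := by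
  have h1 : Continuous (fun t : ℝ => (η, t)) := by fun_prop
  exact h.continuous_hat.comp h1

lemma IsTest.hasCompactSupport_hat (h : IsTest Ω g) (η : Horiz d) :
    HasCompactSupport (hat g η) := by
  obtain ⟨R, hR0, hR⟩ := h.exists_hat_eq_zero
  exact HasCompactSupport.intro (isCompact_Icc (a := -R) (b := R))
    fun t ht => hR η t (by rw [Set.mem_Icc, ← abs_le] at ht; exact not_le.1 ht)

lemma IsTest.trace_pointwise (h : IsTest Ω g) (η : Horiz d) (H : ℝ) :
    ENNReal.ofReal (1 + 2 * Real.pi * ‖η‖) * ‖hat g η H‖ₑ ^ 2 ≤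
      ∫⁻ t in Set.Iio H, (2 * ‖hat g η t‖ₑ ^ 2 +
        2 * ∑ i : Fin d ⊕ Unit, ‖hat (pd i g) η t‖ₑ ^ 2) := by
  have hAc := h.continuous_hat_left η
  have hA'c := (h.pderiv (Sum.inr ())).continuous_hat_left η
  have h1 := enorm_sq_le_of_hasDerivAt hA'c (h.hasCompactSupport_hat η)
    (fun t => h.hasDerivAt_hat η t) H
  refine (mul_le_mul_right h1 _).trans ?_
  rw [← lintegral_const_mul _ (by fun_prop)]
  exact lintegral_mono fun t => h.trace_integrand η t

lemma two_mul_sum_sq_le {ι : Type*} [Fintype ι] (a : ℝ≥0∞) (b : ι → ℝ≥0∞) :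
    2 * a ^ 2 + 2 * ∑ i, b i ^ 2 ≤ (2 * (a + ∑ i, b i)) ^ 2 := by
  have h1 : ∑ i, b i ^ 2 ≤ (∑ i, b i) ^ 2 := by
    rw [sq (∑ i, b i), Finset.sum_mul]
    refine Finset.sum_le_sum fun i _ => ?_
    rw [sq]
    gcongr
    exact Finset.single_le_sum (f := b) (fun _ _ => zero_le) (Finset.mem_univ i)
  generalize ∑ i, b i = c at h1
  calc 2 * a ^ 2 + 2 * ∑ i, b i ^ 2 ≤ 2 * a ^ 2 + 2 * c ^ 2 := by gcongr
    _ ≤ 2 * a ^ 2 + 2 * c ^ 2 + (2 * a ^ 2 + 2 * c ^ 2 + 8 * a * c) := le_self_add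
    _ = (2 * (a + c)) ^ 2 := by ring

/-- An `H¹(Ω)` norm of a smooth function. -/
def normH1 (Ω : Set (Space d)) (φ : Space d → ℂ) : ℝ≥0∞ :=
  eLpNorm φ 2 (volume.restrict Ω) + ∑ i, eLpNorm (pd i φ) 2 (volume.restrict Ω)

/-- Plancherel at each height; since `g` vanishes outside `D`, integrating over the half-space below
`Γ_H` is the same as integrating over `S_H`. -/
lemma IsTest.lintegral_S (hD : IsOpen D) (h : IsTest D g) (H : ℝ) :
    ∫⁻ t in Set.Iio H, ∫⁻ η, ‖hat g η t‖ₑ ^ 2 = eLpNorm g 2 (volume.restrict (S D H)) ^ 2 := by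
  simp_rw [lintegral_hat h]
  have hm : Measurable fun x => ‖g x‖ₑ ^ 2 := by
    have := h.continuous
    fun_prop
  rw [← lintegral_slab (Set.Iio H) hm, eLpNorm_two_sq, S_eq]
  change ∫⁻ x in {x : Space d | x.2 < H}, _ = _
  have hH : MeasurableSet {x : Space d | x.2 < H} := measurableSet_lt measurable_snd measurable_const
  rw [← lintegral_indicator hH, ← lintegral_indicator (hD.measurableSet.inter hH)]
  congr 1
  funext x
  by_cases hx : x ∈ D
  · by_cases hx2 : x ∈ {x : Space d | x.2 < H}
    · rw [Set.indicator_of_mem hx2, Set.indicator_of_mem (Set.mem_inter hx hx2)]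
    · rw [Set.indicator_of_notMem hx2,
        Set.indicator_of_notMem fun h' : x ∈ D ∩ {x : Space d | x.2 < H} => hx2 h'.2]
  · rw [Set.indicator_of_notMem (s := D ∩ {x : Space d | x.2 < H}) fun h' => hx h'.1]
    simp [Set.indicator, h.eq_zero hx]

/-- The trace inequality `H¹(S_H) → H^{1/2}(Γ_H)` in Fourier form: the pointwise bound is integrated
in `η` and the order of integration exchanged by Tonelli. -/
lemma IsTest.trace_bound (hD : IsOpen D) (h : IsTest D g) (H : ℝ) :
    eLpNorm (fun η => hat g η H) 2 (halfMeasure d) ≤ 2 * normH1 (S D H) g := by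
  have hm : ∀ {g : Space d → ℂ}, IsTest D g →
      Measurable (fun p : Horiz d × ℝ => ‖hat g p.1 p.2‖ₑ ^ 2) := fun hg => by
    have := hg.continuous_hat.measurable
    fun_prop
  have hsw : ∀ {g : Space d → ℂ}, IsTest D g → ∫⁻ η, ∫⁻ t in Set.Iio H, ‖hat g η t‖ₑ ^ 2 =
      eLpNorm g 2 (volume.restrict (S D H)) ^ 2 := fun hg => by
    rw [lintegral_lintegral_swap (hm hg).aemeasurable, hg.lintegral_S hD]
  have hm1 : ∀ {g : Space d → ℂ}, IsTest D g → Measurable (fun η : Horiz d =>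
      ∫⁻ t in Set.Iio H, ‖hat g η t‖ₑ ^ 2) := fun hg => (hm hg).lintegral_prod_right'
  have hm2 : ∀ {g : Space d → ℂ}, IsTest D g → ∀ η, Measurable (fun t : ℝ =>
      ‖hat g η t‖ₑ ^ 2) := fun hg η => (hm hg).comp measurable_prodMk_left
  rw [← ENNReal.pow_le_pow_left_iff (n := 2) (by norm_num), eLpNorm_two_sq, lintegral_halfMeasure]
  calc _ ≤ ∫⁻ η, ∫⁻ t in Set.Iio H, (2 * ‖hat g η t‖ₑ ^ 2 +
        2 * ∑ i : Fin d ⊕ Unit, ‖hat (pd i g) η t‖ₑ ^ 2) :=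
        lintegral_mono fun η => h.trace_pointwise η H
    _ = 2 * eLpNorm g 2 (volume.restrict (S D H)) ^ 2 +
        2 * ∑ i, eLpNorm (pd i g) 2 (volume.restrict (S D H)) ^ 2 := by
      have e1 : ∀ η : Horiz d, ∫⁻ t in Set.Iio H, (2 * ‖hat g η t‖ₑ ^ 2 +
          2 * ∑ i : Fin d ⊕ Unit, ‖hat (pd i g) η t‖ₑ ^ 2) =
          2 * (∫⁻ t in Set.Iio H, ‖hat g η t‖ₑ ^ 2) +
          2 * ∑ i : Fin d ⊕ Unit, ∫⁻ t in Set.Iio H, ‖hat (pd i g) η t‖ₑ ^ 2 := by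
        intro η
        rw [lintegral_add_left ((hm2 h η).const_mul 2), lintegral_const_mul _ (hm2 h η),
          lintegral_const_mul _ (Finset.measurable_sum _ fun i _ => hm2 (h.pderiv i) η),
          lintegral_finsetSum _ fun i _ => hm2 (h.pderiv i) η]
      simp_rw [e1]
      rw [lintegral_add_left ((hm1 h).const_mul 2), lintegral_const_mul _ (hm1 h),
          lintegral_const_mul _ (Finset.measurable_sum _ fun i _ => hm1 (h.pderiv i)),
          lintegral_finsetSum _ fun i _ => hm1 (h.pderiv i), hsw h]
      congr 2
      exact Finset.sum_congr rfl fun i _ => hsw (h.pderiv i)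
    _ ≤ (2 * normH1 (S D H) g) ^ 2 :=
      two_mul_sum_sq_le _ _

lemma normH1_sub_le {φ ψ w : Space d → ℂ} {w' : Fin d ⊕ Unit → Space d → ℂ} (hφ : IsTest D φ)
    (hψ : IsTest D ψ) (hw : AEStronglyMeasurable w (volume.restrict Ω))
    (hw' : ∀ i, AEStronglyMeasurable (w' i) (volume.restrict Ω)) :
    normH1 Ω (fun x => φ x - ψ x) ≤
      (eLpNorm (fun x => φ x - w x) 2 (volume.restrict Ω) +
        ∑ i, eLpNorm (fun x => pd i φ x - w' i x) 2 (volume.restrict Ω)) +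
      (eLpNorm (fun x => ψ x - w x) 2 (volume.restrict Ω) +
        ∑ i, eLpNorm (fun x => pd i ψ x - w' i x) 2 (volume.restrict Ω)) := by
  have e : ∀ i, pd i (fun x => φ x - ψ x) = fun x => pd i φ x - pd i ψ x := fun i =>
    funext fun x => pd_sub i (hφ.differentiable x) (hψ.differentiable x)
  rw [normH1, add_add_add_comm, ← Finset.sum_add_distrib]
  refine add_le_add ?_ (Finset.sum_le_sum fun i _ => ?_)
  · rw [eLpNorm_sub_comm' ψ]
    exact eLpNorm_sub_le_add (hφ.memLp _).1 hw (hψ.memLp _).1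
  · rw [e, eLpNorm_sub_comm' (pd i ψ)]
    exact eLpNorm_sub_le_add ((hφ.pderiv i).memLp _).1 (hw' i) ((hψ.pderiv i).memLp _).1

lemma IsTest.normH1_lt_top (h : IsTest D g) (Ω : Set (Space d)) : normH1 Ω g < ⊤ :=
  ENNReal.add_lt_top.2 ⟨(h.memLp _).2, ENNReal.sum_lt_top.2 fun i _ => ((h.pderiv i).memLp _).2⟩

lemma IsTest.memLp_hat_half (hD : IsOpen D) (h : IsTest D g) (H : ℝ) :
    MemLp (fun η => hat g η H) 2 (halfMeasure d) := by
  refine ⟨(h.continuous_hat.comp (by fun_prop :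
    Continuous fun η : Horiz d => (η, H))).aestronglyMeasurable, ?_⟩
  exact (h.trace_bound hD H).trans_lt (ENNReal.mul_lt_top (by norm_num) (h.normH1_lt_top _))

/-! ### Existence, uniqueness and `H^{1/2}` regularity of the trace. -/

lemma TendstoH1.sum {φ : ℕ → Space d → ℂ} {w : Space d → ℂ} (h : TendstoH1 Ω φ w) :
    Tendsto (fun m => eLpNorm (fun x => φ m x - w x) 2 (volume.restrict Ω) +
        ∑ i, eLpNorm (fun x => pd i (φ m) x - weakDeriv Ω i w x) 2 (volume.restrict Ω))
      atTop (𝓝 0) := by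
  simpa using h.tendsto.add (tendsto_finsetSum Finset.univ fun i _ => h.tendsto_deriv i)

/-- By the trace inequality the transformed traces of an `H¹(S_H)` convergent sequence are Cauchy in
the weighted `L²` space, which is complete. -/
lemma exists_trace_limit (hD : IsOpen D) {H : ℝ} {w : Space d → ℂ} (hw : MemV D H w)
    {φ : ℕ → Space d → ℂ} (hφ : ∀ m, IsTest D (φ m)) (hlim : TendstoH1 (S D H) φ w) :
    ∃ F : Lp ℂ 2 (volume : Measure (Horiz d)),
      MemLp (𝓕 F : Lp ℂ 2 (volume : Measure (Horiz d))) 2 (halfMeasure d) ∧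
      Tendsto (fun m => eLpNorm (fun η => hat (φ m) η H -
        (𝓕 F : Lp ℂ 2 (volume : Measure (Horiz d))) η) 2 (halfMeasure d)) atTop (𝓝 0) := by
  have ha := hw.approxH1 hD
  set s : ℕ → Lp ℂ 2 (halfMeasure d) := fun m => ((hφ m).memLp_hat_half hD H).toLp _ with hs
  have hc : CauchySeq s := by
    rw [EMetric.cauchySeq_iff]
    intro ε hε
    -- A quarter, because the trace inequality has the factor `2` and both `φ m` and `φ n` are
    -- compared with `w`.
    have h4 : 0 < ε / 4 := ENNReal.div_pos hε.ne' (by norm_num)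
    obtain ⟨N, hN⟩ := eventually_atTop.1 (hlim.sum.eventually (Iio_mem_nhds h4))
    refine ⟨N, fun m hm n hn => ?_⟩
    rw [hs, Lp.edist_toLp_toLp]
    have h1 : ((fun η => hat (φ m) η H) - fun η => hat (φ n) η H) =
        fun η => hat (fun x => φ m x - φ n x) η H :=
      funext fun η => (hat_sub (hφ m) (hφ n) η H).symm
    rw [h1]
    have h5 := ((hφ m).sub (hφ n)).trace_bound hD H
    have h6 := normH1_sub_le (hφ m) (hφ n) ha.memLp.1 fun i => (ha.memLp' i).1
    calc _ ≤ _ := h5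
      _ ≤ _ := mul_le_mul_right h6 2
      _ < 2 * (ε / 4 + ε / 4) :=
        (ENNReal.mul_lt_mul_iff_right (by norm_num) (by norm_num)).2 (ENNReal.add_lt_add (hN m hm) (hN n hn))
      _ = ε := by
        rw [← two_mul, ← mul_assoc]
        norm_num
        exact ENNReal.mul_div_cancel (by norm_num) (by norm_num)
  obtain ⟨G, hG⟩ := cauchySeq_tendsto_of_complete hc
  -- The weight is at least `1`, so the weighted limit is also in plain `L²`, and the trace is its
  -- inverse transform.
  have hGv : MemLp G 2 (volume : Measure (Horiz d)) :=
    (Lp.memLp G).mono_measure volume_le_halfMeasure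
  have e1 : (𝓕 (𝓕⁻ (hGv.toLp G) : Lp ℂ 2 (volume : Measure (Horiz d))) :
      Lp ℂ 2 (volume : Measure (Horiz d))) = hGv.toLp G :=
    FourierTransform.fourier_fourierInv_eq _
  have e2 : (hGv.toLp G : Horiz d → ℂ) =ᵐ[halfMeasure d] G :=
    halfMeasure_absolutelyContinuous.ae_eq hGv.coeFn_toLp
  refine ⟨𝓕⁻ (hGv.toLp G), ?_, ?_⟩
  · rw [e1]
    exact (Lp.memLp G).ae_eq e2.symm
  · rw [e1]
    rw [Lp.tendsto_Lp_iff_tendsto_eLpNorm'] at hG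
    refine hG.congr fun m => eLpNorm_congr_ae ?_
    filter_upwards [((hφ m).memLp_hat_half hD H).coeFn_toLp, e2] with η h1 h2
    rw [Pi.sub_apply, h1, h2]

lemma isTrace_of_tendsto {H : ℝ} {w : Space d → ℂ} {φ : ℕ → Space d → ℂ}
    (hφ : ∀ m, IsTest D (φ m)) (hlim : TendstoH1 (S D H) φ w)
    {F : Lp ℂ 2 (volume : Measure (Horiz d))}
    (h : Tendsto (fun m => eLpNorm (fun η => hat (φ m) η H -
        (𝓕 F : Lp ℂ 2 (volume : Measure (Horiz d))) η) 2 (halfMeasure d)) atTop (𝓝 0)) :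
    IsTrace D H w F := by
  refine ⟨φ, hφ, hlim, ?_⟩
  refine tendsto_of_tendsto_of_tendsto_of_le_of_le tendsto_const_nhds h (fun _ => zero_le)
    fun m => ?_
  dsimp only
  rw [← eLpNorm_hat_sub (hφ m)]
  exact eLpNorm_mono_measure _ volume_le_halfMeasure

/-- Two sequences approximating the same `w` have a difference tending to zero in `H¹(S_H)`, hence
by the trace inequality also on `Γ_H`. -/
lemma IsTrace.unique (hD : IsOpen D) {H : ℝ} {w : Space d → ℂ} (hw : MemV D H w)
    {F F' : Lp ℂ 2 (volume : Measure (Horiz d))} (h : IsTrace D H w F) (h' : IsTrace D H w F') :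
    F = F' := by
  obtain ⟨φ, h1, h2, h3⟩ := h
  obtain ⟨ψ, k1, k2, k3⟩ := h'
  have ha := hw.approxH1 hD
  refine Lp.ext (ae_eq_of_tendsto_eLpNorm (f := fun m y => φ m (y, H))
    (fun m => ((h1 m).memLp_slice H).1) (Lp.memLp F).1 (Lp.memLp F').1 h3 ?_)
  have l1 : Tendsto (fun m => eLpNorm (fun y => φ m (y, H) - ψ m (y, H)) 2 volume) atTop (𝓝 0) := by
    have h0 := ENNReal.Tendsto.const_mul (a := 2) (h2.sum.add k2.sum) (Or.inr (by norm_num))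
    simp only [add_zero, mul_zero] at h0
    refine tendsto_of_tendsto_of_tendsto_of_le_of_le tendsto_const_nhds h0 (fun _ => zero_le)
      fun m => ?_
    have h5 := ((h1 m).sub (k1 m)).trace_bound hD H
    have h6 := normH1_sub_le (h1 m) (k1 m) ha.memLp.1 fun i => (ha.memLp' i).1
    refine le_trans ?_ (h5.trans (mul_le_mul_right h6 2))
    rw [← eLpNorm_hat ((h1 m).sub (k1 m))]
    exact eLpNorm_mono_measure _ volume_le_halfMeasure
  have l2 := l1.add k3
  rw [add_zero] at l2
  exact tendsto_of_tendsto_of_tendsto_of_le_of_le tendsto_const_nhds l2 (fun _ => zero_le)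
    fun m => eLpNorm_sub_le_add ((h1 m).memLp_slice H).1 ((k1 m).memLp_slice H).1 (Lp.memLp F').1

lemma MemV.exists_tendstoH1 (hD : IsOpen D) {H : ℝ} {w : Space d → ℂ} (hw : MemV D H w) :
    ∃ φ : ℕ → Space d → ℂ, (∀ m, IsTest D (φ m)) ∧ TendstoH1 (S D H) φ w := by
  obtain ⟨φ, h1, h2, h3⟩ := (hw.approxH1 hD).exists_seq
  exact ⟨φ, h1, h2, h3⟩

lemma trace_eq_of_isTrace (hD : IsOpen D) {H : ℝ} {w : Space d → ℂ} (hw : MemV D H w)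
    {F : Lp ℂ 2 (volume : Measure (Horiz d))} (h : IsTrace D H w F) : trace D H w = F := by
  have h' : ∃ F, IsTrace D H w F := ⟨F, h⟩
  rw [trace, dif_pos h']
  exact IsTrace.unique hD hw h'.choose_spec h

/-- Convergence in `H¹(S_H)` implies convergence of the traces in `H^{1/2}`. -/
lemma tendsto_hat_trace (hD : IsOpen D) {H : ℝ} {w : Space d → ℂ} (hw : MemV D H w)
    {φ : ℕ → Space d → ℂ} (hφ : ∀ m, IsTest D (φ m)) (hlim : TendstoH1 (S D H) φ w) :
    MemLp (𝓕 (trace D H w) : Lp ℂ 2 (volume : Measure (Horiz d))) 2 (halfMeasure d) ∧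
      Tendsto (fun m => eLpNorm (fun η => hat (φ m) η H -
        (𝓕 (trace D H w) : Lp ℂ 2 (volume : Measure (Horiz d))) η) 2 (halfMeasure d))
        atTop (𝓝 0) := by
  obtain ⟨F, h1, h2⟩ := exists_trace_limit hD hw hφ hlim
  rw [trace_eq_of_isTrace hD hw (isTrace_of_tendsto hφ hlim h2)]
  exact ⟨h1, h2⟩

lemma memLp_fourier_trace (hD : IsOpen D) {H : ℝ} {w : Space d → ℂ} (hw : MemV D H w) :
    MemLp (𝓕 (trace D H w) : Lp ℂ 2 (volume : Measure (Horiz d))) 2 (halfMeasure d) := by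
  obtain ⟨φ, h1, h2⟩ := hw.exists_tendstoH1 hD
  exact (tendsto_hat_trace hD hw h1 h2).1

lemma isTrace_trace (hD : IsOpen D) {H : ℝ} {w : Space d → ℂ} (hw : MemV D H w) :
    IsTrace D H w (trace D H w) := by
  obtain ⟨φ, h1, h2⟩ := hw.exists_tendstoH1 hD
  exact isTrace_of_tendsto h1 h2 (tendsto_hat_trace hD hw h1 h2).2

lemma trace_congr (hD : IsOpen D) {H : ℝ} {w v : Space d → ℂ} (hw : MemV D H w)
    (hv : v =ᵐ[volume.restrict (S D H)] w) : trace D H v = trace D H w := by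
  have hv' := hw.congr hv
  obtain ⟨φ, h1, h2⟩ := hw.exists_tendstoH1 hD
  refine trace_eq_of_isTrace hD hv' (isTrace_of_tendsto h1 ?_ (tendsto_hat_trace hD hw h1 h2).2)
  refine ⟨h2.tendsto.congr fun m => eLpNorm_congr_ae ?_,
    fun i => (h2.tendsto_deriv i).congr fun m => eLpNorm_congr_ae ?_⟩
  · filter_upwards [hv] with x hx
    rw [hx]
  · filter_upwards [weakDeriv_congr (isOpen_S hD H) ((hw.approxH1 hD).hasWeakDeriv i) hv.symm]
      with x hx
    rw [hx]

lemma IsTest.fourier_trace_ae_eq (hD : IsOpen D) (h : IsTest D g) (H : ℝ) :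
    (𝓕 (trace D H g) : Lp ℂ 2 (volume : Measure (Horiz d))) =ᵐ[volume] fun η => hat g η H := by
  have e : trace D H g = (h.slice H).toLp 2 volume := by
    refine trace_eq_of_isTrace hD (h.memV hD H)
      ⟨fun _ => g, fun _ => h, ⟨by simp, fun i => ?_⟩, ?_⟩
    · have : eLpNorm (fun x => pd i g x - weakDeriv (S D H) i g x) 2 (volume.restrict (S D H)) = 0 := by
        rw [← eLpNorm_zero (p := 2) (μ := volume.restrict (S D H)) (ε := ℂ)]
        refine eLpNorm_congr_ae ?_
        filter_upwards [h.weakDeriv_ae_eq hD H i] with x hx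
        simp [hx]
      rw [this]
      exact tendsto_const_nhds
    · have : eLpNorm (fun y => g (y, H) - ((h.slice H).toLp 2 (volume : Measure (Horiz d))) y) 2
          volume = 0 := by
        rw [← eLpNorm_zero (p := 2) (μ := (volume : Measure (Horiz d))) (ε := ℂ)]
        refine eLpNorm_congr_ae ?_
        filter_upwards [SchwartzMap.coeFn_toLp (h.slice H) 2 volume] with y hy
        rw [hy, h.slice_apply, sub_self]
        rfl
      simp only [this]
      exact tendsto_const_nhds
  rw [e]
  exact coeFn_fourier_slice h H

end RoughLayer

end

noncomputable section

namespace RoughLayer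

variable {d : ℕ} {D Ω Ω' : Set (Space d)} {g φ ψ : Space d → ℂ}

/-! ### Green's formula below `Γ_H` -/

lemma isTest_zero : IsTest Ω (fun _ : Space d => (0 : ℂ)) where
  smooth := contDiff_const
  compact := HasCompactSupport.zero
  subset := by simp [tsupport]

lemma isTest_sum {ι : Type*} (s : Finset ι) {f : ι → Space d → ℂ} (h : ∀ i, IsTest Ω (f i)) :
    IsTest Ω (fun x => ∑ i ∈ s, f i x) := by
  classical
  induction s using Finset.induction_on with
  | empty => simpa using isTest_zero
  | insert a s ha ih => simpa [Finset.sum_insert ha] using (h a).add ih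

lemma IsTest.lap (h : IsTest Ω φ) : IsTest Ω (lap φ) :=
  isTest_sum _ fun i => (h.pderiv i).pderiv i

lemma pd_conj_fun (h : IsTest Ω φ) (i : Fin d ⊕ Unit) :
    pd i (fun x => conj (φ x)) = fun x => conj (pd i φ x) :=
  funext fun x => pd_conj i x (h.differentiable x)

lemma IsTest.lap_conj (h : IsTest Ω φ) :
    RoughLayer.lap (fun x => conj (φ x)) = fun x => conj (RoughLayer.lap φ x) := by
  funext x
  simp only [RoughLayer.lap, map_sum]
  refine Finset.sum_congr rfl fun i _ => ?_
  rw [pd_conj_fun h, pd_conj_fun (h.pderiv i)]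

lemma integral_S_eq (h : IsTest D g) (H : ℝ) :
    ∫ x in S D H, g x = ∫ x in {x : Space d | x.2 ∈ Set.Iio H}, g x := by
  refine (setIntegral_eq_of_subset_of_forall_sdiff_eq_zero
    (measurableSet_lt measurable_snd measurable_const) ?_ fun x hx => ?_).symm
  · rw [S_eq]
    exact Set.inter_subset_right
  · refine h.eq_zero fun h' => hx.2 ?_
    rw [S_eq]
    exact ⟨h', hx.1⟩

/-- The integral is the transform at frequency `0`, where the factor `2πi η_i` vanishes. -/
lemma integral_pd_inl_slice (h : IsTest Ω g) (i : Fin d) (t : ℝ) :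
    ∫ y : Horiz d, pd (Sum.inl i) g (y, t) = 0 := by
  have := h.hat_pd_inl i 0 t
  simpa [hat_eq] using this

lemma IsTest.hasCompactSupport_vertical (h : IsTest Ω g) (y : Horiz d) :
    HasCompactSupport (fun t => g (y, t)) := by
  obtain ⟨C, R, -, -, -, hR⟩ := h.bound
  exact HasCompactSupport.intro (isCompact_Icc (a := -R) (b := R))
    fun t ht => hR y t (Or.inr (by rw [Set.mem_Icc, ← abs_le] at ht; exact not_le.1 ht))

lemma IsTest.continuous_vertical (h : IsTest Ω g) (y : Horiz d) :
    Continuous (fun t => g (y, t)) := by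
  have := h.continuous
  fun_prop

lemma integral_Iio_pd_inr (h : IsTest Ω g) (y : Horiz d) (H : ℝ) :
    ∫ t in Set.Iio H, pd (Sum.inr ()) g (y, t) = g (y, H) := by
  have h' := h.pderiv (Sum.inr ())
  rw [← integral_Iic_eq_integral_Iio, integral_Iic_of_hasDerivAt_of_tendsto (m := 0)
    (h.hasDerivAt_slice y H).continuousAt.continuousWithinAt (fun t _ => h.hasDerivAt_slice y t)
    ((h'.continuous_vertical y).integrable_of_hasCompactSupport
      (h'.hasCompactSupport_vertical y)).integrableOn, sub_zero]
  exact ((h.hasCompactSupport_vertical y).is_zero_at_infty).mono_left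
    (by rw [cocompact_eq_atBot_atTop]; exact le_sup_left)

lemma integrable_slab (h : IsTest Ω g) (T : Set ℝ) :
    Integrable g ((volume : Measure (Horiz d)).prod (volume.restrict T)) := by
  rw [← restrict_slab]
  exact h.integrable _

lemma integral_S_pd_inl (h : IsTest D g) (i : Fin d) (H : ℝ) :
    ∫ x in S D H, pd (Sum.inl i) g x = 0 := by
  rw [integral_S_eq (h.pderiv _), restrict_slab,
    integral_prod_symm _ (integrable_slab (h.pderiv _) _)]
  simp [integral_pd_inl_slice h]

lemma integral_S_pd_inr (h : IsTest D g) (H : ℝ) :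
    ∫ x in S D H, pd (Sum.inr ()) g x = ∫ y, g (y, H) := by
  rw [integral_S_eq (h.pderiv _), restrict_slab,
    integral_prod _ (integrable_slab (h.pderiv _) _)]
  simp [integral_Iio_pd_inr h]

/-- Integrate `∂_i(φ ∂_i ψ)` over `S_H`: the horizontal directions contribute nothing, the vertical
one the term on `Γ_H`. There is no contribution from `∂D`, since `φ` is supported inside `D`. -/
lemma green_test (hφ : IsTest D φ) (hψ : IsTest Ω ψ) (H : ℝ) :
    ∫ x in S D H, φ x * lap ψ x = -(∑ i, ∫ x in S D H, pd i φ x * pd i ψ x) +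
      ∫ y, φ (y, H) * pd (Sum.inr ()) ψ (y, H) := by
  have e : ∀ i, ∫ x in S D H, pd i (fun x => φ x * pd i ψ x) x =
      (∫ x in S D H, φ x * pd i (pd i ψ) x) + ∫ x in S D H, pd i φ x * pd i ψ x := by
    intro i
    rw [← integral_add ((hφ.mul ((hψ.pderiv i).pderiv i)).integrable _)
      (((hφ.pderiv i).mul (hψ.pderiv i)).integrable _)]
    refine integral_congr_ae (.of_forall fun x => ?_)
    exact pd_mul i (hφ.differentiable x) ((hψ.pderiv i).differentiable x)
  have e1 : ∫ x in S D H, φ x * lap ψ x = ∑ i, ∫ x in S D H, φ x * pd i (pd i ψ) x := by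
    rw [← integral_finsetSum _ fun i _ => (hφ.mul ((hψ.pderiv i).pderiv i)).integrable _]
    simp only [lap, Finset.mul_sum]
  have e2 : ∑ i, ∫ x in S D H, pd i (fun x => φ x * pd i ψ x) x =
      ∫ y, φ (y, H) * pd (Sum.inr ()) ψ (y, H) := by
    rw [Fintype.sum_sum_type]
    simp only [Finset.univ_unique, Finset.sum_singleton, PUnit.default_eq_unit]
    rw [integral_S_pd_inr (hφ.mul (hψ.pderiv _)), Finset.sum_eq_zero fun i _ =>
      integral_S_pd_inl (hφ.mul (hψ.pderiv (Sum.inl i))) i H, zero_add]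
  simp_rw [e, Finset.sum_add_distrib] at e2
  rw [e1, ← e2]
  ring

/-- Each term is continuous along the sequence that defines the trace: `H¹(S_H)` convergence for the
volume terms, `L²` convergence on `Γ_H` for the boundary term. -/
lemma green_lower (hD : IsOpen D) {H : ℝ} {w : Space d → ℂ} (hw : MemV D H w) (hψ : IsTest Ω ψ) :
    ∫ x in S D H, w x * lap ψ x = -(∑ i, ∫ x in S D H, weakDeriv (S D H) i w x * pd i ψ x) +
      ∫ y, trace D H w y * pd (Sum.inr ()) ψ (y, H) := by
  obtain ⟨φ, h1, h2, h3⟩ := isTrace_trace hD hw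
  have ha := hw.approxH1 hD
  have l1 := tendsto_integral_mul (fun m => (h1 m).memLp (volume.restrict (S D H))) ha.memLp
    (hψ.lap.memLp _) h2.tendsto
  have l2 := tendsto_finsetSum Finset.univ fun i _ => tendsto_integral_mul
    (fun m => ((h1 m).pderiv i).memLp (volume.restrict (S D H))) (ha.memLp' i)
    ((hψ.pderiv i).memLp _) (h2.tendsto_deriv i)
  have l3 := tendsto_integral_mul (fun m => (h1 m).memLp_slice H) (Lp.memLp (trace D H w))
    ((hψ.pderiv (Sum.inr ())).memLp_slice H) h3
  exact tendsto_nhds_unique l1 ((l2.neg.add l3).congr fun m => (green_test (h1 m) hψ H).symm)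

lemma green_lower_conj (hD : IsOpen D) {H : ℝ} {w v : Space d → ℂ} (hw : MemV D H w)
    (hv : IsTest D v) :
    ∫ x in S D H, w x * conj (lap v x) =
      -(∑ i, innerS D H (weakDeriv (S D H) i w) (weakDeriv (S D H) i v)) +
      ∫ y, trace D H w y * conj (pd (Sum.inr ()) v (y, H)) := by
  have h1 := green_lower hD hw hv.star
  rw [hv.lap_conj] at h1
  simp_rw [pd_conj_fun hv] at h1
  rw [h1]
  congr 2
  refine Finset.sum_congr rfl fun i _ => integral_congr_ae ?_
  filter_upwards [hv.weakDeriv_ae_eq hD H i] with x hx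
  rw [hx]

/-! ### The symbol -/

/-- The symbol `z` in the variable of Mathlib's Fourier transform. -/
def symb (kp : ℝ) (η : Horiz d) : ℂ := z kp ((2 * Real.pi) • η)

lemma norm_two_pi_smul (η : Horiz d) : ‖(2 * Real.pi) • η‖ = 2 * Real.pi * ‖η‖ := by
  rw [norm_smul, Real.norm_of_nonneg (by positivity)]

lemma z_re_nonneg (kp : ℝ) (ξ : Horiz d) : 0 ≤ (z kp ξ).re := by
  rw [z]
  split_ifs
  · simp
  · simp [Real.sqrt_nonneg]

/-- For `|ξ| > k₊`, `(|ξ| - k₊)² ≤ ξ² - k₊²`; otherwise the left side is nonpositive. It is the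
source of all exponential decay of the plane waves in the frequency. -/
lemma z_re_ge {kp : ℝ} (hkp : 0 ≤ kp) (ξ : Horiz d) : ‖ξ‖ - kp ≤ (z kp ξ).re := by
  rw [z]
  split_ifs with h
  · simpa using h
  · rw [Complex.ofReal_re]
    refine Real.le_sqrt_of_sq_le ?_
    nlinarith [not_le.1 h]

/-- Both branches of the root give the same real square, so `exp(-t z)` solves the transformed
Helmholtz equation and conjugation does not change `z²`. -/
lemma z_sq {kp : ℝ} (hkp : 0 ≤ kp) (ξ : Horiz d) : z kp ξ ^ 2 = ((‖ξ‖ ^ 2 - kp ^ 2 : ℝ) : ℂ) := by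
  rw [z]
  split_ifs with h
  · rw [mul_pow, neg_sq, Complex.I_sq, ← Complex.ofReal_pow, Real.sq_sqrt]
    · push_cast; ring
    · nlinarith [norm_nonneg ξ]
  · rw [← Complex.ofReal_pow, Real.sq_sqrt]
    nlinarith [not_le.1 h]

lemma norm_z_le {kp : ℝ} (hkp : 0 ≤ kp) (ξ : Horiz d) : ‖z kp ξ‖ ≤ kp + ‖ξ‖ := by
  have h1 : ‖z kp ξ‖ ^ 2 ≤ (kp + ‖ξ‖) ^ 2 := by
    rw [← norm_pow, z_sq hkp, Complex.norm_real, Real.norm_eq_abs, abs_le]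
    constructor <;> nlinarith [norm_nonneg ξ]
  exact le_of_sq_le_sq h1 (by positivity)

lemma measurable_z (kp : ℝ) : Measurable (z kp : Horiz d → ℂ) := by
  unfold z
  refine Measurable.ite (measurableSet_le (by fun_prop) (by fun_prop)) ?_ ?_ <;> fun_prop

lemma I_mul_root (kp : ℝ) (ξ : Horiz d) : Complex.I * root kp ξ = -z kp ξ := by
  rw [root, z]
  split_ifs
  · ring
  · rw [← mul_assoc, Complex.I_mul_I]; ring

lemma symb_re_nonneg (kp : ℝ) (η : Horiz d) : 0 ≤ (symb kp η).re := z_re_nonneg kp _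

lemma symb_re_ge {kp : ℝ} (hkp : 0 ≤ kp) (η : Horiz d) :
    2 * Real.pi * ‖η‖ - kp ≤ (symb kp η).re := by
  rw [← norm_two_pi_smul]
  exact z_re_ge hkp _

lemma symb_sq {kp : ℝ} (hkp : 0 ≤ kp) (η : Horiz d) :
    symb kp η ^ 2 = (((2 * Real.pi * ‖η‖) ^ 2 - kp ^ 2 : ℝ) : ℂ) := by
  rw [← norm_two_pi_smul]
  exact z_sq hkp _

lemma norm_symb_le {kp : ℝ} (hkp : 0 ≤ kp) (η : Horiz d) :
    ‖symb kp η‖ ≤ kp + 2 * Real.pi * ‖η‖ := by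
  rw [← norm_two_pi_smul]
  exact norm_z_le hkp _

lemma measurable_symb (kp : ℝ) : Measurable (symb kp : Horiz d → ℂ) :=
  (measurable_z kp).comp (measurable_const_smul _)

/-! ### Change of variables -/

lemma two_pi_rpow_mul_self : ((2 * Real.pi) ^ (-(d : ℝ) / 2) : ℝ) * (2 * Real.pi) ^ (-(d : ℝ) / 2) *
    |(2 * Real.pi) ^ d| = 1 := by
  have hp : 0 < 2 * Real.pi := by positivity
  rw [← Real.rpow_add hp, abs_of_pos (by positivity), ← Real.rpow_natCast, ← Real.rpow_add hp]
  ring_nf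
  simp

/-- The two normalizing factors `(2π)^{-d/2}` cancel the Jacobian `(2π)^d` of `ξ = 2πη`. They come
from two transforms in the pairing, and from one transform and the prefactor in the plane wave
formula. -/
lemma integral_scale (f : Horiz d → ℂ) :
    ((((2 * Real.pi) ^ (-(d : ℝ) / 2) : ℝ) : ℂ) * (((2 * Real.pi) ^ (-(d : ℝ) / 2) : ℝ) : ℂ)) *
      ∫ ξ : Horiz d, f ((2 * Real.pi)⁻¹ • ξ) = ∫ η, f η := by
  rw [Measure.integral_comp_inv_smul, Complex.real_smul, ← mul_assoc, finrank_euclideanSpace,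
    Fintype.card_fin, ← Complex.ofReal_mul, ← Complex.ofReal_mul, two_pi_rpow_mul_self,
    Complex.ofReal_one, one_mul]

/-- The plane wave `exp(-(x_n - H) Z(η) + 2πi x̃·η)`. -/
def wave (kp H : ℝ) (x : Space d) (η : Horiz d) : ℂ :=
  Complex.exp (-((x.2 - H : ℝ) : ℂ) * symb kp η +
    ((2 * Real.pi * inner ℝ x.1 η : ℝ) : ℂ) * Complex.I)

lemma planeWaves_eq (kp H : ℝ) (F : Lp ℂ 2 (volume : Measure (Horiz d))) (x : Space d) :
    planeWaves kp H F x =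
      ∫ η, wave kp H x η * (𝓕 F : Lp ℂ 2 (volume : Measure (Horiz d))) η := by
  have h2 : (2 * Real.pi) ≠ 0 := by positivity
  rw [← integral_scale, planeWaves, mul_assoc]
  congr 1
  rw [← integral_const_mul]
  refine integral_congr_ae (.of_forall fun ξ => ?_)
  simp only [fourierHat, wave, symb]
  rw [smul_inv_smul₀ h2, inner_smul_right, mul_inv_cancel_left₀ h2]
  have : Complex.I * (((x.2 - H : ℝ) : ℂ) * root kp ξ + ((inner ℝ x.1 ξ : ℝ) : ℂ)) =
      -((x.2 - H : ℝ) : ℂ) * z kp ξ + ((inner ℝ x.1 ξ : ℝ) : ℂ) * Complex.I := by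
    linear_combination ((x.2 - H : ℝ) : ℂ) * I_mul_root kp ξ
  rw [this]
  ring

lemma dtnPairing_eq (kp : ℝ) (F G : Lp ℂ 2 (volume : Measure (Horiz d))) :
    dtnPairing kp F G = ∫ η, symb kp η * (𝓕 F : Lp ℂ 2 (volume : Measure (Horiz d))) η *
      conj ((𝓕 G : Lp ℂ 2 (volume : Measure (Horiz d))) η) := by
  have h2 : (2 * Real.pi) ≠ 0 := by positivity
  rw [← integral_scale, dtnPairing, ← integral_const_mul]
  refine integral_congr_ae (.of_forall fun ξ => ?_)
  simp only [fourierHat, dtnHat, symb, map_mul, Complex.conj_ofReal]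
  rw [smul_inv_smul₀ h2]
  ring

end RoughLayer

end

noncomputable section

namespace RoughLayer

variable {d : ℕ} {D Ω Ω' : Set (Space d)} {g φ ψ v : Space d → ℂ}

/-! ### Decay of the plane waves -/

lemma exists_pow_mul_exp_neg_le (c : ℝ) (hc : 0 < c) (n : ℕ) :
    ∃ C, 0 ≤ C ∧ ∀ s : ℝ, 0 ≤ s → (1 + s) ^ n * Real.exp (-(c * s)) ≤ C := by
  -- The constant comes from `(c(1 + s))^n / n! ≤ exp(c(1 + s))`, one term of the exponential
  -- series.
  refine ⟨Real.exp c * n.factorial / c ^ n, by positivity, fun s hs => ?_⟩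
  have h1 := Real.pow_div_factorial_le_exp (c * (1 + s)) (by positivity) n
  rw [div_le_iff₀ (by positivity), mul_pow] at h1
  rw [le_div_iff₀ (by positivity)]
  calc (1 + s) ^ n * Real.exp (-(c * s)) * c ^ n = c ^ n * (1 + s) ^ n * Real.exp (-(c * s)) := by
        ring
    _ ≤ Real.exp (c * (1 + s)) * n.factorial * Real.exp (-(c * s)) := by gcongr
    _ = Real.exp c * n.factorial := by
      rw [mul_right_comm, ← Real.exp_add]; ring_nf

/-- The modulus of the plane waves at height `τ` above `Γ_H`. -/
def damp (kp τ : ℝ) (η : Horiz d) : ℝ := Real.exp (-τ * (symb kp η).re)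

lemma damp_nonneg (kp τ : ℝ) (η : Horiz d) : 0 ≤ damp kp τ η := (Real.exp_pos _).le

lemma damp_le_one (kp : ℝ) {τ : ℝ} (hτ : 0 ≤ τ) (η : Horiz d) : damp kp τ η ≤ 1 := by
  rw [damp, Real.exp_le_one_iff]
  nlinarith [symb_re_nonneg kp η]

lemma measurable_damp (kp τ : ℝ) : Measurable (damp kp τ : Horiz d → ℝ) := by
  have := measurable_symb kp (d := d)
  unfold damp
  fun_prop

lemma norm_wave (kp H : ℝ) (x : Space d) (η : Horiz d) :
    ‖wave kp H x η‖ = damp kp (x.2 - H) η := by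
  rw [wave, damp, Complex.norm_exp]
  simp

lemma exists_damp_le {kp τ : ℝ} (hkp : 0 ≤ kp) (hτ : 0 < τ) (n : ℕ) :
    ∃ C, 0 ≤ C ∧ ∀ η : Horiz d, (1 + ‖η‖) ^ n * damp kp τ η ≤ C := by
  obtain ⟨C, hC0, hC⟩ := exists_pow_mul_exp_neg_le (τ * (2 * Real.pi)) (by positivity) n
  refine ⟨Real.exp (τ * kp) * C, by positivity, fun η => ?_⟩
  have h1 : damp kp τ η ≤ Real.exp (τ * kp) * Real.exp (-(τ * (2 * Real.pi) * ‖η‖)) := by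
    rw [damp, ← Real.exp_add, Real.exp_le_exp]
    nlinarith [symb_re_ge hkp η]
  calc _ ≤ (1 + ‖η‖) ^ n * (Real.exp (τ * kp) * Real.exp (-(τ * (2 * Real.pi) * ‖η‖))) := by gcongr
    _ = Real.exp (τ * kp) * ((1 + ‖η‖) ^ n * Real.exp (-(τ * (2 * Real.pi) * ‖η‖))) := by ring
    _ ≤ _ := by gcongr; exact hC _ (norm_nonneg η)

lemma memLp_inv_one_add_norm : MemLp (fun η : Horiz d => ((1 + ‖η‖) ^ (d + 1))⁻¹) 2 volume := by
  have hc : Continuous (fun η : Horiz d => ((1 + ‖η‖) ^ (d + 1))⁻¹) :=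
    Continuous.inv₀ (by fun_prop) fun η => by positivity
  rw [memLp_two_iff_integrable_sq hc.aestronglyMeasurable]
  have h1 := integrable_one_add_norm (E := Horiz d) (μ := volume) (r := ((2 * (d + 1) : ℕ) : ℝ))
    (by rw [finrank_euclideanSpace, Fintype.card_fin]; push_cast; linarith)
  refine h1.congr (.of_forall fun η => ?_)
  dsimp only
  rw [Real.rpow_neg (by positivity), Real.rpow_natCast, ← inv_pow, ← inv_pow, ← pow_mul, mul_comm 2]

lemma memLp_damp {kp τ : ℝ} (hkp : 0 ≤ kp) (hτ : 0 < τ) :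
    MemLp (fun η : Horiz d => (1 + ‖η‖) * damp kp τ η) 2 volume := by
  -- Of the `d + 2` powers one absorbs the weight `1 + |η|`; the other `d + 1` leave a square
  -- integrable majorant, as `2(d + 1) > d`.
  obtain ⟨C, hC0, hC⟩ := exists_damp_le (d := d) hkp hτ (d + 2)
  refine (memLp_inv_one_add_norm.const_mul C).mono ?_ (.of_forall fun η => ?_)
  · have := measurable_damp kp τ (d := d)
    exact Measurable.aestronglyMeasurable (by fun_prop)
  · rw [Real.norm_of_nonneg (mul_nonneg (by positivity) (damp_nonneg _ _ _)),
      Real.norm_of_nonneg (by positivity), ← div_eq_mul_inv, le_div_iff₀ (by positivity)]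
    refine le_trans (le_of_eq ?_) (hC η)
    ring

/-- Strictly above `Γ_H` the plane wave integral of an `L²` density converges absolutely, with one
power of `|η|` to spare for a derivative. -/
lemma integrable_damp_mul {kp τ : ℝ} (hkp : 0 ≤ kp) (hτ : 0 < τ) {G : Horiz d → ℂ}
    (hG : MemLp G 2 volume) : Integrable (fun η => (1 + ‖η‖) * damp kp τ η * ‖G η‖) :=
  (memLp_damp hkp hτ).integrable_mul hG.norm

lemma measurable_wave (kp H : ℝ) :
    Measurable (fun p : Space d × Horiz d => wave kp H p.1 p.2) := by
  have := measurable_symb kp (d := d)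
  unfold wave
  fun_prop

lemma integrable_wave_mul {kp H : ℝ} (hkp : 0 ≤ kp) {x : Space d} (hx : H < x.2) {G : Horiz d → ℂ}
    (hG : MemLp G 2 volume) {m : Horiz d → ℂ} (hm : Measurable m) {C : ℝ}
    (hmC : ∀ η, ‖m η‖ ≤ C * (1 + ‖η‖)) :
    Integrable (fun η => m η * wave kp H x η * G η) := by
  refine ((integrable_damp_mul hkp (sub_pos.2 hx) hG).const_mul C).mono' ?_
    (.of_forall fun η => ?_)
  · exact ((hm.mul ((measurable_wave kp H).comp measurable_prodMk_left)).aestronglyMeasurable).mul hG.1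
  · rw [norm_mul, norm_mul, norm_wave, ← mul_assoc, ← mul_assoc]
    have := damp_nonneg kp (x.2 - H) η
    gcongr
    exact hmC η

lemma wave_eq_mul (kp H : ℝ) (y η : Horiz d) (t : ℝ) :
    wave kp H (y, t) η = Complex.exp (-((t - H : ℝ) : ℂ) * symb kp η) *
      ((Real.fourierChar (inner ℝ y η) : Circle) : ℂ) := by
  rw [wave, Complex.exp_add, Real.fourierChar_apply]

lemma conj_hat (h : Space d → ℂ) (η : Horiz d) (t : ℝ) :
    conj (hat h η t) = ∫ y, ((Real.fourierChar (inner ℝ y η) : Circle) : ℂ) * conj (h (y, t)) := by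
  rw [hat_eq, ← integral_conj]
  refine integral_congr_ae (.of_forall fun y => ?_)
  simp only [Circle.smul_def, smul_eq_mul, map_mul]
  rw [AddChar.map_neg_eq_inv, Circle.coe_inv_eq_conj, Complex.conj_conj]

/-! ### Green's formula above `Γ_H` -/

/-- Fubini, justified by the damping at `t > H`; the integral in `y` is then the conjugate transform
of the slice. -/
lemma integral_slice_planeWaves {kp H t : ℝ} (hkp : 0 ≤ kp) (ht : H < t) {G : Horiz d → ℂ}
    (hG : MemLp G 2 volume) (h : IsTest Ω g) :
    ∫ y, (∫ η, wave kp H (y, t) η * G η) * conj (g (y, t)) =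
      ∫ η, G η * Complex.exp (-((t - H : ℝ) : ℂ) * symb kp η) * conj (hat g η t) := by
  have hi : Integrable (fun p : Horiz d × Horiz d =>
      wave kp H (p.1, t) p.2 * G p.2 * conj (g (p.1, t)))
      ((volume : Measure (Horiz d)).prod volume) := by
    refine ((h.integrable_slice t).norm.mul_prod (integrable_damp_mul hkp (sub_pos.2 ht) hG)).mono'
      ?_ (.of_forall fun p => ?_)
    · refine AEStronglyMeasurable.mul (AEStronglyMeasurable.mul ?_ hG.1.comp_snd) ?_
      · exact ((measurable_wave kp H).comp
          (by fun_prop : Measurable fun p : Horiz d × Horiz d => (((p.1, t) : Space d), p.2))).aestronglyMeasurable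
      · have := (h.star.slice_smooth t).continuous
        exact (this.comp continuous_fst).aestronglyMeasurable
    · rw [norm_mul, norm_mul, norm_wave, RCLike.norm_conj, mul_comm]
      have := damp_nonneg kp (t - H) p.2
      gcongr
      nlinarith [norm_nonneg p.2]
  simp_rw [← integral_mul_const]
  rw [integral_integral_swap hi]
  refine integral_congr_ae (.of_forall fun η => ?_)
  dsimp only
  rw [conj_hat, ← integral_const_mul]
  refine integral_congr_ae (.of_forall fun y => ?_)
  dsimp only
  rw [wave_eq_mul]
  ring

lemma hat_const_mul (c : ℂ) (g : Space d → ℂ) (η : Horiz d) (t : ℝ) :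
    hat (fun x => c * g x) η t = c * hat g η t := by
  rw [hat_eq, hat_eq, ← integral_const_mul]
  refine integral_congr_ae (.of_forall fun y => ?_)
  simp only [Circle.smul_def, smul_eq_mul]
  ring

lemma hat_add (h : IsTest Ω φ) (h' : IsTest Ω' ψ) (η : Horiz d) (t : ℝ) :
    hat (fun x => φ x + ψ x) η t = hat φ η t + hat ψ η t := by
  simp_rw [hat_eq, smul_add]
  exact integral_add (integrable_fourierChar_smul h η t) (integrable_fourierChar_smul h' η t)

lemma hat_sum {ι : Type*} (s : Finset ι) {f : ι → Space d → ℂ} (h : ∀ i, IsTest Ω (f i))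
    (η : Horiz d) (t : ℝ) : hat (fun x => ∑ i ∈ s, f i x) η t = ∑ i ∈ s, hat (f i) η t := by
  simp_rw [hat_eq, Finset.smul_sum]
  exact integral_finsetSum _ fun i _ => integrable_fourierChar_smul (h i) η t

lemma hat_lap (h : IsTest Ω v) (η : Horiz d) (t : ℝ) :
    hat (lap v) η t = hat (pd (Sum.inr ()) (pd (Sum.inr ()) v)) η t -
      (((2 * Real.pi * ‖η‖) ^ 2 : ℝ) : ℂ) * hat v η t := by
  have e : lap v = fun x => ∑ i, pd i (pd i v) x := rfl
  rw [e, hat_sum _ fun i => (h.pderiv i).pderiv i, Fintype.sum_sum_type]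
  simp only [Finset.univ_unique, Finset.sum_singleton, PUnit.default_eq_unit]
  rw [mul_pow, EuclideanSpace.norm_sq_eq, sub_eq_add_neg, add_comm, add_right_inj]
  push_cast
  rw [Finset.mul_sum, Finset.sum_mul, ← Finset.sum_neg_distrib]
  refine Finset.sum_congr rfl fun i _ => ?_
  rw [(h.pderiv _).hat_pd_inl, h.hat_pd_inl, Real.norm_eq_abs, ← Complex.ofReal_pow, sq_abs]
  push_cast
  linear_combination (2 * Real.pi * (η i : ℂ)) ^ 2 * hat v η t * Complex.I_sq

lemma IsTest.const_mul (h : IsTest Ω φ) (c : ℂ) : IsTest Ω (fun x => c * φ x) where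
  smooth := contDiff_const.mul h.smooth
  compact := h.compact.mul_left (f := fun _ => c)
  subset := (tsupport_mul_subset_right (f := fun _ => c)).trans h.subset

lemma hat_helmholtz {kp : ℝ} (hkp : 0 ≤ kp) (h : IsTest Ω v) (η : Horiz d) (t : ℝ) :
    hat (fun x => lap v x + (kp : ℂ) ^ 2 * v x) η t =
      hat (pd (Sum.inr ()) (pd (Sum.inr ()) v)) η t - symb kp η ^ 2 * hat v η t := by
  rw [hat_add h.lap (h.const_mul _), hat_const_mul, hat_lap h, symb_sq hkp]
  push_cast
  ring

/-- The integrand is `exp(-(t - H) Z) (conj v̂'' - Z² conj v̂)`, an exact derivative. The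
contribution at `+∞` vanishes by the compact support of `v`, not by decay, since `Re Z` may be zero.
-/
lemma integral_vertical {kp : ℝ} (hkp : 0 ≤ kp) (h : IsTest Ω v) (η : Horiz d) (H : ℝ) :
    ∫ t in Set.Ioi H, Complex.exp (-((t - H : ℝ) : ℂ) * symb kp η) *
        conj (hat (fun x => lap v x + (kp : ℂ) ^ 2 * v x) η t) =
      -(conj (hat (pd (Sum.inr ()) v) η H) + symb kp η * conj (hat v η H)) := by
  set Z := symb kp η with hZ
  -- Although `Z` is not always real, its square is; without this the cross terms below would not
  -- cancel.
  have hZr : conj (Z ^ 2) = Z ^ 2 := by rw [hZ, symb_sq hkp, Complex.conj_ofReal]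
  have h1 := h.pderiv (Sum.inr ())
  have h2 := h1.pderiv (Sum.inr ())
  set f : ℝ → ℂ := fun t => Complex.exp (-((t - H : ℝ) : ℂ) * Z) *
    (conj (hat (pd (Sum.inr ()) v) η t) + Z * conj (hat v η t)) with hf
  have hd : ∀ t, HasDerivAt f (Complex.exp (-((t - H : ℝ) : ℂ) * Z) *
        conj (hat (fun x => lap v x + (kp : ℂ) ^ 2 * v x) η t)) t := by
    intro t
    have a1 : HasDerivAt (fun t => conj (hat v η t)) (conj (hat (pd (Sum.inr ()) v) η t)) t :=
      (h.hasDerivAt_hat η t).star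
    have a2 : HasDerivAt (fun t => conj (hat (pd (Sum.inr ()) v) η t))
      (conj (hat (pd (Sum.inr ()) (pd (Sum.inr ()) v)) η t)) t := (h1.hasDerivAt_hat η t).star
    have a3 : HasDerivAt (fun t : ℝ => Complex.exp (-((t - H : ℝ) : ℂ) * Z))
        (Complex.exp (-((t - H : ℝ) : ℂ) * Z) * (-1 * Z)) t := by
      have b1 : HasDerivAt (fun t : ℝ => ((t - H : ℝ) : ℂ)) 1 t := by
        simpa using ((hasDerivAt_id t).sub_const H).ofReal_comp
      exact (b1.neg.mul_const Z).cexp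
    refine (a3.mul (a2.add (a1.const_mul Z))).congr_deriv ?_
    rw [hat_helmholtz hkp h, map_sub, map_mul, hZr, Pi.add_apply]
    ring
  have hcomp : HasCompactSupport (hat (fun x => lap v x + (kp : ℂ) ^ 2 * v x) η) :=
    (h.lap.add (h.const_mul _)).hasCompactSupport_hat η
  have hint : Integrable (fun t => Complex.exp (-((t - H : ℝ) : ℂ) * Z) *
        conj (hat (fun x => lap v x + (kp : ℂ) ^ 2 * v x) η t)) := by
    refine Continuous.integrable_of_hasCompactSupport ?_ ?_
    · have := (h.lap.add (h.const_mul ((kp : ℂ) ^ 2))).continuous_hat_left η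
      have hc : Continuous (fun w : ℂ => (starRingEnd ℂ) w) := Complex.continuous_conj
      exact (by fun_prop : Continuous fun t : ℝ => Complex.exp (-((t - H : ℝ) : ℂ) * Z)).mul
        (hc.comp this)
    · exact (hcomp.comp_left (g := fun w : ℂ => (starRingEnd ℂ) w) (by simp)).mul_left
  have hlim : Tendsto f atTop (𝓝 0) := by
    obtain ⟨R, -, hR⟩ := h.exists_hat_eq_zero
    obtain ⟨R', -, hR'⟩ := h1.exists_hat_eq_zero
    refine tendsto_const_nhds.congr' ?_
    filter_upwards [eventually_gt_atTop R, eventually_gt_atTop R'] with t ht ht'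
    simp [hf, hR η t (lt_of_lt_of_le ht (le_abs_self t)),
      hR' η t (lt_of_lt_of_le ht' (le_abs_self t))]
  rw [integral_Ioi_of_hasDerivAt_of_tendsto (hd H).continuousAt.continuousWithinAt
    (fun t _ => hd t) hint.integrableOn hlim]
  simp [hf]

/-- Down to `Γ_H` the damping is lost, so only its bound by `1` is used: `|G||ĝ| ≤ |G|² + |ĝ|²`,
with `G` restricted to the bounded range of heights where `ĝ` does not vanish. -/
lemma integrable_prod_hat {kp H : ℝ} {G : Horiz d → ℂ} (hG : MemLp G 2 volume) (h : IsTest Ω g) :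
    Integrable (fun p : ℝ × Horiz d =>
      G p.2 * Complex.exp (-((p.1 - H : ℝ) : ℂ) * symb kp p.2) * conj (hat g p.2 p.1))
      ((volume.restrict (Set.Ioi H)).prod (volume : Measure (Horiz d))) := by
  obtain ⟨R, -, hR⟩ := h.exists_hat_eq_zero
  have hc : Continuous (fun p : ℝ × Horiz d => hat g p.2 p.1) :=
    h.continuous_hat.comp continuous_swap
  have i1 : Integrable (fun p : ℝ × Horiz d =>
      (Set.Icc (-R) R).indicator (fun _ => (1 : ℝ)) p.1 * ‖G p.2‖ ^ 2)
      ((volume.restrict (Set.Ioi H)).prod (volume : Measure (Horiz d))) := by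
    refine Integrable.mul_prod (Integrable.mono_measure (ν := volume) ?_ Measure.restrict_le_self)
      ((memLp_two_iff_integrable_sq_norm hG.1).1 hG)
    rw [integrable_indicator_iff measurableSet_Icc]
    exact integrableOn_const (measure_Icc_lt_top).ne
  have i2 : Integrable (fun p : ℝ × Horiz d => ‖hat g p.2 p.1‖ ^ 2)
      ((volume.restrict (Set.Ioi H)).prod (volume : Measure (Horiz d))) := by
    rw [← memLp_two_iff_integrable_sq_norm hc.aestronglyMeasurable]
    refine ⟨hc.aestronglyMeasurable, ?_⟩
    have hm : Measurable (fun p : ℝ × Horiz d => ‖hat g p.2 p.1‖ₑ ^ 2) := by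
      have := hc.measurable
      fun_prop
    have hm' : Measurable (fun x => ‖g x‖ₑ ^ 2) := by
      have := h.continuous.measurable
      fun_prop
    refine ((ENNReal.pow_lt_top_iff (n := 2)).1 ?_).resolve_right (by norm_num)
    rw [eLpNorm_two_sq, lintegral_prod _ hm.aemeasurable]
    simp_rw [lintegral_hat h]
    rw [← lintegral_slab (Set.Ioi H) hm', ← eLpNorm_two_sq]
    exact ENNReal.pow_lt_top (h.memLp _).2
  refine (i1.add i2).mono' ?_ ?_
  · refine (hG.1.comp_snd.mul ?_).mul (Complex.continuous_conj.comp hc).aestronglyMeasurable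
    have := measurable_symb kp (d := d)
    exact Measurable.aestronglyMeasurable (by fun_prop)
  · have hpos : ∀ᵐ p : ℝ × Horiz d ∂((volume.restrict (Set.Ioi H)).prod
        (volume : Measure (Horiz d))), H < p.1 :=
      Measure.quasiMeasurePreserving_fst.ae (ae_restrict_mem measurableSet_Ioi)
    filter_upwards [hpos] with p hp
    rw [norm_mul, norm_mul, RCLike.norm_conj, Pi.add_apply, Complex.norm_exp]
    have e1 : Real.exp ((-((p.1 - H : ℝ) : ℂ) * symb kp p.2).re) ≤ 1 := by
      rw [Real.exp_le_one_iff, ← Complex.ofReal_neg, Complex.re_ofReal_mul]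
      nlinarith [symb_re_nonneg kp p.2]
    by_cases ht : p.1 ∈ Set.Icc (-R) R
    · rw [Set.indicator_of_mem ht]
      have e2 : ‖G p.2‖ * Real.exp ((-((p.1 - H : ℝ) : ℂ) * symb kp p.2).re) ≤ ‖G p.2‖ :=
        mul_le_of_le_one_right (norm_nonneg _) e1
      nlinarith [mul_le_mul_of_nonneg_right e2 (norm_nonneg (hat g p.2 p.1)),
        sq_nonneg (‖G p.2‖ - ‖hat g p.2 p.1‖), sq_nonneg (‖G p.2‖ + ‖hat g p.2 p.1‖)]
    · rw [Set.indicator_of_notMem ht,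
        hR p.2 p.1 (by rw [Set.mem_Icc, ← abs_le] at ht; exact not_le.1 ht)]
      simp

lemma U_eq (H : ℝ) : U d H = {x | x.2 ∈ Set.Ioi H} := rfl

lemma green_upper {kp H : ℝ} (hkp : 0 ≤ kp) (F : Lp ℂ 2 (volume : Measure (Horiz d)))
    (h : IsTest Ω v)
    (hint : Integrable (fun x => planeWaves kp H F x * conj (lap v x + (kp : ℂ) ^ 2 * v x))
      (volume.restrict (U d H))) :
    ∫ x in U d H, planeWaves kp H F x * conj (lap v x + (kp : ℂ) ^ 2 * v x) =
      -∫ η, (𝓕 F : Lp ℂ 2 (volume : Measure (Horiz d))) η *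
        (conj (hat (pd (Sum.inr ()) v) η H) + symb kp η * conj (hat v η H)) := by
  have hG := Lp.memLp (𝓕 F : Lp ℂ 2 (volume : Measure (Horiz d)))
  set G : Horiz d → ℂ := ⇑(𝓕 F : Lp ℂ 2 (volume : Measure (Horiz d))) with hGdef
  have ht := h.lap.add (h.const_mul ((kp : ℂ) ^ 2))
  rw [U_eq, restrict_slab] at hint ⊢
  rw [integral_prod_symm _ hint]
  have e1 : ∫ t in Set.Ioi H, ∫ y, planeWaves kp H F (y, t) *
      conj (lap v (y, t) + (kp : ℂ) ^ 2 * v (y, t)) =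
      ∫ t in Set.Ioi H, ∫ η, G η * Complex.exp (-((t - H : ℝ) : ℂ) * symb kp η) *
        conj (hat (fun x => lap v x + (kp : ℂ) ^ 2 * v x) η t) := by
    refine setIntegral_congr_fun measurableSet_Ioi fun t htH => ?_
    rw [← integral_slice_planeWaves hkp htH hG ht]
    simp_rw [planeWaves_eq]
    rfl
  rw [e1, integral_integral_swap (integrable_prod_hat hG ht), ← integral_neg]
  refine integral_congr_ae (.of_forall fun η => ?_)
  dsimp only
  simp_rw [mul_assoc]
  rw [integral_const_mul, integral_vertical hkp h, mul_neg]

end RoughLayer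

end

noncomputable section

namespace RoughLayer

variable {d : ℕ} {D Ω Ω' : Set (Space d)} {g φ ψ v : Space d → ℂ}

/-! ### The Dirichlet to Neumann pairing on `H^{1/2}` -/

/-- The symbol divided by the weight of `H^{1/2}`. -/
def symbQuot (kp : ℝ) (η : Horiz d) : ℂ := symb kp η / ((1 + 2 * Real.pi * ‖η‖ : ℝ) : ℂ)

lemma weight_pos (η : Horiz d) : 0 < 1 + 2 * Real.pi * ‖η‖ := by positivity

/-- The symbol grows no faster than the weight, so moving the weight into the measure makes the
pairing a bounded form on `L²` of `halfMeasure`. -/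
lemma norm_symbQuot_le {kp : ℝ} (hkp : 0 ≤ kp) (η : Horiz d) : ‖symbQuot kp η‖ ≤ kp + 1 := by
  rw [symbQuot, norm_div, Complex.norm_real, Real.norm_of_nonneg (weight_pos η).le,
    div_le_iff₀ (weight_pos η)]
  have := norm_symb_le hkp η
  nlinarith [mul_nonneg hkp (mul_nonneg Real.pi_pos.le (norm_nonneg η))]

lemma memLp_symbQuot_mul {kp : ℝ} (hkp : 0 ≤ kp) {G : Horiz d → ℂ} {μ : Measure (Horiz d)}
    (hG : MemLp G 2 μ) : MemLp (fun η => symbQuot kp η * conj (G η)) 2 μ := by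
  refine hG.of_le_mul (c := kp + 1) ?_ (.of_forall fun η => ?_)
  · refine AEStronglyMeasurable.mul ?_ (Complex.continuous_conj.comp_aestronglyMeasurable hG.1)
    have := measurable_symb kp (d := d)
    unfold symbQuot
    exact Measurable.aestronglyMeasurable (by fun_prop)
  · rw [norm_mul, RCLike.norm_conj]
    gcongr
    exact norm_symbQuot_le hkp η

lemma symb_mul_eq (kp : ℝ) (F G : Horiz d → ℂ) (η : Horiz d) :
    symb kp η * F η * conj (G η) =
      (ENNReal.ofReal (1 + 2 * Real.pi * ‖η‖)).toReal • (F η * (symbQuot kp η * conj (G η))) := by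
  have h : ((1 + 2 * Real.pi * ‖η‖ : ℝ) : ℂ) ≠ 0 := Complex.ofReal_ne_zero.2 (weight_pos η).ne'
  rw [ENNReal.toReal_ofReal (weight_pos η).le, Complex.real_smul, symbQuot]
  field_simp

lemma integrable_symb_mul {kp : ℝ} (hkp : 0 ≤ kp) {F G : Horiz d → ℂ}
    (hF : MemLp F 2 (halfMeasure d)) (hG : MemLp G 2 (halfMeasure d)) :
    Integrable (fun η => symb kp η * F η * conj (G η)) := by
  have h1 : Integrable (fun η => F η * (symbQuot kp η * conj (G η))) (halfMeasure d) :=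
    hF.integrable_mul (memLp_symbQuot_mul hkp hG)
  rw [halfMeasure, integrable_withDensity_iff_integrable_smul' (by fun_prop)
    (.of_forall fun _ => ENNReal.ofReal_lt_top)] at h1
  exact h1.congr (.of_forall fun η => (symb_mul_eq kp F G η).symm)

lemma integral_symb_mul (kp : ℝ) (F G : Horiz d → ℂ) :
    ∫ η, symb kp η * F η * conj (G η) =
      ∫ η, F η * (symbQuot kp η * conj (G η)) ∂(halfMeasure d) := by
  rw [halfMeasure, integral_withDensity_eq_integral_toReal_smul (by fun_prop)
    (.of_forall fun _ => ENNReal.ofReal_lt_top)]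
  exact integral_congr_ae (.of_forall fun η => symb_mul_eq kp F G η)

lemma eLpNorm_conj_sub {α : Type*} [MeasurableSpace α] {μ : Measure α} (f f₀ : α → ℂ) :
    eLpNorm (fun x => conj (f x) - conj (f₀ x)) 2 μ = eLpNorm (fun x => f x - f₀ x) 2 μ := by
  refine eLpNorm_congr_norm_ae (.of_forall fun x => ?_)
  rw [← map_sub, RCLike.norm_conj]

lemma MemLp.conj {α : Type*} [MeasurableSpace α] {μ : Measure α} {f : α → ℂ} (hf : MemLp f 2 μ) :
    MemLp (fun x => conj (f x)) 2 μ := hf.star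

lemma tendsto_integral_mul_conj {α : Type*} [MeasurableSpace α] {μ : Measure α}
    {f : ℕ → α → ℂ} {f₀ h : α → ℂ} (hf : ∀ m, MemLp (f m) 2 μ) (hf₀ : MemLp f₀ 2 μ)
    (hh : MemLp h 2 μ) (hlim : Tendsto (fun m => eLpNorm (fun x => f m x - f₀ x) 2 μ) atTop (𝓝 0)) :
    Tendsto (fun m => ∫ x, h x * conj (f m x) ∂μ) atTop (𝓝 (∫ x, h x * conj (f₀ x) ∂μ)) := by
  simp_rw [mul_comm (h _)]
  refine tendsto_integral_mul (fun m => MemLp.conj (hf m)) (MemLp.conj hf₀) hh ?_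
  simpa only [eLpNorm_conj_sub] using hlim

/-- `H¹` convergence gives convergence of the transformed traces in the weighted `L²` space, and
there the pairing is an integral against a fixed `L²` function. Plain `L²` convergence of traces
would not suffice. -/
lemma tendsto_dtnPairing (hD : IsOpen D) {H kp : ℝ} (hkp : 0 ≤ kp) {w v : Space d → ℂ}
    (hw : MemV D H w) (hv : MemV D H v) {φ : ℕ → Space d → ℂ} (hφ : ∀ m, IsTest D (φ m))
    (hlim : TendstoH1 (S D H) φ v) :
    Tendsto (fun m => dtnPairing kp (trace D H w) (trace D H (φ m))) atTop
      (𝓝 (dtnPairing kp (trace D H w) (trace D H v))) := by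
  obtain ⟨hG, hGlim⟩ := tendsto_hat_trace hD hv hφ hlim
  have hF := memLp_fourier_trace hD hw
  have e : ∀ m, dtnPairing kp (trace D H w) (trace D H (φ m)) =
      ∫ η, (𝓕 (trace D H w) : Lp ℂ 2 (volume : Measure (Horiz d))) η *
        (symbQuot kp η * conj (hat (φ m) η H)) ∂(halfMeasure d) := fun m => by
    rw [dtnPairing_eq, ← integral_symb_mul]
    refine integral_congr_ae ?_
    filter_upwards [(hφ m).fourier_trace_ae_eq hD H] with η hη
    rw [hη]
  simp_rw [e]
  rw [dtnPairing_eq, integral_symb_mul]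
  have hF2 : MemLp (fun η => (𝓕 (trace D H w) : Lp ℂ 2 (volume : Measure (Horiz d))) η *
      symbQuot kp η) 2 (halfMeasure d) := by
    have := MemLp.conj (memLp_symbQuot_mul hkp hF)
    have h2 := memLp_symbQuot_mul hkp (MemLp.conj hF)
    refine h2.ae_eq (.of_forall fun η => ?_)
    simp [mul_comm]
  have := tendsto_integral_mul_conj (fun m => (hφ m).memLp_hat_half hD H) hG hF2 hGlim
  simpa only [mul_assoc] using this

/-! ### The two problems tested with smooth functions -/

lemma volume_plane (H : ℝ) : (volume : Measure (Space d)) {x | x.2 = H} = 0 := by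
  have h := restrict_slab (d := d) {H}
  rw [Measure.restrict_eq_zero.2 (by simp : (volume : Measure ℝ) {H} = 0), Measure.prod_zero] at h
  exact Measure.restrict_eq_zero.1 h

lemma diff_ae_eq_U {fp H : ℝ} (hD₁ : U d fp ⊆ D) (hH : fp ≤ H) :
    (D \ {x | x.2 < H} : Set (Space d)) =ᵐ[volume] U d H := by
  have h0 : ∀ᵐ x : Space d, x.2 ≠ H := by
    rw [ae_iff]
    simpa using volume_plane (d := d) H
  filter_upwards [h0] with x hx
  refine propext ⟨fun h => ?_, fun h => ⟨hD₁ (lt_of_le_of_lt hH h), ?_⟩⟩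
  · exact lt_of_le_of_ne (not_lt.1 h.2) (Ne.symm hx)
  · exact not_lt.2 (le_of_lt h)

lemma integral_D_eq {fp H : ℝ} (hD₁ : U d fp ⊆ D) (hH : fp ≤ H)
    {f : Space d → ℂ} (hf : IntegrableOn f D) :
    ∫ x in D, f x = (∫ x in S D H, f x) + ∫ x in U d H, f x := by
  rw [← integral_inter_add_sdiff (t := {x : Space d | x.2 < H})
    (measurableSet_lt measurable_snd measurable_const) hf, ← S_eq,
    setIntegral_congr_set (diff_ae_eq_U hD₁ hH)]

lemma memLp_top_sq_mul {α : Type*} [MeasurableSpace α] {μ : Measure α} {k u : α → ℂ}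
    (hk : MemLp k ∞ μ) (hu : MemLp u 2 μ) : MemLp (fun x => k x ^ 2 * u x) 2 μ := by
  have h1 : MemLp (k * u) 2 μ := hu.mul hk
  have h2 : MemLp (k * (k * u)) 2 μ := h1.mul hk
  refine h2.ae_eq (.of_forall fun x => ?_)
  simp only [Pi.mul_apply]
  ring

lemma integrable_mul_conj {α : Type*} [MeasurableSpace α] {μ : Measure α} {u v : α → ℂ}
    (hu : MemLp u 2 μ) (hv : MemLp v 2 μ) : Integrable (fun x => u x * conj (v x)) μ :=
  hu.integrable_mul (MemLp.conj hv)

lemma IsTest.exists_height (h : IsTest Ω v) (H : ℝ) : ∃ a, H < a ∧ ∀ x : Space d, a ≤ x.2 → v x = 0 := by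
  obtain ⟨C, R, -, -, -, hR⟩ := h.bound
  refine ⟨max H R + 1, by linarith [le_max_left H R], fun x hx => hR x.1 x.2 (Or.inr ?_)⟩
  exact lt_of_lt_of_le (by linarith [le_max_right H R]) (le_abs_self x.2)

/-- The test function vanishes above some height `a`, so only the square integrability of `u` in
`S_a` matters. -/
lemma integrableOn_helmholtz (hD : IsOpen D) {fp H : ℝ} (hH : fp ≤ H) {k u : Space d → ℂ}
    (hk : MemLp k ∞ (volume.restrict D)) (hu : ∀ a, fp < a → MemV D a u) (hv : IsTest D v) :
    IntegrableOn (fun x => u x * conj (lap v x) + k x ^ 2 * u x * conj (v x)) D := by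
  obtain ⟨a, ha, hva⟩ := hv.exists_height H
  obtain ⟨a', ha', hva'⟩ := hv.lap.exists_height H
  have hm := hu (max a a') (lt_of_le_of_lt hH (lt_of_lt_of_le ha (le_max_left _ _)))
  have hL := (hm.approxH1 hD).memLp
  have hk' := hk.mono_measure (Measure.restrict_mono_set volume (S_subset D (max a a')))
  refine IntegrableOn.of_forall_sdiff_eq_zero (s := S D (max a a')) ?_ hD.measurableSet
    fun x hx => ?_
  · exact (integrable_mul_conj hL (hv.lap.memLp _)).add
      (integrable_mul_conj (memLp_top_sq_mul hk' hL) (hv.memLp _))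
  · have : max a a' ≤ x.2 := by
      by_contra h
      exact hx.2 (by rw [S_eq]; exact ⟨hx.1, not_le.1 h⟩)
    rw [hva x ((le_max_left _ _).trans this), hva' x ((le_max_right _ _).trans this)]
    simp

/-- The core of both directions: Green's formulas below and above `Γ_H` are added, the normal
derivative terms cancel, and the Dirichlet to Neumann pairing remains. -/
lemma helmholtz_eq_form (hD : IsOpen D) {fp H kp : ℝ} (hD₁ : U d fp ⊆ D) (hH : fp ≤ H)
    (hkp : 0 ≤ kp) {k u : Space d → ℂ} (hk : MemLp k ∞ (volume.restrict D))
    (hkU : ∀ᵐ x ∂(volume.restrict D), x ∈ closure (U d H) → k x = kp)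
    (hu : ∀ a, fp < a → MemV D a u)
    (hrad : ∀ᵐ x ∂(volume.restrict (U d H)), u x = planeWaves kp H (trace D H u) x)
    (hv : IsTest D v) :
    ∫ x in D, (u x * conj (lap v x) + k x ^ 2 * u x * conj (v x)) = -b D H kp k u v := by
  have hi := integrableOn_helmholtz hD hH hk hu hv
  -- The case `H = f₊` is allowed while membership is assumed only for `a > f₊`, hence the detour
  -- through `H + 1`.
  have huH : MemV D H u := (hu (H + 1) (by linarith)).mono (by linarith)
  have hL := (huH.approxH1 hD).memLp
  have hk' := hk.mono_measure (Measure.restrict_mono_set volume (S_subset D H))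
  have hUD : U d H ⊆ D := fun x hx => hD₁ (lt_of_le_of_lt hH hx)
  have hae : (fun x => u x * conj (lap v x) + k x ^ 2 * u x * conj (v x))
      =ᵐ[volume.restrict (U d H)] fun x =>
      planeWaves kp H (trace D H u) x * conj (lap v x + (kp : ℂ) ^ 2 * v x) := by
    filter_upwards [hrad, ae_restrict_of_ae_restrict_of_subset hUD hkU,
      ae_restrict_mem (isOpen_U H).measurableSet] with x h1 h2 h3
    rw [h2 (subset_closure h3), ← h1, map_add, map_mul, map_pow, Complex.conj_ofReal]
    ring
  have hiU : Integrable (fun x =>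
      planeWaves kp H (trace D H u) x * conj (lap v x + (kp : ℂ) ^ 2 * v x))
      (volume.restrict (U d H)) := (hi.mono_set hUD).congr hae
  have hF := memLp_fourier_trace hD huH
  have i1 : Integrable (fun η => (𝓕 (trace D H u) : Lp ℂ 2 (volume : Measure (Horiz d))) η *
      conj (hat (pd (Sum.inr ()) v) η H)) :=
    integrable_mul_conj (Lp.memLp _) ((hv.pderiv _).memLp_hat H)
  have i2 := integrable_symb_mul hkp hF (hv.memLp_hat_half hD H)
  have edtn : dtnPairing kp (trace D H u) (trace D H v) = ∫ η, symb kp η *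
      (𝓕 (trace D H u) : Lp ℂ 2 (volume : Measure (Horiz d))) η * conj (hat v η H) := by
    rw [dtnPairing_eq]
    refine integral_congr_ae ?_
    filter_upwards [hv.fourier_trace_ae_eq hD H] with η hη
    rw [hη]
  have eU : ∫ x in U d H, (u x * conj (lap v x) + k x ^ 2 * u x * conj (v x)) =
      -((∫ y, trace D H u y * conj (pd (Sum.inr ()) v (y, H))) +
        dtnPairing kp (trace D H u) (trace D H v)) := by
    rw [integral_congr_ae hae, green_upper hkp _ hv hiU, integral_mul_conj_slice (hv.pderiv _),
      edtn, ← integral_add i1 i2]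
    congr 1
    refine integral_congr_ae (.of_forall fun η => ?_)
    dsimp only
    ring
  have eS : ∫ x in S D H, (u x * conj (lap v x) + k x ^ 2 * u x * conj (v x)) =
      (∫ x in S D H, u x * conj (lap v x)) + innerS D H (fun x => k x ^ 2 * u x) v :=
    integral_add (integrable_mul_conj hL (hv.lap.memLp _))
      (integrable_mul_conj (memLp_top_sq_mul hk' hL) (hv.memLp _))
  rw [integral_D_eq hD₁ hH hi, eS, eU, green_lower_conj hD huH hv, b]
  ring

lemma innerS_congr {H : ℝ} {u u' v v' : Space d → ℂ} (hu : u =ᵐ[volume.restrict (S D H)] u')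
    (hv : v =ᵐ[volume.restrict (S D H)] v') : innerS D H u v = innerS D H u' v' := by
  refine integral_congr_ae ?_
  filter_upwards [hu, hv] with x h1 h2
  rw [h1, h2]

lemma b_congr (hD : IsOpen D) {H kp : ℝ} {k k' u u' v : Space d → ℂ}
    (hk : k =ᵐ[volume.restrict (S D H)] k') (hu : u' =ᵐ[volume.restrict (S D H)] u)
    (hm : MemV D H u) : b D H kp k u v = b D H kp k' u' v := by
  rw [b, b, trace_congr hD hm hu]
  congr 2
  · refine Finset.sum_congr rfl fun i _ => innerS_congr ?_ (ae_eq_refl _)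
    exact weakDeriv_congr (isOpen_S hD H) ((hm.approxH1 hD).hasWeakDeriv i) hu.symm
  · refine innerS_congr ?_ (ae_eq_refl _)
    filter_upwards [hk, hu] with x h1 h2
    rw [h1, h2]

/-- The closure of `S_H` stays in `x_n ≤ H`, so the support condition makes `g` vanish almost
everywhere on `U_H`. -/
lemma integral_g_eq {fp H : ℝ} (hD₁ : U d fp ⊆ D) (hH : fp ≤ H)
    {g : Space d → ℂ} (hg : MemLp g 2 (volume.restrict D))
    (hsupp : ∀ᵐ x ∂(volume.restrict D), x ∉ closure (S D H) → g x = 0) (hv : IsTest D v) :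
    ∫ x in D, g x * conj (v x) = innerS D H g v := by
  rw [integral_D_eq hD₁ hH (integrable_mul_conj hg (hv.memLp _))]
  have hUD : U d H ⊆ D := fun x hx => hD₁ (lt_of_le_of_lt hH hx)
  have hcl : closure (S D H) ⊆ {x : Space d | x.2 ≤ H} := by
    refine closure_minimal ?_ (isClosed_le continuous_snd continuous_const)
    rw [S_eq]
    exact fun x hx => (show x.2 < H from hx.2).le
  have : ∫ x in U d H, g x * conj (v x) = 0 := by
    refine integral_eq_zero_of_ae ?_
    filter_upwards [ae_restrict_of_ae_restrict_of_subset hUD hsupp,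
      ae_restrict_mem (isOpen_U H).measurableSet] with x h1 h2
    rw [h1 fun h => absurd (show x.2 ≤ H from hcl h) (not_le.2 (show H < x.2 from h2)), zero_mul]
    rfl
  rw [this, add_zero]
  rfl

/-- Solutions of the boundary value problem are solutions of the variational problem. -/
theorem IsBVPSolution.isVariationalSolution (hD : IsOpen D) {fp H kp : ℝ} (hD₁ : U d fp ⊆ D)
    (hH : fp ≤ H) (hkp : 0 ≤ kp) {g k u : Space d → ℂ} (hgk : AdmissibleData D H kp g k)
    (hu : IsBVPSolution D fp H kp g k u) : IsVariationalSolution D H kp g k u := by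
  have huH : MemV D H u := (hu.memV (H + 1) (by linarith)).mono (by linarith)
  have ha := huH.approxH1 hD
  have hk' := hgk.memLp_k.mono_measure (Measure.restrict_mono_set volume (S_subset D H))
  have hg' := hgk.memLp_g.mono_measure (Measure.restrict_mono_set volume (S_subset D H))
  refine ⟨huH, fun v hv => ?_⟩
  have key : ∀ v, IsTest D v → b D H kp k u v = -innerS D H g v := by
    intro v hv
    have h1 := helmholtz_eq_form hD hD₁ hH hkp hgk.memLp_k hgk.k_eq hu.memV hu.radiation hv
    -- The distributional equation is bilinear and the form sesquilinear, so the equation is tested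
    -- with `conj v`.
    have h2 := hu.helmholtz _ hv.star
    rw [hv.lap_conj, h1, integral_g_eq hD₁ hH hgk.memLp_g hgk.supp_g hv] at h2
    rw [← h2, neg_neg]
  obtain ⟨φ, hφ, hlim⟩ := hv.exists_tendstoH1 hD
  have hva := hv.approxH1 hD
  have l1 := tendsto_finsetSum Finset.univ fun i _ => tendsto_integral_mul_conj
    (fun m => ((hφ m).pderiv i).memLp (volume.restrict (S D H))) (hva.memLp' i) (ha.memLp' i)
    (hlim.tendsto_deriv i)
  have l2 := tendsto_integral_mul_conj (fun m => (hφ m).memLp (volume.restrict (S D H)))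
    hva.memLp (memLp_top_sq_mul hk' ha.memLp) hlim.tendsto
  have l3 := tendsto_dtnPairing hD hkp huH hv hφ hlim
  have l4 := tendsto_integral_mul_conj (fun m => (hφ m).memLp (volume.restrict (S D H)))
    hva.memLp hg' hlim.tendsto
  refine tendsto_nhds_unique ((l1.sub l2).add l3) (l4.neg.congr fun m => ?_)
  have h3 := key _ (hφ m)
  rw [innerS] at h3
  rw [← h3, b]
  congr 2
  refine Finset.sum_congr rfl fun i _ => innerS_congr (ae_eq_refl _) ?_
  exact ((hφ m).weakDeriv_ae_eq hD H i).symm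

/-! ### The extended data and the converse direction. -/

lemma extendG_ae_eq (hD : IsOpen D) (H : ℝ) (g : Space d → ℂ) :
    extendG D H g =ᵐ[volume.restrict (S D H)] g := by
  filter_upwards [ae_restrict_mem (isOpen_S hD H).measurableSet] with x hx
  rw [extendG, if_pos hx]

lemma extendK_ae_eq (hD : IsOpen D) (H kp : ℝ) (k : Space d → ℂ) :
    extendK D H kp k =ᵐ[volume.restrict (S D H)] k := by
  filter_upwards [ae_restrict_mem (isOpen_S hD H).measurableSet] with x hx
  rw [extendK, if_pos hx]

lemma extendSol_ae_eq (hD : IsOpen D) (H kp : ℝ) (w : Space d → ℂ) :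
    extendSol D H kp w =ᵐ[volume.restrict (S D H)] w := by
  filter_upwards [ae_restrict_mem (isOpen_S hD H).measurableSet] with x hx
  rw [extendSol, if_neg fun h => hx.2 (subset_closure h)]

lemma admissibleData_extend (hD : IsOpen D) {H kp : ℝ} {g k : Space d → ℂ}
    (hg : MemLp g 2 (volume.restrict (S D H))) (hk : MemLp k ∞ (volume.restrict (S D H))) :
    AdmissibleData D H kp (extendG D H g) (extendK D H kp k) where
  memLp_g := by
    have e : extendG D H g = (S D H).indicator g := by
      funext x
      simp [extendG, Set.indicator]
    rw [e]
    exact ((memLp_indicator_iff_restrict (isOpen_S hD H).measurableSet).2 hg).restrict D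
  supp_g := .of_forall fun x hx => by rw [extendG, if_neg fun h => hx (subset_closure h)]
  memLp_k := by
    have e : extendK D H kp k = (S D H).indicator k + (S D H)ᶜ.indicator fun _ => (kp : ℂ) := by
      funext x
      by_cases hx : x ∈ S D H <;> simp [extendK, hx]
    rw [e]
    exact (((memLp_indicator_iff_restrict (isOpen_S hD H).measurableSet).2 hk).add
      ((memLp_top_const _).indicator (isOpen_S hD H).measurableSet.compl)).restrict D
  k_eq := .of_forall fun x hx => by rw [extendK, if_neg fun h => h.2 hx]

/-- Solutions of the variational problem extend to solutions of the boundary value problem,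
provided that the extension is locally in `H¹`. -/
theorem IsVariationalSolution.isBVPSolution (hD : IsOpen D) {fp H kp : ℝ} (hD₁ : U d fp ⊆ D)
    (hH : fp ≤ H) (hkp : 0 ≤ kp) {g k w : Space d → ℂ}
    (hgk : AdmissibleData D H kp (extendG D H g) (extendK D H kp k))
    (hw : IsVariationalSolution D H kp g k w)
    (hext : ∀ a, MemV D a (extendSol D H kp w)) :
    IsBVPSolution D fp H kp (extendG D H g) (extendK D H kp k) (extendSol D H kp w) := by
  have htr := trace_congr hD hw.1 (extendSol_ae_eq hD H kp w)
  have hrad : ∀ᵐ x ∂(volume.restrict (U d H)),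
      extendSol D H kp w x = planeWaves kp H (trace D H (extendSol D H kp w)) x := by
    filter_upwards [ae_restrict_mem (isOpen_U H).measurableSet] with x hx
    rw [htr, extendSol, if_pos hx]
  refine ⟨fun a _ => hext a, fun φ hφ => ?_, hrad⟩
  have hv := hφ.star
  have h1 := helmholtz_eq_form hD hD₁ hH hkp hgk.memLp_k hgk.k_eq (fun a _ => hext a) hrad hv
  rw [← b_congr hD (extendK_ae_eq hD H kp k).symm (extendSol_ae_eq hD H kp w) hw.1,
    hw.2 _ (hv.memV hD H), neg_neg, ← innerS_congr (extendG_ae_eq hD H g) (ae_eq_refl _),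
    ← integral_g_eq hD₁ hH hgk.memLp_g hgk.supp_g hv, hφ.lap_conj] at h1
  simpa using h1

end RoughLayer

end

/-! ### Towards direction (ii): the plane wave extension is locally in `H_0^1`. -/

noncomputable section

namespace RoughLayer

variable {d : ℕ}

/-! ### Plancherel's theorem for integrable square integrable functions -/

lemma integral_mul_fourierInv_integral {G : Horiz d → ℂ} (hG : Integrable G) {ψ : Horiz d → ℂ}
    (hψ : Integrable ψ) :
    ∫ y, (∫ η, ((Real.fourierChar (inner ℝ y η) : Circle) : ℂ) * G η) * conj (ψ y) =
      ∫ η, G η * conj (𝓕 ψ η) := by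
  have hi : Integrable (fun p : Horiz d × Horiz d =>
      ((Real.fourierChar (inner ℝ p.1 p.2) : Circle) : ℂ) * G p.2 * conj (ψ p.1))
      ((volume : Measure (Horiz d)).prod volume) := by
    refine (hψ.norm.mul_prod hG.norm).mono' ?_ (.of_forall fun p => ?_)
    · refine AEStronglyMeasurable.mul (AEStronglyMeasurable.mul ?_ hG.1.comp_snd) ?_
      · have h1 : Continuous fun p : Horiz d × Horiz d => (inner ℝ p.1 p.2 : ℝ) := by fun_prop
        exact (continuous_induced_dom.comp
          (Real.continuous_fourierChar.comp h1)).aestronglyMeasurable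
      · exact (Complex.continuous_conj.comp_aestronglyMeasurable hψ.1).comp_fst
    · rw [norm_mul, norm_mul, RCLike.norm_conj, Circle.norm_coe, one_mul, mul_comm]
  simp_rw [← integral_mul_const]
  rw [integral_integral_swap hi]
  refine integral_congr_ae (.of_forall fun η => ?_)
  dsimp only
  rw [Real.fourier_eq, ← integral_conj, ← integral_const_mul]
  refine integral_congr_ae (.of_forall fun y => ?_)
  simp only [Circle.smul_def, smul_eq_mul, map_mul]
  rw [AddChar.map_neg_eq_inv, Circle.coe_inv_eq_conj, Complex.conj_conj]
  ring

lemma continuous_fourierInv_integral {G : Horiz d → ℂ} (hG : Integrable G) :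
    Continuous fun y : Horiz d =>
      ∫ η, ((Real.fourierChar (inner ℝ y η) : Circle) : ℂ) * G η := by
  refine continuous_of_dominated (bound := fun η => ‖G η‖) (fun y => ?_)
    (fun y => .of_forall fun η => ?_) hG.norm (.of_forall fun η => ?_)
  · have h1 : Continuous fun η : Horiz d => (inner ℝ y η : ℝ) := by fun_prop
    exact (continuous_induced_dom.comp
      (Real.continuous_fourierChar.comp h1)).aestronglyMeasurable.mul hG.1
  · rw [norm_mul, Circle.norm_coe, one_mul]
  · have h1 : Continuous fun y : Horiz d => (inner ℝ y η : ℝ) := by fun_prop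
    exact (continuous_induced_dom.comp (Real.continuous_fourierChar.comp h1)).mul continuous_const

/-- The convergent integral and the abstract `L²` inverse transform have the same integrals against
smooth compactly supported functions, by Fubini for the former and by Parseval for the latter. -/
lemma fourierInv_integral_ae_eq {G : Horiz d → ℂ} (hG : Integrable G) (hG2 : MemLp G 2 volume) :
    (fun y : Horiz d => ∫ η, ((Real.fourierChar (inner ℝ y η) : Circle) : ℂ) * G η)
      =ᵐ[volume] (𝓕⁻ (hG2.toLp G) : Lp ℂ 2 (volume : Measure (Horiz d))) := by
  refine ae_eq_of_integral_contDiff_smul_eq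
    (continuous_fourierInv_integral hG).locallyIntegrable
    ((Lp.memLp _).locallyIntegrable (by norm_num)) fun ψ hψ hψc => ?_
  set ψc : Horiz d → ℂ := fun y => (ψ y : ℂ) with hψcdef
  have hs : ContDiff ℝ ∞ ψc := Complex.ofRealCLM.contDiff.comp hψ
  have hc : HasCompactSupport ψc := hψc.comp_left (g := fun r : ℝ => (r : ℂ)) (by simp)
  set Ψ : SchwartzMap (Horiz d) ℂ := hc.toSchwartzMap hs with hΨ
  have e1 : ∀ f : Horiz d → ℂ, ∫ y, ψ y • f y = ∫ y, f y * conj (ψc y) := fun f => by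
    refine integral_congr_ae (.of_forall fun y => ?_)
    simp only [hψcdef, Complex.real_smul, Complex.conj_ofReal]
    ring
  rw [e1, e1, integral_mul_fourierInv_integral hG
    (hs.continuous.integrable_of_hasCompactSupport hc)]
  have h1 := Lp.inner_fourier_eq (Ψ.toLp 2 volume)
    (𝓕⁻ (hG2.toLp G) : Lp ℂ 2 (volume : Measure (Horiz d)))
  rw [FourierTransform.fourier_fourierInv_eq, L2.inner_def, L2.inner_def,
    SchwartzMap.toLp_fourier_eq] at h1
  have e2 : ∫ η, G η * conj (𝓕 ψc η) = ∫ a, inner ℂ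
      ((𝓕 Ψ : SchwartzMap (Horiz d) ℂ).toLp 2 (volume : Measure (Horiz d)) a) (hG2.toLp G a) := by
    refine integral_congr_ae ?_
    filter_upwards [SchwartzMap.coeFn_toLp (𝓕 Ψ : SchwartzMap (Horiz d) ℂ) 2 volume,
      hG2.coeFn_toLp] with η h2 h3
    rw [h2, h3, RCLike.inner_apply]
    rfl
  rw [e2, h1]
  refine integral_congr_ae ?_
  filter_upwards [SchwartzMap.coeFn_toLp Ψ 2 volume] with y h2
  rw [h2, RCLike.inner_apply]
  rfl

lemma lintegral_fourierInv_integral {G : Horiz d → ℂ} (hG : Integrable G)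
    (hG2 : MemLp G 2 volume) :
    ∫⁻ y : Horiz d, ‖∫ η, ((Real.fourierChar (inner ℝ y η) : Circle) : ℂ) * G η‖ₑ ^ 2 =
      ∫⁻ η, ‖G η‖ₑ ^ 2 := by
  have h0 : ‖(𝓕⁻ (hG2.toLp G) : Lp ℂ 2 (volume : Measure (Horiz d)))‖ₑ = ‖hG2.toLp G‖ₑ := by
    rw [← ofReal_norm, ← ofReal_norm]
    congr 1
    exact (Lp.fourierTransformₗᵢ (Horiz d) ℂ).symm.norm_map _
  rw [Lp.enorm_def, Lp.enorm_def, eLpNorm_congr_ae hG2.coeFn_toLp,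
    ← eLpNorm_congr_ae (fourierInv_integral_ae_eq hG hG2)] at h0
  rw [← eLpNorm_two_sq, ← eLpNorm_two_sq, h0]

/-! ### Superpositions of plane waves in a strip -/

/-- The superposition of plane waves with density `m G`. -/
def superpose (kp H : ℝ) (m G : Horiz d → ℂ) (x : Space d) : ℂ :=
  ∫ η, m η * wave kp H x η * G η

lemma measurable_superpose (kp H : ℝ) {m G : Horiz d → ℂ} (hm : Measurable m)
    (hG : Measurable G) : Measurable (superpose kp H m G) := by
  have h1 : StronglyMeasurable (fun p : Space d × Horiz d => m p.2 * wave kp H p.1 p.2 * G p.2) := by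
    have := measurable_wave kp H (d := d)
    exact Measurable.stronglyMeasurable (by fun_prop)
  exact h1.integral_prod_right.measurable

/-- With `r = 1 + 2π|η|` one has `Re Z ≥ r - 1 - k₊`. In a strip of thickness `T` the loss `1 + k₊`
costs only a factor `exp(2T(k₊ + 1))`, and the remaining decay at rate at least `r > 0` integrates
to `1/r`. -/
lemma lintegral_damp_le {kp T : ℝ} (hkp : 0 ≤ kp) (H : ℝ) (η : Horiz d) :
    ∫⁻ t in Set.Ioo H (H + T), ENNReal.ofReal (damp kp (t - H) η ^ 2) ≤
      ENNReal.ofReal (Real.exp (2 * T * (kp + 1)) / (1 + 2 * Real.pi * ‖η‖)) := by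
  set r := 1 + 2 * Real.pi * ‖η‖ with hr
  have hr0 : 0 < r := weight_pos η
  have h1 : ∀ t ∈ Set.Ioo H (H + T), damp kp (t - H) η ^ 2 ≤
      Real.exp (2 * T * (kp + 1)) * Real.exp ((-r) * (t - H)) := by
    intro t ht
    rw [damp, ← Real.exp_nat_mul, ← Real.exp_add, Real.exp_le_exp]
    have h2 := symb_re_ge hkp η
    have h3 : 0 < t - H := sub_pos.2 ht.1
    have h4 : t - H < T := by linarith [ht.2]
    push_cast
    have h5 : (t - H) * (r - 1 - kp) ≤ (t - H) * (symb kp η).re := by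
      gcongr
      linarith
    nlinarith [mul_le_mul_of_nonneg_right h4.le (by linarith : 0 ≤ kp + 1),
      mul_pos h3 hr0]
  have hint : IntegrableOn (fun t => Real.exp (2 * T * (kp + 1)) * Real.exp ((-r) * (t - H)))
      (Set.Ioi H) := by
    have h2 := (integrableOn_exp_mul_Ioi (a := -r) (by linarith) H).const_mul
      (Real.exp (2 * T * (kp + 1)) * Real.exp (r * H))
    refine h2.congr (.of_forall fun t => ?_)
    dsimp only
    rw [mul_assoc, ← Real.exp_add]
    ring_nf
  calc _ ≤ ∫⁻ t in Set.Ioo H (H + T),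
        ENNReal.ofReal (Real.exp (2 * T * (kp + 1)) * Real.exp ((-r) * (t - H))) :=
        setLIntegral_mono (by fun_prop) fun t ht => ENNReal.ofReal_le_ofReal (h1 t ht)
    _ ≤ ∫⁻ t in Set.Ioi H,
        ENNReal.ofReal (Real.exp (2 * T * (kp + 1)) * Real.exp ((-r) * (t - H))) :=
        lintegral_mono_set Set.Ioo_subset_Ioi_self
    _ = ENNReal.ofReal (∫ t in Set.Ioi H,
        Real.exp (2 * T * (kp + 1)) * Real.exp ((-r) * (t - H))) :=
        (ofReal_integral_eq_lintegral_ofReal hint (.of_forall fun t => by positivity)).symm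
    _ = _ := by
      congr 1
      rw [integral_const_mul, div_eq_mul_inv]
      congr 1
      have e : ∀ t, Real.exp ((-r) * (t - H)) = Real.exp (r * H) * Real.exp ((-r) * t) := by
        intro t
        rw [← Real.exp_add]
        ring_nf
      simp_rw [e]
      rw [integral_const_mul, integral_exp_mul_Ioi (by linarith)]
      rw [neg_div_neg_eq, ← mul_div_assoc, ← Real.exp_add]
      ring_nf
      simp

/-- At a fixed height the superposition is an inverse Fourier integral of a damped density, which is
both integrable and square integrable, so Plancherel applies. -/
lemma lintegral_superpose_slice {kp H t : ℝ} (hkp : 0 ≤ kp) (ht : H < t) {m G : Horiz d → ℂ}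
    (hm : Measurable m) (hG : MemLp G 2 volume) {C : ℝ}
    (hmC : ∀ η, ‖m η‖ ≤ C * (1 + ‖η‖)) :
    ∫⁻ y : Horiz d, ‖superpose kp H m G (y, t)‖ₑ ^ 2 ≤
      ∫⁻ η, ENNReal.ofReal (damp kp (t - H) η ^ 2) *
        (ENNReal.ofReal ((C * (1 + ‖η‖)) ^ 2) * ‖G η‖ₑ ^ 2) := by
  set K : Horiz d → ℂ := fun η => m η * Complex.exp (-((t - H : ℝ) : ℂ) * symb kp η) * G η with hK
  have hn : ∀ η : Horiz d, ‖Complex.exp (-((t - H : ℝ) : ℂ) * symb kp η)‖ = damp kp (t - H) η := by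
    intro η
    rw [Complex.norm_exp, damp, ← Complex.ofReal_neg, Complex.re_ofReal_mul]
  have hKm : AEStronglyMeasurable K volume := by
    have := measurable_symb kp (d := d)
    refine AEStronglyMeasurable.mul (Measurable.aestronglyMeasurable ?_) hG.1
    fun_prop
  have hKb : ∀ η, ‖K η‖ ≤ damp kp (t - H) η * (C * (1 + ‖η‖)) * ‖G η‖ := by
    intro η
    rw [hK]
    dsimp only
    rw [norm_mul, norm_mul, hn, mul_comm ‖m η‖]
    have := damp_nonneg kp (t - H) η
    gcongr
    exact hmC η
  have hC : 0 ≤ C := by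
    have := (norm_nonneg _).trans (hmC 0)
    simpa using this
  have hK1 : Integrable K := by
    refine ((integrable_damp_mul hkp (sub_pos.2 ht) hG).const_mul C).mono' hKm
      (.of_forall fun η => (hKb η).trans (le_of_eq (by ring)))
  have hK2 : MemLp K 2 volume := by
    obtain ⟨B, hB0, hB⟩ := exists_damp_le (d := d) hkp (sub_pos.2 ht) 1
    refine hG.of_le_mul (c := C * B) hKm (.of_forall fun η => (hKb η).trans ?_)
    refine mul_le_mul_of_nonneg_right ?_ (norm_nonneg _)
    calc _ = C * ((1 + ‖η‖) ^ 1 * damp kp (t - H) η) := by ring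
      _ ≤ C * B := by gcongr; exact hB η
  have e : ∀ y, superpose kp H m G (y, t) =
      ∫ η, ((Real.fourierChar (inner ℝ y η) : Circle) : ℂ) * K η := by
    intro y
    refine integral_congr_ae (.of_forall fun η => ?_)
    dsimp only
    rw [wave_eq_mul]
    ring
  simp_rw [e]
  rw [lintegral_fourierInv_integral hK1 hK2]
  refine lintegral_mono fun η => ?_
  rw [enorm_sq_eq_ofReal, enorm_sq_eq_ofReal, ← ENNReal.ofReal_mul (by positivity),
    ← ENNReal.ofReal_mul (by positivity)]
  refine ENNReal.ofReal_le_ofReal ?_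
  calc ‖K η‖ ^ 2 ≤ (damp kp (t - H) η * (C * (1 + ‖η‖)) * ‖G η‖) ^ 2 := by
        gcongr
        exact hKb η
    _ = _ := by ring

/-- A superposition of plane waves is bounded in `L²` of a strip by the `H^{1/2}` norm of its
density. -/
lemma eLpNorm_superpose_le {kp : ℝ} (hkp : 0 ≤ kp) (H T : ℝ) {m G : Horiz d → ℂ}
    (hm : Measurable m) (hGm : Measurable G) (hG : MemLp G 2 volume) {C : ℝ}
    (hmC : ∀ η, ‖m η‖ ≤ C * (1 + ‖η‖)) :
    eLpNorm (superpose kp H m G) 2 (volume.restrict {x : Space d | x.2 ∈ Set.Ioo H (H + T)}) ≤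
      ENNReal.ofReal (C * Real.exp (T * (kp + 1))) * eLpNorm G 2 (halfMeasure d) := by
  have hC : 0 ≤ C := by
    have := (norm_nonneg _).trans (hmC 0)
    simpa using this
  have hms := measurable_superpose kp H hm hGm
  have hmd : Measurable fun p : ℝ × Horiz d => damp kp (p.1 - H) p.2 := by
    have := measurable_symb kp (d := d)
    unfold damp
    fun_prop
  rw [← ENNReal.pow_le_pow_left_iff (n := 2) (by norm_num), mul_pow, eLpNorm_two_sq,
    eLpNorm_two_sq, lintegral_slab _ (by fun_prop), lintegral_halfMeasure]
  calc _ ≤ ∫⁻ t in Set.Ioo H (H + T), ∫⁻ η, ENNReal.ofReal (damp kp (t - H) η ^ 2) *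
        (ENNReal.ofReal ((C * (1 + ‖η‖)) ^ 2) * ‖G η‖ₑ ^ 2) := by
        refine setLIntegral_mono' measurableSet_Ioo fun t ht => ?_
        exact lintegral_superpose_slice hkp ht.1 hm hG hmC
    _ = ∫⁻ η, (∫⁻ t in Set.Ioo H (H + T), ENNReal.ofReal (damp kp (t - H) η ^ 2)) *
        (ENNReal.ofReal ((C * (1 + ‖η‖)) ^ 2) * ‖G η‖ₑ ^ 2) := by
        rw [lintegral_lintegral_swap]
        · refine lintegral_congr fun η => ?_
          rw [lintegral_mul_const]
          have : Measurable fun t : ℝ => damp kp (t - H) η := hmd.comp measurable_prodMk_right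
          fun_prop
        · refine Measurable.aemeasurable ?_
          have h1 : Measurable fun p : ℝ × Horiz d => ENNReal.ofReal (damp kp (p.1 - H) p.2 ^ 2) *
              (ENNReal.ofReal ((C * (1 + ‖p.2‖)) ^ 2) * ‖G p.2‖ₑ ^ 2) := by fun_prop
          exact h1
    -- The vertical integral gains one power of `1 + 2π|η|` against the two lost to `m`, leaving
    -- exactly the weight of `H^{1/2}`.
    _ ≤ ∫⁻ η, ENNReal.ofReal (C * Real.exp (T * (kp + 1))) ^ 2 *
        (ENNReal.ofReal (1 + 2 * Real.pi * ‖η‖) * ‖G η‖ₑ ^ 2) := by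
        refine lintegral_mono fun η => ?_
        rw [← mul_assoc, ← mul_assoc]
        refine mul_le_mul_left ?_ _
        refine (mul_le_mul_left (lintegral_damp_le hkp H η) _).trans ?_
        rw [← ENNReal.ofReal_pow (by positivity), ← ENNReal.ofReal_mul (by positivity),
          ← ENNReal.ofReal_mul (by positivity)]
        refine ENNReal.ofReal_le_ofReal ?_
        have h1 : (1 + ‖η‖) ^ 2 ≤ (1 + 2 * Real.pi * ‖η‖) ^ 2 := by
          gcongr
          nlinarith [norm_nonneg η, Real.pi_gt_three]
        have h2 : Real.exp (2 * T * (kp + 1)) = Real.exp (T * (kp + 1)) ^ 2 := by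
          rw [← Real.exp_nat_mul]
          push_cast
          ring_nf
        rw [h2, div_mul_eq_mul_div, div_le_iff₀ (weight_pos η)]
        calc Real.exp (T * (kp + 1)) ^ 2 * (C * (1 + ‖η‖)) ^ 2 =
            (C * Real.exp (T * (kp + 1))) ^ 2 * (1 + ‖η‖) ^ 2 := by ring
          _ ≤ (C * Real.exp (T * (kp + 1))) ^ 2 * (1 + 2 * Real.pi * ‖η‖) ^ 2 := by gcongr
          _ = _ := by ring
    _ = _ := by
      rw [lintegral_const_mul]
      fun_prop

end RoughLayer

end

noncomputable section

namespace RoughLayer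

variable {d : ℕ} {D Ω : Set (Space d)} {q : Space d → ℂ}

/-! ### Regularization -/

lemma eLpNorm_le_of_bound {K : Set (Space d)} (hK : MeasurableSet K) {ε : ℝ} {f : Space d → ℂ}
    (hf : ∀ x, ‖f x‖ ≤ ε) (hf0 : ∀ x, x ∉ K → f x = 0) (Ω : Set (Space d)) :
    eLpNorm f 2 (volume.restrict Ω) ≤ ENNReal.ofReal ε * volume K ^ (1 / 2 : ℝ) := by
  have hε : 0 ≤ ε := (norm_nonneg _).trans (hf 0)
  calc eLpNorm f 2 (volume.restrict Ω) ≤ eLpNorm f 2 volume :=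
        eLpNorm_mono_measure _ Measure.restrict_le_self
    _ ≤ eLpNorm (K.indicator fun _ => ε) 2 volume := by
        refine eLpNorm_mono fun x => ?_
        by_cases hx : x ∈ K
        · rw [Set.indicator_of_mem hx, Real.norm_of_nonneg hε]
          exact hf x
        · simp [hf0 x hx]
    _ = _ := by
        rw [eLpNorm_indicator_const hK (by norm_num) (by norm_num), Real.enorm_of_nonneg hε]
        norm_num

lemma eventually_uniform {f : Space d → ℂ} (hf : Continuous f) (hc : HasCompactSupport f) {ε : ℝ}
    (hε : 0 < ε) : ∀ᶠ δ in 𝓝[>] (0 : ℝ), ∀ x y, dist x y < δ → dist (f x) (f y) ≤ ε := by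
  obtain ⟨δ, hδ, h⟩ := Metric.uniformContinuous_iff.1
    (hc.uniformContinuous_of_continuous hf) ε hε
  filter_upwards [Ioo_mem_nhdsGT hδ] with r hr x y hxy
  exact (h (hxy.trans hr.2)).le

/-- Compactly supported `C¹` functions are limits of test functions. -/
lemma approxH1_of_contDiff_one (hΩ : IsOpen Ω) (hq : ContDiff ℝ 1 q) (hc : HasCompactSupport q)
    (hs : tsupport q ⊆ Ω) : ApproxH1 Ω Ω q (fun i => pd i q) := by
  have hq' : ∀ i, Continuous (pd i q) := fun i =>
    (hq.continuous_fderiv (by simp)).clm_apply continuous_const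
  have hc' : ∀ i, HasCompactSupport (pd i q) := fun i => hc.fderiv_apply ℝ _
  have hs' : ∀ i, tsupport (pd i q) ⊆ tsupport q := fun i => tsupport_fderiv_apply_subset ℝ _
  refine ⟨hq.continuous.memLp_of_hasCompactSupport hc,
    fun i => (hq' i).memLp_of_hasCompactSupport (hc' i), fun ε hε => ?_⟩
  obtain ⟨δ₀, hδ₀, hK⟩ := hc.isCompact.exists_cthickening_subset_open hΩ hs
  set K := Metric.cthickening δ₀ (tsupport q) with hKdef
  have hKc : IsCompact K := hc.isCompact.cthickening
  have hKV : volume K ^ (1 / 2 : ℝ) ≠ ⊤ :=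
    ENNReal.rpow_ne_top_of_nonneg (by norm_num) hKc.measure_lt_top.ne
  obtain ⟨ε', hε'0, hε'⟩ : ∃ ε' : ℝ, 0 < ε' ∧ ENNReal.ofReal ε' * volume K ^ (1 / 2 : ℝ) ≤ ε := by
    obtain ⟨r, hr0, hr⟩ := ENNReal.exists_nnreal_pos_mul_lt hKV hε.ne'
    exact ⟨r, hr0, by simpa using hr.le⟩
  obtain ⟨δ, h1, h2, h3⟩ := ((eventually_uniform hq.continuous hc hε'0).and
    ((eventually_all.2 fun i => eventually_uniform (hq' i) (hc' i) hε'0).and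
      (Ioo_mem_nhdsGT hδ₀))).exists
  -- The mollifier has radius `δ`, below the moduli of continuity of `q` and its derivatives, so
  -- convolution moves them by at most `ε'`, and below `δ₀`, so supports stay in `K ⊆ Ω`.
  set φ : ContDiffBump (0 : Space d) := ⟨δ / 2, δ, half_pos h3.1, half_lt_self h3.1⟩ with hφ
  set m : (Space d → ℂ) → Space d → ℂ := fun f =>
    convolution (φ.normed volume) f (ContinuousLinearMap.lsmul ℝ ℝ) volume with hm
  have hclose : ∀ f : Space d → ℂ, Continuous f →
      (∀ x y, dist x y < δ → dist (f x) (f y) ≤ ε') → ∀ x, ‖m f x - f x‖ ≤ ε' := by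
    intro f hf hfu x
    rw [← dist_eq_norm]
    exact ContDiffBump.dist_normed_convolution_le hf.aestronglyMeasurable
      fun y hy => hfu y x hy
  have hzero : ∀ f : Space d → ℂ, tsupport f ⊆ tsupport q → ∀ x, x ∉ K → m f x = 0 ∧ f x = 0 := by
    intro f hf x hx
    have hb : ∀ y ∈ Metric.ball x δ, f y = 0 := by
      intro y hy
      refine image_eq_zero_of_notMem_tsupport fun hy' => hx ?_
      refine Metric.mem_cthickening_of_dist_le x y δ₀ _ (hf hy') ?_
      rw [dist_comm]
      exact (Metric.mem_ball.1 hy).le.trans h3.2.le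
    have hx0 := hb x (Metric.mem_ball_self h3.1)
    refine ⟨?_, hx0⟩
    rw [← hx0]
    exact ContDiffBump.normed_convolution_eq_right fun y hy => by rw [hb y hy, hx0]
  have hloc : LocallyIntegrable (φ.normed (volume : Measure (Space d))) volume :=
    φ.continuous_normed.locallyIntegrable
  have hpd : ∀ i, pd i (m q) = m (pd i q) := by
    intro i
    funext x
    have h := (hc.hasFDerivAt_convolution_right (ContinuousLinearMap.lsmul ℝ ℝ)
      hloc hq x).fderiv
    rw [pd]
    change fderiv ℝ (convolution (φ.normed volume) q (ContinuousLinearMap.lsmul ℝ ℝ) volume) x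
      (dir i) = _
    rw [h]
    exact convolution_precompR_apply _ hloc
      (hc.fderiv ℝ) (hq.continuous_fderiv (by simp)) x (dir i)
  refine ⟨m q, ⟨?_, ?_, ?_⟩, ?_, fun i => ?_⟩
  · exact φ.hasCompactSupport_normed.contDiff_convolution_left _ φ.contDiff_normed
      (hq.continuous.locallyIntegrable)
  · exact HasCompactSupport.intro hKc fun x hx => (hzero q subset_rfl x hx).1
  · refine (closure_minimal ?_ hKc.isClosed).trans hK
    intro x hx
    by_contra h
    exact hx (hzero q subset_rfl x h).1
  · refine (eLpNorm_le_of_bound hKc.measurableSet (hclose q hq.continuous h1)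
      (fun x hx => ?_) Ω).trans hε'
    rw [(hzero q subset_rfl x hx).1, (hzero q subset_rfl x hx).2, sub_zero]
  · rw [hpd]
    refine (eLpNorm_le_of_bound hKc.measurableSet (hclose _ (hq' i) (h2 i))
      (fun x hx => ?_) Ω).trans hε'
    rw [(hzero _ (hs' i) x hx).1, (hzero _ (hs' i) x hx).2, sub_zero]

/-! ### Cutting off -/

lemma tendsto_eLpNorm_zero {α : Type*} [MeasurableSpace α] {μ : Measure α} {f : ℕ → α → ℂ}
    {G : α → ℝ} (hf : ∀ j, AEStronglyMeasurable (f j) μ) (hG : MemLp G 2 μ)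
    (hb : ∀ j, ∀ᵐ x ∂μ, ‖f j x‖ ≤ G x) (hl : ∀ᵐ x ∂μ, ∀ᶠ j in atTop, f j x = 0) :
    Tendsto (fun j => eLpNorm (f j) 2 μ) atTop (𝓝 0) := by
  have hGfin : ∫⁻ x, ENNReal.ofReal (G x) ^ 2 ∂μ ≠ ⊤ := by
    have h1 : eLpNorm (fun x => (G x : ℂ)) 2 μ ^ 2 ≠ ⊤ :=
      ENNReal.pow_ne_top hG.ofReal.2.ne
    rw [eLpNorm_two_sq] at h1
    refine ne_top_of_le_ne_top h1 (lintegral_mono fun x => ?_)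
    rw [← ofReal_norm, Complex.norm_real]
    gcongr
    exact Real.le_norm_self _
  have h2 : Tendsto (fun j => ∫⁻ x, ‖f j x‖ₑ ^ 2 ∂μ) atTop (𝓝 (∫⁻ _, 0 ∂μ)) := by
    refine tendsto_lintegral_of_dominated_convergence' (fun x => ENNReal.ofReal (G x) ^ 2)
      (fun j => (hf j).enorm.pow_const 2) (fun j => ?_) hGfin ?_
    · filter_upwards [hb j] with x hx
      rw [← ofReal_norm]
      gcongr
    · filter_upwards [hl] with x hx
      refine tendsto_const_nhds.congr' ?_
      filter_upwards [hx] with j hj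
      simp [hj]
  have h3 := h2.ennrpow_const (1 / 2 : ℝ)
  rw [lintegral_zero, ENNReal.zero_rpow_of_pos (by norm_num)] at h3
  refine h3.congr fun j => ?_
  rw [← eLpNorm_two_sq, ← ENNReal.rpow_natCast, ← ENNReal.rpow_mul]
  norm_num

lemma pd_congr {f g : Space d → ℂ} {x : Space d} (h : f =ᶠ[𝓝 x] g) (i : Fin d ⊕ Unit) :
    pd i f x = pd i g x := by
  rw [pd, pd, h.fderiv_eq]

/-- Dominated convergence for `c_j q` and its derivatives. Near each point `c_j` is eventually `1`,
and `G` dominates the commutator terms `(∂_i c_j) q`. It serves both the vertical and the horizontal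
cutoff. -/
lemma approxH1_of_cutoff (hΩ : IsOpen Ω) (hq : MemLp q 2 (volume.restrict Ω))
    (hq' : ∀ i, MemLp (pd i q) 2 (volume.restrict Ω)) (hqd : ∀ x ∈ Ω, DifferentiableAt ℝ q x)
    {c : ℕ → Space d → ℂ} (hc : ∀ j, Differentiable ℝ (c j)) (hcb : ∀ j x, ‖c j x‖ ≤ 1)
    (hlim : ∀ x ∈ Ω, ∀ᶠ j in atTop, c j =ᶠ[𝓝 x] fun _ => 1) {G : Space d → ℝ}
    (hG : MemLp G 2 (volume.restrict Ω))
    (hb : ∀ i j, ∀ x ∈ Ω, ‖pd i (c j) x * q x‖ ≤ G x)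
    (happ : ∀ j, ApproxH1 Ω Ω (fun x => c j x * q x) (fun i => pd i (fun x => c j x * q x))) :
    ApproxH1 Ω Ω q (fun i => pd i q) := by
  have l1 : Tendsto (fun j => eLpNorm (fun x => c j x * q x - q x) 2 (volume.restrict Ω)) atTop
      (𝓝 0) := by
    refine tendsto_eLpNorm_zero (G := fun x => 2 * ‖q x‖)
      (fun j => (happ j).memLp.1.sub hq.1) (hq.norm.const_mul 2) (fun j => .of_forall fun x => ?_) ?_
    · refine (norm_sub_le _ _).trans ?_
      rw [norm_mul]
      nlinarith [hcb j x, norm_nonneg (q x)]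
    · filter_upwards [ae_restrict_mem hΩ.measurableSet] with x hx
      filter_upwards [hlim x hx] with j hj
      rw [hj.eq_of_nhds, one_mul, sub_self]
  have l2 : ∀ i, Tendsto (fun j => eLpNorm (fun x => pd i (fun x => c j x * q x) x - pd i q x) 2
      (volume.restrict Ω)) atTop (𝓝 0) := by
    intro i
    refine tendsto_eLpNorm_zero (G := fun x => 2 * ‖pd i q x‖ + G x)
      (fun j => ((happ j).memLp' i).1.sub (hq' i).1) (((hq' i).norm.const_mul 2).add hG)
      (fun j => ?_) ?_
    · filter_upwards [ae_restrict_mem hΩ.measurableSet] with x hx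
      rw [pd_mul i (hc j x) (hqd x hx)]
      have h1 : ‖c j x * pd i q x‖ ≤ ‖pd i q x‖ := by
        rw [norm_mul]
        exact mul_le_of_le_one_left (norm_nonneg _) (hcb j x)
      calc _ ≤ ‖c j x * pd i q x‖ + ‖pd i (c j) x * q x‖ + ‖pd i q x‖ :=
            (norm_sub_le _ _).trans (by gcongr; exact norm_add_le _ _)
        _ ≤ _ := by linarith [hb i j x hx]
    · filter_upwards [ae_restrict_mem hΩ.measurableSet] with x hx
      filter_upwards [hlim x hx] with j hj
      rw [pd_congr (g := q), sub_self]
      filter_upwards [hj] with y hy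
      rw [hy, one_mul]
  refine .of_approx hq hq' fun ε hε => ?_
  obtain ⟨j, h1, h2⟩ := ((l1.eventually (Iic_mem_nhds hε)).and
    (eventually_all.2 fun i => (l2 i).eventually (Iic_mem_nhds hε))).exists
  exact ⟨_, _, happ j, h1, h2⟩

lemma pd_vertical {f : ℝ → ℂ} {f' : ℂ} {x : Space d} (h : HasDerivAt f f' x.2) :
    (∀ i, pd (Sum.inl i) (fun x : Space d => f x.2) x = 0) ∧
      pd (Sum.inr ()) (fun x : Space d => f x.2) x = f' := by
  have h1 : HasFDerivAt (fun x : Space d => f x.2) _ x :=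
    h.hasFDerivAt.comp x (hasFDerivAt_snd (𝕜 := ℝ) (p := x))
  simp [pd, h1.fderiv, dir]

lemma smoothTransition_deriv_bound :
    ∃ M : ℝ, 0 ≤ M ∧ ∀ s, |deriv Real.smoothTransition s| ≤ M := by
  have hcont : Continuous (deriv Real.smoothTransition) :=
    Real.smoothTransition.contDiff.continuous_deriv (n := 1) (by simp)
  have hcs : HasCompactSupport (deriv Real.smoothTransition) := by
    refine HasCompactSupport.intro (isCompact_Icc (a := (0 : ℝ)) (b := 1)) fun s hs => ?_
    rcases lt_or_ge s 0 with h | h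
    · have : Real.smoothTransition =ᶠ[𝓝 s] fun _ => 0 := by
        filter_upwards [Iio_mem_nhds h] with r hr
        exact Real.smoothTransition.zero_of_nonpos (le_of_lt hr)
      rw [this.deriv_eq, deriv_const]
    · have h1 : 1 < s := by
        by_contra h'
        exact hs ⟨h, not_lt.1 h'⟩
      have : Real.smoothTransition =ᶠ[𝓝 s] fun _ => 1 := by
        filter_upwards [Ioi_mem_nhds h1] with r hr
        exact Real.smoothTransition.one_of_one_le (le_of_lt hr)
      rw [this.deriv_eq, deriv_const]
  obtain ⟨M, hM⟩ := hcont.bounded_above_of_compact_support hcs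
  exact ⟨M, (norm_nonneg _).trans (hM 0), hM⟩

lemma smoothTransition_deriv_eq_zero {s : ℝ} (hs : 1 < s) : deriv Real.smoothTransition s = 0 := by
  have : Real.smoothTransition =ᶠ[𝓝 s] fun _ => 1 := by
    filter_upwards [Ioi_mem_nhds hs] with r hr
    exact Real.smoothTransition.one_of_one_le (le_of_lt hr)
  rw [this.deriv_eq, deriv_const]

/-- `C¹` functions of bounded support in the half-space that vanish on its boundary are limits of
test functions. -/
lemma approxH1_of_bounded_support {H : ℝ} (hq : ContDiffOn ℝ 1 q (U d H))
    (hqL : MemLp q 2 (volume.restrict (U d H)))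
    (hqL' : ∀ i, MemLp (pd i q) 2 (volume.restrict (U d H)))
    {R C : ℝ} (hR : ∀ x ∈ U d H, R < ‖x‖ → q x = 0)
    (hC : ∀ x ∈ U d H, x.2 < H + 1 → ‖q x‖ ≤ C * (x.2 - H)) :
    ApproxH1 (U d H) (U d H) q (fun i => pd i q) := by
  obtain ⟨M, hM0, hM⟩ := smoothTransition_deriv_bound
  have hC0 : 0 ≤ C := by
    have h1 := hC (0, H + 1 / 2) (show H < H + 1 / 2 by linarith) (by norm_num)
    have h2 := (norm_nonneg _).trans h1
    simp at h2
    exact h2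
  -- The cutoff rises from `0` to `1` for `t - H` between `1/(j+3)` and `2/(j+3)`; the `3` keeps
  -- this layer below `H + 1`, where the linear bound on `q` is available.
  set s : ℕ → ℝ → ℝ := fun j t => (j + 3 : ℝ) * (t - H) - 1 with hs
  set c : ℕ → Space d → ℂ := fun j x => (Real.smoothTransition (s j x.2) : ℂ) with hc
  have hj : ∀ j : ℕ, (0 : ℝ) < j + 3 := fun j => by positivity
  have hcsm : ∀ j, ContDiff ℝ ∞ (c j) := by
    intro j
    refine Complex.ofRealCLM.contDiff.comp (Real.smoothTransition.contDiff.comp ?_)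
    exact ((contDiff_const.mul (contDiff_snd.sub contDiff_const)).sub contDiff_const)
  have hder : ∀ j (t : ℝ), HasDerivAt (fun t => (Real.smoothTransition (s j t) : ℂ))
      ((deriv Real.smoothTransition (s j t) * (j + 3) : ℝ) : ℂ) t := by
    intro j t
    have h1 : HasDerivAt (fun t : ℝ => (j + 3 : ℝ) * (t - H) - 1) (j + 3 : ℝ) t := by
      simpa using (((hasDerivAt_id t).sub_const H).const_mul (j + 3 : ℝ)).sub_const 1
    have h2 : HasDerivAt Real.smoothTransition (deriv Real.smoothTransition (s j t)) (s j t) :=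
      ((Real.smoothTransition.contDiff (n := 1)).differentiable (by simp) _).hasDerivAt
    exact (h2.comp t h1).ofReal_comp
  -- Where the cutoff varies, its derivative is at most `M(j+3)` while `|q| ≤ 2C/(j+3)`; the factors
  -- `j + 3` cancel and leave the majorant `2CM` on a ball.
  refine approxH1_of_cutoff (isOpen_U H) hqL hqL'
    (fun x hx => (hq.contDiffAt ((isOpen_U H).mem_nhds hx)).differentiableAt (by simp))
    (c := c) (fun j => (hcsm j).differentiable (by simp)) (fun j x => ?_) (fun x hx => ?_)
    (G := (Metric.closedBall 0 R).indicator fun _ => 2 * C * M) ?_ (fun i j x hx => ?_) fun j => ?_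
  · rw [hc]
    dsimp only
    rw [Complex.norm_real, Real.norm_of_nonneg (Real.smoothTransition.nonneg _)]
    exact Real.smoothTransition.le_one _
  · have hx0 : 0 < x.2 - H := sub_pos.2 hx
    obtain ⟨N, hN⟩ := exists_nat_gt (2 / (x.2 - H))
    filter_upwards [eventually_ge_atTop N] with j hjN
    have h1 : 1 < s j x.2 := by
      rw [div_lt_iff₀ hx0] at hN
      have : (N : ℝ) ≤ j := by exact_mod_cast hjN
      simp only [hs]
      nlinarith
    have hcont : Continuous fun x : Space d => s j x.2 := by
      simp only [hs]
      fun_prop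
    filter_upwards [(isOpen_lt continuous_const hcont).mem_nhds h1] with y hy
    simp only [hc]
    rw [Real.smoothTransition.one_of_one_le (le_of_lt hy), Complex.ofReal_one]
  · refine MemLp.restrict _ ?_
    rw [memLp_indicator_iff_restrict Metric.isClosed_closedBall.measurableSet]
    have : IsFiniteMeasure ((volume : Measure (Space d)).restrict (Metric.closedBall 0 R)) :=
      ⟨by simpa using measure_closedBall_lt_top⟩
    exact memLp_const _
  · by_cases hxR : x ∈ Metric.closedBall 0 R
    · rw [Set.indicator_of_mem hxR]
      have h0 : 0 ≤ 2 * C * M := by positivity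
      obtain ⟨p1, p2⟩ := pd_vertical (hder j x.2)
      rcases i with i | ⟨⟩
      · change ‖pd (Sum.inl i) (fun x : Space d => ((Real.smoothTransition (s j x.2) : ℝ) : ℂ)) x
          * q x‖ ≤ _
        rw [p1 i, zero_mul, norm_zero]
        exact h0
      · change ‖pd (Sum.inr ()) (fun x : Space d => ((Real.smoothTransition (s j x.2) : ℝ) : ℂ)) x
          * q x‖ ≤ _
        rw [p2, norm_mul, Complex.norm_real, Real.norm_eq_abs, abs_mul, abs_of_pos (hj j)]
        rcases lt_or_ge 1 (s j x.2) with h1 | h1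
        · rw [smoothTransition_deriv_eq_zero h1]
          simpa using h0
        · have hx0 : 0 < x.2 - H := sub_pos.2 hx
          have h2 : (j + 3 : ℝ) * (x.2 - H) ≤ 2 := by
            simp only [hs] at h1
            linarith
          have h3 : x.2 < H + 1 := by
            have : (0 : ℝ) ≤ j := by positivity
            nlinarith
          calc _ ≤ M * (j + 3) * (C * (x.2 - H)) := by
                gcongr
                · exact hM _
                · exact hC x hx h3
            _ = M * C * ((j + 3) * (x.2 - H)) := by ring
            _ ≤ M * C * 2 := by gcongr
            _ = _ := by ring
    · rw [Set.indicator_of_notMem hxR, hR x hx (by simpa using hxR), mul_zero, norm_zero]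
  -- The product vanishes on an open set containing the complement of `U_H`, so it is `C¹` on the
  -- whole space whatever `q` is outside `U_H`.
  · have hopen : IsOpen {x : Space d | x.2 < H + 1 / (j + 3)} :=
      isOpen_lt continuous_snd continuous_const
    have hzero : ∀ x ∈ {x : Space d | x.2 < H + 1 / (j + 3)}, c j x * q x = 0 := by
      intro x hx
      have h1 : s j x.2 ≤ 0 := by
        have h2 : x.2 - H < 1 / (j + 3) := by
          have : x.2 < H + 1 / (j + 3) := hx
          linarith
        rw [lt_div_iff₀ (hj j)] at h2
        simp only [hs]
        linarith
      simp only [hc]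
      rw [Real.smoothTransition.zero_of_nonpos h1, Complex.ofReal_zero, zero_mul]
    have hlow : ∀ x : Space d, x ∉ U d H → x ∈ {x : Space d | x.2 < H + 1 / (j + 3)} := by
      intro x hx
      have h1 : x.2 ≤ H := not_lt.1 hx
      have h2 : (0 : ℝ) < 1 / (j + 3) := by positivity
      exact lt_of_le_of_lt h1 (by linarith)
    refine approxH1_of_contDiff_one (isOpen_U H) ?_ ?_ ?_
    · refine contDiff_iff_contDiffAt.2 fun x => ?_
      by_cases hx : x ∈ U d H
      · exact ((hcsm j).of_le (by simp)).contDiffAt.mul (hq.contDiffAt ((isOpen_U H).mem_nhds hx))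
      · refine (contDiffAt_const (c := (0 : ℂ))).congr_of_eventuallyEq ?_
        filter_upwards [hopen.mem_nhds (hlow x hx)] with y hy
        exact hzero y hy
    · refine HasCompactSupport.intro (isCompact_closedBall (0 : Space d) R) fun x hx => ?_
      by_cases hxU : x ∈ U d H
      · rw [hR x hxU (by simpa using hx), mul_zero]
      · exact hzero x (hlow x hxU)
    · have h1 : tsupport (fun x => c j x * q x) ⊆ {x : Space d | x.2 < H + 1 / (j + 3)}ᶜ :=
        closure_minimal (fun x hx h => hx (hzero x h)) hopen.isClosed_compl
      intro x hx
      by_contra h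
      exact h1 hx (hlow x h)

/-- `C¹` functions in the half-space, with square integrable derivatives, that vanish on its
boundary and at large height are limits of test functions. -/
lemma approxH1_halfspace {H : ℝ} (hq : ContDiffOn ℝ 1 q (U d H))
    (hqL : MemLp q 2 (volume.restrict (U d H)))
    (hqL' : ∀ i, MemLp (pd i q) 2 (volume.restrict (U d H)))
    {T C : ℝ} (hT : ∀ x ∈ U d H, T < x.2 → q x = 0)
    (hC : ∀ x ∈ U d H, x.2 < H + 1 → ‖q x‖ ≤ C * (x.2 - H)) :
    ApproxH1 (U d H) (U d H) q (fun i => pd i q) := by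
  set β : ContDiffBump (0 : Horiz d) := ⟨1, 2, one_pos, one_lt_two⟩ with hβ
  have hβs : ContDiff ℝ ∞ (fun y : Horiz d => β y) := β.contDiff
  obtain ⟨M, hM⟩ := (hβs.continuous_fderiv (by simp)).bounded_above_of_compact_support
    (β.hasCompactSupport.fderiv ℝ)
  have hM0 : 0 ≤ M := (norm_nonneg _).trans (hM 0)
  set r : ℕ → ℝ := fun j => ((j : ℝ) + 1)⁻¹ with hr
  have hr0 : ∀ j, 0 < r j := fun j => by simp only [hr]; positivity
  have hr1 : ∀ j, r j ≤ 1 := fun j => by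
    simp only [hr]
    exact inv_le_one_of_one_le₀ (by linarith [(Nat.cast_nonneg j : (0 : ℝ) ≤ j)])
  set c : ℕ → Space d → ℂ := fun j x => ((β (r j • x.1) : ℝ) : ℂ) with hc
  have hcsm : ∀ j, ContDiff ℝ ∞ (c j) := fun j =>
    Complex.ofRealCLM.contDiff.comp (hβs.comp (contDiff_fst.const_smul (r j)))
  have hcb : ∀ j x, ‖c j x‖ ≤ 1 := fun j x => by
    simp only [hc]
    rw [Complex.norm_real, Real.norm_of_nonneg β.nonneg]
    exact β.le_one
  have hcd : ∀ i j x, ‖pd i (c j) x‖ ≤ M := by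
    intro i j x
    have h1 : HasFDerivAt (fun x : Space d => r j • x.1)
        (r j • ContinuousLinearMap.fst ℝ (Horiz d) ℝ) x := hasFDerivAt_fst.const_smul (r j)
    have h2 := ((hβs.differentiable (by simp)) (r j • x.1)).hasFDerivAt
    have h3 := Complex.ofRealCLM.hasFDerivAt.comp x (h2.comp x h1)
    have h4 : pd i (c j) x = ((fderiv ℝ (fun y : Horiz d => β y) (r j • x.1)
        (r j • (dir i).1) : ℝ) : ℂ) := by
      rw [pd]
      change fderiv ℝ (Complex.ofRealCLM ∘ ((fun y : Horiz d => β y) ∘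
        fun x : Space d => r j • x.1)) x (dir i) = _
      rw [h3.fderiv]
      rfl
    have h5 : ‖(dir i : Space d).1‖ ≤ 1 := by
      rcases i with i | i <;> simp [dir]
    rw [h4, Complex.norm_real]
    refine (ContinuousLinearMap.le_opNorm _ _).trans ?_
    rw [norm_smul, Real.norm_of_nonneg (hr0 j).le]
    calc _ ≤ M * (1 * 1) := by
          gcongr
          · exact hM _
          · exact hr1 j
      _ = M := by ring
  have hqd : ∀ x ∈ U d H, DifferentiableAt ℝ q x := fun x hx =>
    (hq.contDiffAt ((isOpen_U H).mem_nhds hx)).differentiableAt (by simp)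
  have hcd' : ∀ j, Differentiable ℝ (c j) := fun j => (hcsm j).differentiable (by simp)
  refine approxH1_of_cutoff (isOpen_U H) hqL hqL' hqd (c := c) hcd' hcb (fun x hx => ?_)
    (G := fun x => M * ‖q x‖) (hqL.norm.const_mul M) (fun i j x hx => ?_) fun j => ?_
  · obtain ⟨N, hN⟩ := exists_nat_gt ‖x.1‖
    filter_upwards [eventually_ge_atTop N] with j hjN
    have h1 : ‖r j • x.1‖ < 1 := by
      rw [norm_smul, Real.norm_of_nonneg (hr0 j).le]
      simp only [hr]
      rw [inv_mul_lt_iff₀ (by positivity)]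
      have : (N : ℝ) ≤ j := by exact_mod_cast hjN
      linarith
    have hcont : Continuous fun x : Space d => ‖r j • x.1‖ := by fun_prop
    filter_upwards [(isOpen_lt hcont continuous_const).mem_nhds h1] with y hy
    simp only [hc]
    rw [β.one_of_mem_closedBall, Complex.ofReal_one]
    simpa using le_of_lt hy
  · rw [norm_mul]
    gcongr
    exact hcd i j x
  · have hL : MemLp (fun x => c j x * q x) 2 (volume.restrict (U d H)) := by
      refine hqL.of_le_mul (c := 1) ((hcsm j).continuous.aestronglyMeasurable.mul hqL.1)
        (.of_forall fun x => ?_)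
      rw [norm_mul]
      gcongr
      exact hcb j x
    -- In the supremum norm, a point of `U_H` outside the ball of radius `R` either has horizontal
    -- part beyond the bump's support, `|x̃| > 2/r_j`, or has height above `T`.
    refine approxH1_of_bounded_support ((((hcsm j).of_le (by simp)).contDiffOn).mul hq) hL
      (fun i => ?_) (R := max (2 / r j) (max |H| |T|)) (C := C) (fun x hx hxR => ?_)
      fun x hx hx1 => ?_
    · have h1 : MemLp (fun x => c j x * pd i q x) 2 (volume.restrict (U d H)) := by
        refine (hqL' i).of_le_mul (c := 1)
          ((hcsm j).continuous.aestronglyMeasurable.mul (hqL' i).1) (.of_forall fun x => ?_)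
        rw [norm_mul]
        gcongr
        exact hcb j x
      have h2 : MemLp (fun x => pd i (c j) x * q x) 2 (volume.restrict (U d H)) := by
        have hpc : Continuous (pd i (c j)) :=
          ((hcsm j).continuous_fderiv (by simp)).clm_apply continuous_const
        refine hqL.of_le_mul (c := M) (hpc.aestronglyMeasurable.mul hqL.1) (.of_forall fun x => ?_)
        rw [norm_mul]
        gcongr
        exact hcd i j x
      refine (h1.add h2).ae_eq ?_
      filter_upwards [ae_restrict_mem (isOpen_U H).measurableSet] with x hx
      rw [pd_mul i (hcd' j x) (hqd x hx)]
      rfl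
    · rw [Prod.norm_def] at hxR
      rcases lt_max_iff.1 hxR with h1 | h1
      · have h4 : β (r j • x.1) = 0 := by
          refine β.zero_of_le_dist ?_
          rw [dist_zero_right, norm_smul, Real.norm_of_nonneg (hr0 j).le]
          have h5 := (le_max_left _ _).trans_lt h1
          rw [div_lt_iff₀ (hr0 j)] at h5
          change (2 : ℝ) ≤ _
          linarith
        simp only [hc]
        rw [h4, Complex.ofReal_zero, zero_mul]
      · rcases lt_or_ge T x.2 with h4 | h4
        · rw [hT x hx h4, mul_zero]
        · have h5 := (max_lt_iff.1 ((le_max_right _ _).trans_lt h1))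
          have h6 : H < x.2 := hx
          rw [Real.norm_eq_abs] at h5
          rcases abs_cases x.2 with h7 | h7
          · linarith [h5.2, le_abs_self T]
          · linarith [h5.1, neg_abs_le H]
    · rw [norm_mul]
      calc _ ≤ 1 * ‖q x‖ := by gcongr; exact hcb j x
        _ ≤ _ := by rw [one_mul]; exact hC x hx hx1

end RoughLayer

end

noncomputable section

namespace RoughLayer

variable {d : ℕ} {D Ω : Set (Space d)} {φ : Space d → ℂ}

/-! ### Regularity of superpositions of plane waves -/

/-- The linear part of the phase of a plane wave. -/
def phase (kp : ℝ) (η : Horiz d) : Space d →L[ℝ] ℂ :=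
  (-symb kp η) • (Complex.ofRealCLM.comp (ContinuousLinearMap.snd ℝ (Horiz d) ℝ)) +
    (2 * Real.pi * Complex.I : ℂ) •
      (Complex.ofRealCLM.comp ((innerSL ℝ η).comp (ContinuousLinearMap.fst ℝ (Horiz d) ℝ)))

lemma phase_apply (kp : ℝ) (η : Horiz d) (x : Space d) :
    phase kp η x = -symb kp η * (x.2 : ℂ) + 2 * Real.pi * Complex.I * ((inner ℝ η x.1 : ℝ) : ℂ) := by
  simp [phase]

/-- The symbols of the partial derivatives of plane waves. -/
def dirSymb (kp : ℝ) (i : Fin d ⊕ Unit) (η : Horiz d) : ℂ := phase kp η (dir i)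

lemma norm_phase_le {kp : ℝ} (hkp : 0 ≤ kp) (η : Horiz d) :
    ‖phase kp η‖ ≤ (kp + 4 * Real.pi) * (1 + ‖η‖) := by
  refine ContinuousLinearMap.opNorm_le_bound _ (by positivity) fun x => ?_
  rw [phase_apply]
  refine (norm_add_le _ _).trans ?_
  have hx1 : ‖x.1‖ ≤ ‖x‖ := norm_fst_le x
  have hx2 : |x.2| ≤ ‖x‖ := norm_snd_le x
  simp only [norm_mul, norm_neg, Complex.norm_real, Complex.norm_I, Complex.norm_ofNat,
    Real.norm_eq_abs, abs_of_pos Real.pi_pos, mul_one]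
  have h1 := norm_symb_le hkp η
  have h2 : |inner ℝ η x.1| ≤ ‖η‖ * ‖x‖ :=
    (abs_real_inner_le_norm η x.1).trans (by gcongr)
  calc ‖symb kp η‖ * |x.2| + 2 * Real.pi * |inner ℝ η x.1| ≤
      (kp + 2 * Real.pi * ‖η‖) * ‖x‖ + 2 * Real.pi * (‖η‖ * ‖x‖) := by gcongr
    _ = (kp + 4 * Real.pi * ‖η‖) * ‖x‖ := by ring
    _ ≤ (kp + 4 * Real.pi) * (1 + ‖η‖) * ‖x‖ := by
      refine mul_le_mul_of_nonneg_right ?_ (norm_nonneg x)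
      nlinarith [mul_nonneg hkp (norm_nonneg η), Real.pi_pos]

lemma norm_dir_le (i : Fin d ⊕ Unit) : ‖(dir i : Space d)‖ ≤ 1 := by
  rcases i with i | i <;> simp [dir, Prod.norm_def]

lemma norm_dirSymb_le {kp : ℝ} (hkp : 0 ≤ kp) (i : Fin d ⊕ Unit) (η : Horiz d) :
    ‖dirSymb kp i η‖ ≤ (kp + 4 * Real.pi) * (1 + ‖η‖) := by
  refine (ContinuousLinearMap.le_opNorm _ _).trans ?_
  refine (mul_le_of_le_one_right (norm_nonneg _) (norm_dir_le i)).trans (norm_phase_le hkp η)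

lemma measurable_dirSymb (kp : ℝ) (i : Fin d ⊕ Unit) : Measurable (dirSymb kp i) := by
  have := measurable_symb kp (d := d)
  unfold dirSymb
  simp_rw [phase_apply]
  fun_prop

lemma aestronglyMeasurable_phase (kp : ℝ) :
    AEStronglyMeasurable (phase kp : Horiz d → Space d →L[ℝ] ℂ) volume := by
  have h1 := (measurable_symb kp (d := d)).neg.aestronglyMeasurable (μ := volume)
  have h2 : Continuous fun η : Horiz d =>
      Complex.ofRealCLM.comp ((innerSL ℝ η).comp (ContinuousLinearMap.fst ℝ (Horiz d) ℝ)) :=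
    continuous_const.clm_comp ((innerSL ℝ).continuous.clm_comp continuous_const)
  exact (h1.smul_const _).add (h2.const_smul (2 * Real.pi * Complex.I : ℂ)).aestronglyMeasurable

lemma wave_eq_exp_phase (kp H : ℝ) (x : Space d) (η : Horiz d) :
    wave kp H x η = Complex.exp (phase kp η x + H * symb kp η) := by
  rw [wave, phase_apply, real_inner_comm]
  congr 1
  push_cast
  ring

lemma hasFDerivAt_wave (kp H : ℝ) (x : Space d) (η : Horiz d) :
    HasFDerivAt (fun x => wave kp H x η) (wave kp H x η • phase kp η) x := by
  simp_rw [wave_eq_exp_phase]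
  exact ((phase kp η).hasFDerivAt.add_const _).cexp

lemma norm_wave_le_one {kp H : ℝ} {x : Space d} (hx : x ∈ U d H) (η : Horiz d) :
    ‖wave kp H x η‖ ≤ 1 := by
  rw [norm_wave]
  exact damp_le_one kp (sub_nonneg.2 (le_of_lt hx)) η

variable {G : Horiz d → ℂ}

/-- The derivative of a superposition of plane waves. -/
def superposeDeriv (kp H : ℝ) (G : Horiz d → ℂ) (x : Space d) : Space d →L[ℝ] ℂ :=
  ∫ η, (wave kp H x η * G η) • phase kp η

lemma aestronglyMeasurable_wave_mul (kp H : ℝ) (hG : AEStronglyMeasurable G volume) (x : Space d) :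
    AEStronglyMeasurable (fun η => wave kp H x η * G η) volume :=
  ((measurable_wave kp H).comp measurable_prodMk_left).aestronglyMeasurable.mul hG

lemma norm_wave_smul_phase_le {kp H : ℝ} (hkp : 0 ≤ kp) {x : Space d} (hx : x ∈ U d H)
    (η : Horiz d) : ‖(wave kp H x η * G η) • phase kp η‖ ≤
      (kp + 4 * Real.pi) * ((1 + ‖η‖) * ‖G η‖) := by
  rw [norm_smul, norm_mul]
  calc _ ≤ 1 * ‖G η‖ * ((kp + 4 * Real.pi) * (1 + ‖η‖)) := by
        gcongr
        · exact norm_wave_le_one hx η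
        · exact norm_phase_le hkp η
    _ = _ := by ring

lemma integrable_wave_smul_phase {kp H : ℝ} (hkp : 0 ≤ kp) (hG : AEStronglyMeasurable G volume)
    (hGi : Integrable fun η => (1 + ‖η‖) * ‖G η‖) {x : Space d} (hx : x ∈ U d H) :
    Integrable (fun η => (wave kp H x η * G η) • phase kp η) :=
  (hGi.const_mul (kp + 4 * Real.pi)).mono'
    ((aestronglyMeasurable_wave_mul kp H hG x).smul (aestronglyMeasurable_phase kp))
    (.of_forall fun η => norm_wave_smul_phase_le hkp hx η)

lemma integrable_of_weighted (hG : AEStronglyMeasurable G volume)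
    (hGi : Integrable fun η => (1 + ‖η‖) * ‖G η‖) : Integrable G :=
  hGi.mono' hG (.of_forall fun η => le_mul_of_one_le_left (norm_nonneg _)
    (by linarith [norm_nonneg η]))

/-- Plane waves have modulus at most `1` in `U_H` and phase of size `O(1 + |η|)`, so the weighted
integrability of `G` dominates the derivative uniformly up to `Γ_H`. -/
lemma hasFDerivAt_superpose {kp H : ℝ} (hkp : 0 ≤ kp) (hG : AEStronglyMeasurable G volume)
    (hGi : Integrable fun η => (1 + ‖η‖) * ‖G η‖) {x : Space d} (hx : x ∈ U d H) :
    HasFDerivAt (superpose kp H (fun _ => 1) G) (superposeDeriv kp H G x) x := by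
  have e : superpose kp H (fun _ => 1) G = fun x => ∫ η, wave kp H x η * G η := by
    funext x
    simp [superpose]
  rw [e]
  refine hasFDerivAt_integral_of_dominated_of_fderiv_le (s := U d H)
    (bound := fun η => (kp + 4 * Real.pi) * ((1 + ‖η‖) * ‖G η‖))
    (F' := fun x η => (wave kp H x η * G η) • phase kp η)
    ((isOpen_U H).mem_nhds hx)
    (.of_forall fun x => aestronglyMeasurable_wave_mul kp H hG x) ?_
    (integrable_wave_smul_phase hkp hG hGi hx).1
    (.of_forall fun η x hx => norm_wave_smul_phase_le hkp hx η)
    (hGi.const_mul _) (.of_forall fun η x hx => ?_)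
  · refine (integrable_of_weighted hG hGi).norm.mono' (aestronglyMeasurable_wave_mul kp H hG x)
      (.of_forall fun η => ?_)
    rw [norm_mul]
    exact mul_le_of_le_one_left (norm_nonneg _) (norm_wave_le_one hx η)
  · have h := (hasFDerivAt_wave kp H x η).mul_const (G η)
    refine h.congr_fderiv ?_
    rw [smul_smul, mul_comm]

lemma continuousOn_superposeDeriv {kp H : ℝ} (hkp : 0 ≤ kp) (hG : AEStronglyMeasurable G volume)
    (hGi : Integrable fun η => (1 + ‖η‖) * ‖G η‖) :
    ContinuousOn (superposeDeriv kp H G) (U d H) := by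
  refine continuousOn_of_dominated (bound := fun η => (kp + 4 * Real.pi) * ((1 + ‖η‖) * ‖G η‖))
    (fun x hx => (integrable_wave_smul_phase hkp hG hGi hx).1)
    (fun x hx => .of_forall fun η => norm_wave_smul_phase_le hkp hx η) (hGi.const_mul _)
    (.of_forall fun η => ?_)
  have hc : Continuous fun x : Space d => wave kp H x η :=
    continuous_iff_continuousAt.2 fun x => (hasFDerivAt_wave kp H x η).continuousAt
  exact ((hc.mul continuous_const).smul continuous_const).continuousOn

lemma contDiffOn_superpose {kp H : ℝ} (hkp : 0 ≤ kp) (hG : AEStronglyMeasurable G volume)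
    (hGi : Integrable fun η => (1 + ‖η‖) * ‖G η‖) :
    ContDiffOn ℝ 1 (superpose kp H (fun _ => 1) G) (U d H) := by
  rw [show (1 : WithTop ℕ∞) = 0 + 1 by simp, contDiffOn_succ_iff_fderiv_of_isOpen (isOpen_U H)]
  refine ⟨fun x hx => (hasFDerivAt_superpose hkp hG hGi hx).differentiableAt.differentiableWithinAt,
    by simp, ?_⟩
  rw [contDiffOn_zero]
  exact (continuousOn_superposeDeriv hkp hG hGi).congr fun x hx =>
    (hasFDerivAt_superpose hkp hG hGi hx).fderiv

lemma pd_superpose {kp H : ℝ} (hkp : 0 ≤ kp) (hG : AEStronglyMeasurable G volume)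
    (hGi : Integrable fun η => (1 + ‖η‖) * ‖G η‖) (i : Fin d ⊕ Unit) {x : Space d}
    (hx : x ∈ U d H) :
    pd i (superpose kp H (fun _ => 1) G) x = superpose kp H (dirSymb kp i) G x := by
  rw [pd, (hasFDerivAt_superpose hkp hG hGi hx).fderiv, superposeDeriv,
    ContinuousLinearMap.integral_apply (integrable_wave_smul_phase hkp hG hGi hx), superpose]
  refine integral_congr_ae (.of_forall fun η => ?_)
  simp only [dirSymb, smul_apply, smul_eq_mul]
  ring

/-- Mean value inequality on the convex half-plane `Re ≤ 0`, where the derivative of `exp` has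
modulus at most `1`. -/
lemma norm_exp_sub_one_le_of_re_nonpos {w : ℂ} (hw : w.re ≤ 0) : ‖Complex.exp w - 1‖ ≤ ‖w‖ := by
  have h := (convex_halfSpace_re_le 0).norm_image_sub_le_of_norm_hasDerivWithin_le
    (f := Complex.exp) (f' := Complex.exp) (C := 1) (x := 0) (y := w)
    (fun z _ => (Complex.hasDerivAt_exp z).hasDerivWithinAt)
    (fun z hz => by
      rw [Complex.norm_exp, Real.exp_le_one_iff]
      exact hz) (by simp) hw
  simpa using h

/-- A superposition of plane waves is close to its boundary values. -/
lemma norm_superpose_sub_le {kp H : ℝ} (hG : AEStronglyMeasurable G volume) (hkp : 0 ≤ kp)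
    (hGi : Integrable fun η => (1 + ‖η‖) * ‖G η‖) {x : Space d} (hx : x ∈ U d H) :
    ‖superpose kp H (fun _ => 1) G x -
        ∫ η, ((Real.fourierChar (inner ℝ x.1 η) : Circle) : ℂ) * G η‖ ≤
      ((kp + 2 * Real.pi) * ∫ η, (1 + ‖η‖) * ‖G η‖) * (x.2 - H) := by
  have hx0 : 0 < x.2 - H := sub_pos.2 hx
  have hGI := integrable_of_weighted hG hGi
  have h1 : Integrable (fun η => 1 * wave kp H x η * G η) := by
    simp_rw [one_mul]
    refine hGI.norm.mono' (aestronglyMeasurable_wave_mul kp H hG x) (.of_forall fun η => ?_)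
    rw [norm_mul]
    exact mul_le_of_le_one_left (norm_nonneg _) (norm_wave_le_one hx η)
  have h2 : Integrable (fun η => ((Real.fourierChar (inner ℝ x.1 η) : Circle) : ℂ) * G η) := by
    refine hGI.norm.mono' (AEStronglyMeasurable.mul ?_ hG) (.of_forall fun η => ?_)
    · have h1 : Continuous fun η : Horiz d => (inner ℝ x.1 η : ℝ) := by fun_prop
      exact (continuous_induced_dom.comp
        (Real.continuous_fourierChar.comp h1)).aestronglyMeasurable
    · rw [norm_mul, Circle.norm_coe, one_mul]
  rw [superpose, ← integral_sub h1 h2, mul_right_comm, ← integral_const_mul]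
  refine norm_integral_le_of_norm_le (hGi.const_mul _) (.of_forall fun η => ?_)
  have e : 1 * wave kp H x η * G η - ((Real.fourierChar (inner ℝ x.1 η) : Circle) : ℂ) * G η =
      (Complex.exp (-((x.2 - H : ℝ) : ℂ) * symb kp η) - 1) *
        (((Real.fourierChar (inner ℝ x.1 η) : Circle) : ℂ) * G η) := by
    have := wave_eq_mul kp H x.1 η x.2
    rw [Prod.mk.eta] at this
    rw [this]
    ring
  rw [e, norm_mul, norm_mul, Circle.norm_coe, one_mul]
  have h3 : ‖Complex.exp (-((x.2 - H : ℝ) : ℂ) * symb kp η) - 1‖ ≤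
      (x.2 - H) * ((kp + 2 * Real.pi) * (1 + ‖η‖)) := by
    refine (norm_exp_sub_one_le_of_re_nonpos ?_).trans ?_
    · rw [← Complex.ofReal_neg, Complex.re_ofReal_mul]
      nlinarith [symb_re_nonneg kp η]
    · rw [norm_mul, norm_neg, Complex.norm_real, Real.norm_of_nonneg hx0.le]
      refine mul_le_mul_of_nonneg_left ((norm_symb_le hkp η).trans ?_) hx0.le
      nlinarith [mul_nonneg hkp (norm_nonneg η), Real.pi_pos]
  calc _ ≤ (x.2 - H) * ((kp + 2 * Real.pi) * (1 + ‖η‖)) * ‖G η‖ := by gcongr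
    _ = _ := by ring

lemma IsTest.integrable_weighted_hat (h : IsTest Ω φ) (H : ℝ) :
    Integrable fun η => (1 + ‖η‖) * ‖hat φ η H‖ := by
  have h0 := (𝓕 (h.slice H) : SchwartzMap (Horiz d) ℂ).integrable_pow_mul volume 0
  have h1 := (𝓕 (h.slice H) : SchwartzMap (Horiz d) ℂ).integrable_pow_mul volume 1
  refine (h0.add h1).congr (.of_forall fun η => ?_)
  simp only [Pi.add_apply, h.fourier_slice]
  ring

lemma IsTest.fourierInv_hat (h : IsTest Ω φ) (H : ℝ) (y : Horiz d) :
    ∫ η, ((Real.fourierChar (inner ℝ y η) : Circle) : ℂ) * hat φ η H = φ (y, H) := by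
  have h1 : (𝓕⁻ (𝓕 (h.slice H) : SchwartzMap (Horiz d) ℂ) : SchwartzMap (Horiz d) ℂ) = h.slice H :=
    FourierTransform.fourierInv_fourier_eq _
  have h2 := DFunLike.congr_fun h1 y
  rw [SchwartzMap.fourierInv_coe, Real.fourierInv_eq] at h2
  rw [← h.slice_apply, ← h2]
  refine integral_congr_ae (.of_forall fun η => ?_)
  simp only [h.fourier_slice, Circle.smul_def, smul_eq_mul, real_inner_comm]

/-- Used to compare `φ` just above `Γ_H` with its trace, with an error linear in the distance. -/
lemma IsTest.exists_vertical_lipschitz (h : IsTest Ω φ) : ∃ C, 0 ≤ C ∧ ∀ (y : Horiz d) (s t : ℝ),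
    ‖φ (y, t) - φ (y, s)‖ ≤ C * |t - s| := by
  obtain ⟨C, R, hC0, -, hC, -⟩ := (h.pderiv (Sum.inr ())).bound
  refine ⟨C, hC0, fun y s t => ?_⟩
  exact convex_univ.norm_image_sub_le_of_norm_hasDerivWithin_le
    (f := fun t => φ (y, t)) (fun r _ => (h.hasDerivAt_slice y r).hasDerivWithinAt)
    (fun r _ => hC (y, r)) (Set.mem_univ s) (Set.mem_univ t)

/-! ### Cut off superpositions -/

lemma eLpNorm_cut_superpose_le {kp H T : ℝ} (hkp : 0 ≤ kp) {m : Horiz d → ℂ} (hm : Measurable m)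
    (hGm : Measurable G) (hG : MemLp G 2 volume) {C M : ℝ} (hmC : ∀ η, ‖m η‖ ≤ C * (1 + ‖η‖))
    {ζ : Space d → ℂ} (hζ : ∀ x, ‖ζ x‖ ≤ M) (hζT : ∀ x : Space d, H + T ≤ x.2 → ζ x = 0) :
    eLpNorm (fun x => ζ x * superpose kp H m G x) 2 (volume.restrict (U d H)) ≤
      ENNReal.ofReal M * (ENNReal.ofReal (C * Real.exp (T * (kp + 1))) *
        eLpNorm G 2 (halfMeasure d)) := by
  have hms : MeasurableSet {x : Space d | x.2 ∈ Set.Ioo H (H + T)} :=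
    measurable_snd measurableSet_Ioo
  refine le_trans ?_ (mul_le_mul_right (eLpNorm_superpose_le hkp H T hm hGm hG hmC) _)
  rw [← eLpNorm_indicator_eq_eLpNorm_restrict hms,
    ← eLpNorm_indicator_eq_eLpNorm_restrict (isOpen_U H).measurableSet]
  refine eLpNorm_le_mul_eLpNorm_of_ae_le_mul (.of_forall fun x => ?_) 2
  by_cases hx : x ∈ U d H
  · rw [Set.indicator_of_mem hx]
    by_cases hxT : x.2 < H + T
    · rw [Set.indicator_of_mem (show x ∈ {x : Space d | x.2 ∈ Set.Ioo H (H + T)} from ⟨hx, hxT⟩),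
        norm_mul]
      gcongr
      exact hζ x
    · rw [hζT x (not_lt.1 hxT), zero_mul, norm_zero]
      have := (norm_nonneg _).trans (hζ x)
      positivity
  · rw [Set.indicator_of_notMem hx, norm_zero]
    have := (norm_nonneg _).trans (hζ x)
    positivity

lemma memLp_cut_superpose {kp H T : ℝ} (hkp : 0 ≤ kp) {m : Horiz d → ℂ} (hm : Measurable m)
    (hGm : Measurable G) (hG : MemLp G 2 (halfMeasure d)) {C M : ℝ}
    (hmC : ∀ η, ‖m η‖ ≤ C * (1 + ‖η‖)) {ζ : Space d → ℂ} (hζc : Continuous ζ)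
    (hζ : ∀ x, ‖ζ x‖ ≤ M) (hζT : ∀ x : Space d, H + T ≤ x.2 → ζ x = 0) :
    MemLp (fun x => ζ x * superpose kp H m G x) 2 (volume.restrict (U d H)) := by
  refine ⟨(hζc.measurable.mul (measurable_superpose kp H hm hGm)).aestronglyMeasurable, ?_⟩
  refine (eLpNorm_cut_superpose_le hkp hm hGm (hG.mono_measure volume_le_halfMeasure) hmC hζ
    hζT).trans_lt ?_
  exact ENNReal.mul_lt_top ENNReal.ofReal_lt_top
    (ENNReal.mul_lt_top ENNReal.ofReal_lt_top hG.2)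

lemma superpose_sub {kp H : ℝ} (hkp : 0 ≤ kp) {m G G' : Horiz d → ℂ} (hm : Measurable m)
    (hG : MemLp G 2 volume) (hG' : MemLp G' 2 volume) {C : ℝ}
    (hmC : ∀ η, ‖m η‖ ≤ C * (1 + ‖η‖)) {x : Space d} (hx : x ∈ U d H) :
    superpose kp H m (fun η => G η - G' η) x = superpose kp H m G x - superpose kp H m G' x := by
  rw [superpose, superpose, superpose, ← integral_sub (integrable_wave_mul hkp hx hG hm hmC)
    (integrable_wave_mul hkp hx hG' hm hmC)]
  refine integral_congr_ae (.of_forall fun η => ?_)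
  dsimp only
  ring

end RoughLayer

end

noncomputable section

namespace RoughLayer

variable {d : ℕ} {D Ω : Set (Space d)} {φ : Space d → ℂ}

/-! ### Extension by zero from the half-space and gluing -/

/-- A test function of `U_H` is one of `D` and vanishes outside `U_H` as the indicator does, so the
approximation errors over `D` and `U_H` coincide. -/
lemma ApproxH1.extend_zero {H : ℝ} (hU : U d H ⊆ D) {q : Space d → ℂ}
    {q' : Fin d ⊕ Unit → Space d → ℂ} (h : ApproxH1 (U d H) (U d H) q q') :
    ApproxH1 D D ((U d H).indicator q) (fun i => (U d H).indicator (q' i)) := by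
  have hms := (isOpen_U (d := d) H).measurableSet
  have hr : ∀ f : Space d → ℂ, eLpNorm ((U d H).indicator f) 2 (volume.restrict D) =
      eLpNorm f 2 (volume.restrict (U d H)) := fun f => by
    rw [eLpNorm_indicator_eq_eLpNorm_restrict hms, Measure.restrict_restrict hms,
      Set.inter_eq_self_of_subset_left hU]
  have hmem : ∀ {f : Space d → ℂ}, MemLp f 2 (volume.restrict (U d H)) →
      MemLp ((U d H).indicator f) 2 (volume.restrict D) := fun hf => by
    rw [memLp_indicator_iff_restrict hms, Measure.restrict_restrict hms,
      Set.inter_eq_self_of_subset_left hU]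
    exact hf
  have hsub : ∀ {ψ : Space d → ℂ} (f : Space d → ℂ), IsTest (U d H) ψ →
      (fun x => ψ x - (U d H).indicator f x) = (U d H).indicator (fun x => ψ x - f x) := by
    intro ψ f hψ
    funext x
    by_cases hx : x ∈ U d H
    · simp [hx]
    · simp [hx, hψ.eq_zero hx]
  refine ⟨hmem h.memLp, fun i => hmem (h.memLp' i), fun ε hε => ?_⟩
  obtain ⟨ψ, hψ, h1, h2⟩ := h.approx ε hε
  refine ⟨ψ, hψ.mono hU, ?_, fun i => ?_⟩
  · rw [hsub q hψ, hr]
    exact h1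
  · rw [hsub (q' i) (hψ.pderiv i), hr]
    exact h2 i

/-- The function that equals `f` in the half-space `U_H` and `g` elsewhere. -/
def glue (H : ℝ) (f g : Space d → ℂ) (x : Space d) : ℂ :=
  (U d H).indicator f x + (U d H)ᶜ.indicator g x

lemma glue_of_mem {H : ℝ} {x : Space d} (hx : x ∈ U d H) (f g : Space d → ℂ) :
    glue H f g x = f x := by
  simp [glue, hx]

lemma glue_of_notMem {H : ℝ} {x : Space d} (hx : x ∉ U d H) (f g : Space d → ℂ) :
    glue H f g x = g x := by
  simp [glue, hx]

lemma glue_sub (H : ℝ) (f g f' g' : Space d → ℂ) (x : Space d) :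
    glue H f g x - glue H f' g' x = glue H (fun x => f x - f' x) (fun x => g x - g' x) x := by
  by_cases hx : x ∈ U d H
  · simp only [glue_of_mem hx]
  · simp only [glue_of_notMem hx]

lemma memLp_glue {H : ℝ} {f g : Space d → ℂ} (hf : MemLp f 2 (volume.restrict (U d H)))
    (hg : MemLp g 2 (volume.restrict D)) : MemLp (glue H f g) 2 (volume.restrict D) := by
  have hms := (isOpen_U (d := d) H).measurableSet
  refine MemLp.add ?_ (hg.indicator hms.compl)
  rw [memLp_indicator_iff_restrict hms, Measure.restrict_restrict hms]
  exact hf.mono_measure (Measure.restrict_mono_set _ Set.inter_subset_left)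

lemma eLpNorm_glue_le {H : ℝ} {f g : Space d → ℂ}
    (hf : AEStronglyMeasurable f (volume.restrict (U d H)))
    (hg : AEStronglyMeasurable g (volume.restrict D)) :
    eLpNorm (glue H f g) 2 (volume.restrict D) ≤
      eLpNorm f 2 (volume.restrict (U d H)) + eLpNorm g 2 (volume.restrict D) := by
  have hms := (isOpen_U (d := d) H).measurableSet
  have hle : (volume.restrict D).restrict (U d H) ≤
      (volume : Measure (Space d)).restrict (U d H) := by
    rw [Measure.restrict_restrict hms]
    exact Measure.restrict_mono_set _ Set.inter_subset_left
  refine (eLpNorm_add_le ?_ (hg.indicator hms.compl) (by norm_num)).trans (add_le_add ?_ ?_)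
  · exact (aestronglyMeasurable_indicator_iff hms).2 (hf.mono_measure hle)
  · rw [eLpNorm_indicator_eq_eLpNorm_restrict hms]
    exact eLpNorm_mono_measure _ hle
  · exact eLpNorm_indicator_le g

/-! ### The cut off plane wave representation -/

/-- A smooth function of the height, equal to `1` up to height `T` and to `0` above `T + 1`. -/
def heightCut (T : ℝ) (x : Space d) : ℂ := (Real.smoothTransition (T + 1 - x.2) : ℂ)

lemma contDiff_heightCut (T : ℝ) : ContDiff ℝ ∞ (heightCut T : Space d → ℂ) :=
  Complex.ofRealCLM.contDiff.comp
    (Real.smoothTransition.contDiff.comp (contDiff_const.sub contDiff_snd))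

lemma heightCut_eq_one {T : ℝ} {x : Space d} (hx : x.2 ≤ T) : heightCut T x = 1 := by
  rw [heightCut, Real.smoothTransition.one_of_one_le (by linarith), Complex.ofReal_one]

lemma heightCut_eq_zero {T : ℝ} {x : Space d} (hx : T + 1 ≤ x.2) : heightCut T x = 0 := by
  rw [heightCut, Real.smoothTransition.zero_of_nonpos (by linarith), Complex.ofReal_zero]

lemma norm_heightCut_le (T : ℝ) (x : Space d) : ‖heightCut T x‖ ≤ 1 := by
  rw [heightCut, Complex.norm_real, Real.norm_of_nonneg (Real.smoothTransition.nonneg _)]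
  exact Real.smoothTransition.le_one _

lemma pd_heightCut (T : ℝ) (x : Space d) (i : Fin d ⊕ Unit) :
    pd i (heightCut T) x = 0 ∨
      pd i (heightCut T) x = ((-deriv Real.smoothTransition (T + 1 - x.2) : ℝ) : ℂ) := by
  have h : HasDerivAt (fun t : ℝ => ((Real.smoothTransition (T + 1 - t) : ℝ) : ℂ))
      ((-deriv Real.smoothTransition (T + 1 - x.2) : ℝ) : ℂ) x.2 := by
    have h1 : HasDerivAt Real.smoothTransition (deriv Real.smoothTransition (T + 1 - x.2))
        (T + 1 - x.2) :=
      (Real.smoothTransition.contDiff.differentiable (n := 1) (by simp) _).hasDerivAt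
    have h2 := (h1.comp_const_sub (T + 1) x.2).ofReal_comp
    simpa using h2
  rcases i with i | i
  · exact Or.inl ((pd_vertical h).1 i)
  · exact Or.inr (pd_vertical h).2

/-- The height `T + 2`, not `T + 1`, leaves room for a neighbourhood on which the cutoff vanishes.
-/
lemma pd_heightCut_eq_zero {T : ℝ} {x : Space d} (hx : T + 2 ≤ x.2) (i : Fin d ⊕ Unit) :
    pd i (heightCut T) x = 0 := by
  rcases pd_heightCut T x i with h | h
  · exact h
  · have h1 : Real.smoothTransition =ᶠ[𝓝 (T + 1 - x.2)] fun _ => 0 := by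
      filter_upwards [Iio_mem_nhds (show T + 1 - x.2 < 0 by linarith)] with r hr
      exact Real.smoothTransition.zero_of_nonpos (le_of_lt hr)
    rw [h, h1.deriv_eq, deriv_const, neg_zero, Complex.ofReal_zero]

lemma exists_norm_pd_heightCut_le (d : ℕ) (T : ℝ) :
    ∃ M : ℝ, 0 ≤ M ∧ ∀ (i : Fin d ⊕ Unit) (x : Space d), ‖pd i (heightCut T) x‖ ≤ M := by
  obtain ⟨M, hM0, hM⟩ := smoothTransition_deriv_bound
  refine ⟨M, hM0, fun i x => ?_⟩
  rcases pd_heightCut T x i with h | h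
  · simpa [h] using hM0
  · rw [h, Complex.norm_real, norm_neg]
    exact hM _

/-- The plane wave representation, cut off at the height `T`. -/
def cutWave (kp H T : ℝ) (G : Horiz d → ℂ) (x : Space d) : ℂ :=
  heightCut T x * superpose kp H (fun _ => 1) G x

/-- The partial derivatives of the cut off plane wave representation. -/
def cutWaveDeriv (kp H T : ℝ) (G : Horiz d → ℂ) (i : Fin d ⊕ Unit) (x : Space d) : ℂ :=
  heightCut T x * superpose kp H (dirSymb kp i) G x +
    pd i (heightCut T) x * superpose kp H (fun _ => 1) G x

lemma one_le_weight (η : Horiz d) : ‖(1 : ℂ)‖ ≤ 1 * (1 + ‖η‖) := by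
  rw [norm_one]
  linarith [norm_nonneg η]

/-- The cut off plane wave representation is bounded in `H¹` by the `H^{1/2}` norm of its
density. -/
lemma exists_cutWave_bound (d : ℕ) {kp : ℝ} (hkp : 0 ≤ kp) (H T : ℝ) :
    ∃ K : ℝ≥0∞, K ≠ ⊤ ∧ ∀ G : Horiz d → ℂ, Measurable G → MemLp G 2 (halfMeasure d) →
      MemLp (cutWave kp H T G) 2 (volume.restrict (U d H)) ∧
      (∀ i, MemLp (cutWaveDeriv kp H T G i) 2 (volume.restrict (U d H))) ∧
      eLpNorm (cutWave kp H T G) 2 (volume.restrict (U d H)) ≤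
        K * eLpNorm G 2 (halfMeasure d) ∧
      ∀ i, eLpNorm (cutWaveDeriv kp H T G i) 2 (volume.restrict (U d H)) ≤
        K * eLpNorm G 2 (halfMeasure d) := by
  obtain ⟨M, hM0, hM⟩ := exists_norm_pd_heightCut_le d T
  have hT1 : ∀ x : Space d, H + (T + 2 - H) ≤ x.2 → heightCut T x = 0 := fun x hx =>
    heightCut_eq_zero (by linarith)
  have hT2 : ∀ (i : Fin d ⊕ Unit) (x : Space d), H + (T + 2 - H) ≤ x.2 →
      pd i (heightCut T) x = 0 := fun i x hx => pd_heightCut_eq_zero (by linarith) i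
  have hc := (contDiff_heightCut (d := d) T).continuous
  have hc' : ∀ i, Continuous (pd i (heightCut T : Space d → ℂ)) := fun i =>
    ((contDiff_heightCut T).continuous_fderiv (by simp)).clm_apply continuous_const
  set E := Real.exp ((T + 2 - H) * (kp + 1))
  set k1 := ENNReal.ofReal 1 * ENNReal.ofReal (1 * E)
  set k2 := ENNReal.ofReal 1 * ENNReal.ofReal ((kp + 4 * Real.pi) * E)
  set k3 := ENNReal.ofReal M * ENNReal.ofReal (1 * E)
  refine ⟨k1 + (k2 + k3), ?_, fun G hGm hG => ?_⟩
  · have h : ∀ a b : ℝ, ENNReal.ofReal a * ENNReal.ofReal b ≠ ⊤ := fun a b =>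
      ENNReal.mul_ne_top ENNReal.ofReal_ne_top ENNReal.ofReal_ne_top
    exact ENNReal.add_ne_top.2 ⟨h _ _, ENNReal.add_ne_top.2 ⟨h _ _, h _ _⟩⟩
  have hG2 := hG.mono_measure volume_le_halfMeasure
  have m1 := memLp_cut_superpose (H := H) (T := T + 2 - H) hkp measurable_const hGm hG
    one_le_weight hc (norm_heightCut_le T) hT1
  have m2 := fun i => memLp_cut_superpose (H := H) (T := T + 2 - H) hkp (measurable_dirSymb kp i)
    hGm hG (norm_dirSymb_le hkp i) hc (norm_heightCut_le T) hT1
  have m3 := fun i => memLp_cut_superpose (H := H) (T := T + 2 - H) hkp measurable_const hGm hG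
    one_le_weight (hc' i) (hM i) (hT2 i)
  have e1 := eLpNorm_cut_superpose_le (H := H) (T := T + 2 - H) hkp measurable_const hGm hG2
    one_le_weight (norm_heightCut_le T) hT1
  have e2 := fun i => eLpNorm_cut_superpose_le (H := H) (T := T + 2 - H) hkp
    (measurable_dirSymb kp i) hGm hG2 (norm_dirSymb_le hkp i) (norm_heightCut_le T) hT1
  have e3 := fun i => eLpNorm_cut_superpose_le (H := H) (T := T + 2 - H) hkp measurable_const hGm
    hG2 one_le_weight (hM i) (hT2 i)
  simp only [← mul_assoc] at e1 e2 e3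
  refine ⟨m1, fun i => (m2 i).add (m3 i), ?_, fun i => ?_⟩
  · exact e1.trans (mul_le_mul_left le_self_add _)
  · refine (eLpNorm_add_le (m2 i).1 (m3 i).1 (by norm_num)).trans
      ((add_le_add (e2 i) (e3 i)).trans ?_)
    rw [← add_mul]
    exact mul_le_mul_left le_add_self _

/-- Linearity in the density is available only in `U_H`, where the integrals are known to converge.
-/
lemma cutWave_sub {kp H : ℝ} (hkp : 0 ≤ kp) (T : ℝ) {G G' : Horiz d → ℂ}
    (hG : MemLp G 2 volume) (hG' : MemLp G' 2 volume) {x : Space d} (hx : x ∈ U d H) :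
    cutWave kp H T G x - cutWave kp H T G' x = cutWave kp H T (fun η => G η - G' η) x := by
  rw [cutWave, cutWave, cutWave, superpose_sub hkp measurable_const hG hG' one_le_weight hx]
  ring

lemma cutWaveDeriv_sub {kp H : ℝ} (hkp : 0 ≤ kp) (T : ℝ) {G G' : Horiz d → ℂ}
    (hG : MemLp G 2 volume) (hG' : MemLp G' 2 volume) (i : Fin d ⊕ Unit) {x : Space d}
    (hx : x ∈ U d H) :
    cutWaveDeriv kp H T G i x - cutWaveDeriv kp H T G' i x =
      cutWaveDeriv kp H T (fun η => G η - G' η) i x := by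
  rw [cutWaveDeriv, cutWaveDeriv, cutWaveDeriv,
    superpose_sub hkp measurable_const hG hG' one_le_weight hx,
    superpose_sub hkp (measurable_dirSymb kp i) hG hG' (norm_dirSymb_le hkp i) hx]
  ring

lemma measurable_hat (h : IsTest Ω φ) (H : ℝ) : Measurable fun η => hat φ η H :=
  (h.continuous_hat.comp (by fun_prop : Continuous fun η : Horiz d => (η, H))).measurable

/-- The plane wave extension of a test function is a limit of test functions. -/
lemma IsTest.approxH1_glue (hD : IsOpen D) {kp H : ℝ} (hkp : 0 ≤ kp) (hU : U d H ⊆ D)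
    {T : ℝ} (hT : H + 1 ≤ T) (h : IsTest D φ) :
    ApproxH1 D D (glue H (cutWave kp H T fun η => hat φ η H) φ)
      (fun i => glue H (cutWaveDeriv kp H T (fun η => hat φ η H) i) (pd i φ)) := by
  obtain ⟨K, -, hK⟩ := exists_cutWave_bound d hkp H T
  have hGm := measurable_hat h H
  obtain ⟨m1, m2, -, -⟩ := hK _ hGm (h.memLp_hat_half hD H)
  have hGs := hGm.aestronglyMeasurable (μ := volume)
  have hGi := h.integrable_weighted_hat H
  have hcs := contDiffOn_superpose (H := H) hkp hGs hGi
  have hcut : ContDiff ℝ 1 (heightCut T : Space d → ℂ) := (contDiff_heightCut T).of_le (by simp)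
  have hφ1 : ContDiff ℝ 1 φ := h.smooth.of_le (by simp)
  -- Both terms have the boundary values `φ(·, H)` on `Γ_H`, the first by Fourier inversion, so `q`
  -- vanishes there.
  set q : Space d → ℂ := fun x => cutWave kp H T (fun η => hat φ η H) x - φ x with hq
  have hqc : ContDiffOn ℝ 1 q (U d H) := (hcut.contDiffOn.mul hcs).sub hφ1.contDiffOn
  have hpd : ∀ i, ∀ x ∈ U d H,
      pd i q x = cutWaveDeriv kp H T (fun η => hat φ η H) i x - pd i φ x := by
    intro i x hx
    have hd1 := (hasFDerivAt_superpose hkp hGs hGi hx).differentiableAt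
    have hd2 : DifferentiableAt ℝ (heightCut T : Space d → ℂ) x :=
      hcut.differentiable (by simp) x
    have hd3 : DifferentiableAt ℝ (cutWave kp H T fun η => hat φ η H) x := hd2.mul hd1
    rw [hq, pd_sub i hd3 (h.differentiable x)]
    congr 1
    change pd i (fun x => heightCut T x * superpose kp H (fun _ => 1) (fun η => hat φ η H) x) x = _
    rw [pd_mul i hd2 hd1, pd_superpose hkp hGs hGi i hx, cutWaveDeriv]
  have hpd' : ∀ i, (fun x => cutWaveDeriv kp H T (fun η => hat φ η H) i x - pd i φ x)
      =ᵐ[volume.restrict (U d H)] pd i q := fun i => by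
    filter_upwards [ae_restrict_mem (isOpen_U H).measurableSet] with x hx
    rw [hpd i x hx]
  obtain ⟨a, -, ha⟩ := h.exists_height H
  obtain ⟨L, hL0, hL⟩ := h.exists_vertical_lipschitz
  have hq1 : ApproxH1 (U d H) (U d H) q (fun i => pd i q) := by
    -- Above this height both terms of `q` vanish. The constant adds the rate at which the plane
    -- waves leave their boundary values to the vertical Lipschitz constant of `φ`.
    refine approxH1_halfspace (T := max a (T + 1))
      (C := (kp + 2 * Real.pi) * (∫ η, (1 + ‖η‖) * ‖hat φ η H‖) + L) hqc (m1.sub (h.memLp _))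
      (fun i => ((m2 i).sub ((h.pderiv i).memLp _)).ae_eq (hpd' i)) (fun x _ hx => ?_)
      (fun x hx hx1 => ?_)
    · simp only [hq, cutWave, ha x ((le_max_left _ _).trans hx.le),
        heightCut_eq_zero ((le_max_right _ _).trans hx.le), zero_mul, sub_zero]
    · have h1 := norm_superpose_sub_le hGs hkp hGi hx
      rw [h.fourierInv_hat] at h1
      have h2 := hL x.1 x.2 H
      rw [abs_sub_comm, abs_of_pos (sub_pos.2 hx)] at h2
      have h3 : q x = superpose kp H (fun _ => 1) (fun η => hat φ η H) x - φ x := by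
        simp only [hq, cutWave, heightCut_eq_one (show x.2 ≤ T by linarith), one_mul]
      rw [h3, add_mul]
      calc _ = ‖(superpose kp H (fun _ => 1) (fun η => hat φ η H) x - φ (x.1, H)) +
            (φ (x.1, H) - φ (x.1, x.2))‖ := by simp
        _ ≤ _ := (norm_add_le _ _).trans (add_le_add h1 h2)
  -- The glued function is `φ` plus the extension by zero of `q`.
  have hq2 := (hq1.congr (ae_eq_refl _) fun i => (hpd' i).symm).extend_zero hU
  refine (hq2.add (ApproxH1.of_test h D)).congr (.of_forall fun x => ?_)
    fun i => .of_forall fun x => ?_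
  · by_cases hx : x ∈ U d H
    · simp [glue_of_mem hx, hx, hq]
    · simp [glue_of_notMem hx, hx]
  · by_cases hx : x ∈ U d H
    · simp [glue_of_mem hx, hx]
    · simp [glue_of_notMem hx, hx]

lemma tendsto_glue {H : ℝ} {f g : ℕ → Space d → ℂ} {f₀ g₀ : Space d → ℂ}
    (hf : ∀ m, MemLp (f m) 2 (volume.restrict (U d H))) (hf₀ : MemLp f₀ 2 (volume.restrict (U d H)))
    (hg : ∀ m, MemLp (g m) 2 (volume.restrict D)) (hg₀ : MemLp g₀ 2 (volume.restrict D))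
    (h1 : Tendsto (fun m => eLpNorm (fun x => f m x - f₀ x) 2 (volume.restrict (U d H)))
      atTop (𝓝 0))
    (h2 : Tendsto (fun m => eLpNorm (fun x => g m x - g₀ x) 2 (volume.restrict D)) atTop (𝓝 0)) :
    Tendsto (fun m => eLpNorm (fun x => glue H (f m) (g m) x - glue H f₀ g₀ x) 2
      (volume.restrict D)) atTop (𝓝 0) := by
  have h3 := h1.add h2
  rw [add_zero] at h3
  refine tendsto_of_tendsto_of_tendsto_of_le_of_le tendsto_const_nhds h3 (fun _ => zero_le)
    fun m => ?_
  simp_rw [glue_sub]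
  exact eLpNorm_glue_le ((hf m).sub hf₀).1 ((hg m).sub hg₀).1

/-- The plane wave extension, cut off at a finite height, of a function in `V_H` belongs to
`H_0^1(D)`. -/
lemma MemH10.memH10_glue (hD : IsOpen D) {kp H : ℝ} (hkp : 0 ≤ kp) (hU : U d H ⊆ D)
    {T : ℝ} (hT : H + 1 ≤ T) {w u : Space d → ℂ} (hu : MemH10 D u)
    (hw : w =ᵐ[volume.restrict (S D H)] u) :
    MemH10 D (glue H
      (cutWave kp H T (𝓕 (trace D H w) : Lp ℂ 2 (volume : Measure (Horiz d)))) u) := by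
  have hwV : MemV D H w := ⟨u, hu, hw⟩
  obtain ⟨K, hKt, hK⟩ := exists_cutWave_bound d hkp H T
  have ha := hu.approxH1
  -- One sequence serves both sides: it approximates `u` on `D`, and its traces approximate that of
  -- `w` in `H^{1/2}`, which controls the plane waves above.
  obtain ⟨φ, hφ, h1, h2⟩ := ha.exists_seq
  have hS := Measure.restrict_mono_set (volume : Measure (Space d)) (S_subset D H)
  have hwd : ∀ i, weakDeriv D i u =ᵐ[volume.restrict (S D H)] weakDeriv (S D H) i w :=
    ((ha.mono (S_subset D H)).congr hw.symm fun i => ae_eq_refl _).weakDeriv_ae_eq (isOpen_S hD H)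
  have hlim : TendstoH1 (S D H) φ w := by
    refine ⟨?_, fun i => ?_⟩
    · refine tendsto_of_tendsto_of_tendsto_of_le_of_le tendsto_const_nhds h1 (fun _ => zero_le)
        fun m => (eLpNorm_congr_ae ?_).trans_le (eLpNorm_mono_measure _ hS)
      filter_upwards [hw] with x hx
      rw [hx]
    · refine tendsto_of_tendsto_of_tendsto_of_le_of_le tendsto_const_nhds (h2 i)
        (fun _ => zero_le) fun m => (eLpNorm_congr_ae ?_).trans_le (eLpNorm_mono_measure _ hS)
      filter_upwards [hwd i] with x hx
      rw [hx]
  obtain ⟨hF, hFlim⟩ := tendsto_hat_trace hD hwV hφ hlim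
  set F : Horiz d → ℂ := fun η =>
    (𝓕 (trace D H w) : Lp ℂ 2 (volume : Measure (Horiz d))) η with hFdef
  have hFm : Measurable F := (Lp.stronglyMeasurable _).measurable
  have hF2 := hF.mono_measure volume_le_halfMeasure
  have hGm := fun m => measurable_hat (hφ m) H
  have hG := fun m => (hφ m).memLp_hat_half hD H
  have hG2 := fun m => (hG m).mono_measure volume_le_halfMeasure
  have hlimK : Tendsto (fun m => K * eLpNorm (fun η => hat (φ m) η H - F η) 2 (halfMeasure d))
      atTop (𝓝 0) := by
    simpa using ENNReal.Tendsto.const_mul hFlim (Or.inr hKt)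
  -- The bound is applied to the difference of densities; by linearity in `U_H` it measures the
  -- difference of the extensions.
  have hd := fun m => hK _ ((hGm m).sub hFm) ((hG m).sub hF)
  have m1 := fun m => hK _ (hGm m) (hG m)
  have m2 := hK _ hFm hF
  have c1 : Tendsto (fun m => eLpNorm (fun x => cutWave kp H T (fun η => hat (φ m) η H) x -
      cutWave kp H T F x) 2 (volume.restrict (U d H))) atTop (𝓝 0) := by
    refine tendsto_of_tendsto_of_tendsto_of_le_of_le tendsto_const_nhds hlimK (fun _ => zero_le)
      fun m => (eLpNorm_congr_ae ?_).trans_le (hd m).2.2.1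
    filter_upwards [ae_restrict_mem (isOpen_U H).measurableSet] with x hx
    exact cutWave_sub hkp T (hG2 m) hF2 hx
  have c2 : ∀ i, Tendsto (fun m => eLpNorm (fun x =>
      cutWaveDeriv kp H T (fun η => hat (φ m) η H) i x - cutWaveDeriv kp H T F i x) 2
      (volume.restrict (U d H))) atTop (𝓝 0) := fun i => by
    refine tendsto_of_tendsto_of_tendsto_of_le_of_le tendsto_const_nhds hlimK (fun _ => zero_le)
      fun m => (eLpNorm_congr_ae ?_).trans_le ((hd m).2.2.2 i)
    filter_upwards [ae_restrict_mem (isOpen_U H).measurableSet] with x hx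
    exact cutWaveDeriv_sub hkp T (hG2 m) hF2 i hx
  have t1 := tendsto_glue (fun m => (m1 m).1) m2.1 (fun m => (hφ m).memLp _) ha.memLp c1 h1
  have t2 := fun i => tendsto_glue (fun m => (m1 m).2.1 i) (m2.2.1 i)
    (fun m => ((hφ m).pderiv i).memLp _) (ha.memLp' i) (c2 i) (h2 i)
  refine (ApproxH1.of_approx (memLp_glue m2.1 ha.memLp)
    (fun i => memLp_glue (m2.2.1 i) (ha.memLp' i)) fun ε hε => ?_).memH10 hD
  have e1 := t1.eventually (Iic_mem_nhds hε)
  have e2 := eventually_all.2 fun i => (t2 i).eventually (Iic_mem_nhds hε)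
  obtain ⟨m, hm1, hm2⟩ := (e1.and e2).exists
  exact ⟨_, _, (hφ m).approxH1_glue hD hkp hU hT, hm1, hm2⟩

/-- The plane wave extension of a function in `V_H` is locally in `H_0^1`. -/
lemma MemV.memV_extendSol (hD : IsOpen D) {kp H : ℝ} (hkp : 0 ≤ kp) (hU : U d H ⊆ D)
    {w : Space d → ℂ} (hw : MemV D H w) (a : ℝ) : MemV D a (extendSol D H kp w) := by
  obtain ⟨u, hu, hwu⟩ := hw
  -- Cutting at height `max (H + 1) a` is invisible in `S_a`, and leaves the unit layer above `Γ_H`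
  -- required for the gluing.
  refine ⟨_, hu.memH10_glue hD hkp hU (le_max_left (H + 1) a) hwu, ?_⟩
  have h0 : ∀ᵐ x : Space d, x.2 ≠ H := by
    rw [ae_iff]
    simpa using volume_plane (d := d) H
  have hS := ae_imp_of_ae_restrict hwu
  filter_upwards [ae_restrict_mem (isOpen_S hD a).measurableSet, ae_restrict_of_ae h0,
    ae_restrict_of_ae hS] with x hxa hx0 hxS
  rw [S_eq] at hxa
  by_cases hx : x ∈ U d H
  · rw [glue_of_mem hx, extendSol, if_pos hx, planeWaves_eq, cutWave,
      heightCut_eq_one ((le_of_lt hxa.2).trans (le_max_right _ _)), one_mul, superpose]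
    simp_rw [one_mul]
  · rw [glue_of_notMem hx, extendSol, if_neg hx]
    refine hxS ?_
    rw [S_eq]
    exact ⟨hxa.1, lt_of_le_of_ne (not_lt.1 hx) hx0⟩

end RoughLayer

end

/-! ### Both directions assembled. -/

theorem theorem2p1 (d : ℕ) (hd : d + 1 = 2 ∨ d + 1 = 3)
    (D : Set (RoughLayer.Space d)) (hDo : IsOpen D) (hDc : IsConnected D)
    (fm fp : ℝ) (hf : fm < fp)
    (hD₁ : RoughLayer.U d fp ⊆ D) (hD₂ : D ⊆ RoughLayer.U d fm)
    (H : ℝ) (hH : fp ≤ H) (kp : ℝ) (hkp : 0 < kp) :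
    (∀ g k u : RoughLayer.Space d → ℂ,
      RoughLayer.AdmissibleData D H kp g k →
      RoughLayer.IsBVPSolution D fp H kp g k u →
      RoughLayer.IsVariationalSolution D H kp g k u) ∧
    (∀ g k w : RoughLayer.Space d → ℂ,
      MemLp g 2 (volume.restrict (RoughLayer.S D H)) →
      MemLp k ∞ (volume.restrict (RoughLayer.S D H)) →
      RoughLayer.IsVariationalSolution D H kp g k w →
      RoughLayer.AdmissibleData D H kp
          (RoughLayer.extendG D H g) (RoughLayer.extendK D H kp k) ∧
        RoughLayer.IsBVPSolution D fp H kp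
          (RoughLayer.extendG D H g) (RoughLayer.extendK D H kp k)
          (RoughLayer.extendSol D H kp w)) := by
  refine ⟨fun g k u hgk hu => hu.isVariationalSolution hDo hD₁ hH hkp.le hgk,
    fun g k w hg hk hw => ?_⟩
  have hU : RoughLayer.U d H ⊆ D := fun x hx => hD₁ (lt_of_le_of_lt hH hx)
  have hdata := RoughLayer.admissibleData_extend (kp := kp) hDo hg hk
  exact ⟨hdata, hw.isBVPSolution hDo hD₁ hH hkp.le hdata
    fun a => hw.1.memV_extendSol hDo hkp.le hU a⟩
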